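/- **Setting.** Let $\sigma_1,\sigma_2,\sigma_3$ be the Pauli matrices, $\alpha_k=\begin{pmatrix}0&\sigma_k\\ \sigma_k&0\end{pmatrix}$, $\beta=\begin{pmatrix}\mathbb I_2&0\\0&-\mathbb I_2\end{pmatrix}$, and $\alpha\cdot\nabla=\sum_{k=1}^3\alpha_k\partial_k$. Let $m\ge 0$ and $\epsilon>0$. For a measurable $V:(0,\infty)\to(0,\infty)$ define $$h^+(r)=\frac1{r^2}\int_0^r V(t)\,t^2\,dt,\qquad h^-(r)=r^2\int_r^\infty V(t)\,\frac{dt}{t^2}\qquad(r>0),$$ and write $V=V(|x|)$, $h^\pm=h^\pm(|x|)$ for the corresponding radial functions on $\mathbb R^3$. Throughout, $\psi\in L^2(\mathbb R^3,\mathbb C^4)$ is such that the distribution $\alpha\cdot\nabla\psi$ on $\mathbb R^3$ is a locally integrable function; integrals of non-negative functions may take the value $+\infty$. **Theorem 5.1.** Suppose $\|h^+\|_\infty\le\frac12$ and $\|h^-\|_\infty\le\frac12$. Then, for either choice of the sign and for every such $\psi$, $$\int_{\mathbb R^3}V|\psi|^2\le\int_{\mathbb R^3}V^{-1}\left|(\alpha\cdot\nabla+im\beta\pm\epsilon\,\mathbb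 I_4)\psi\right|^2+\sqrt{m^2+\epsilon^2}\left(\int_{\mathbb R^3}|(h^--h^+)\psi|^2\right)^{1/2}\left(\int_{\mathbb R^3}|\psi|^2\right)^{1/2}.$$ In particular, if $V=\frac1{|x|}$ then $h^+=h^-=\frac12$, and one recovers the following: for either sign and every such $\psi$, $$\int_{\mathbb R^3}\frac1{|x|}|\psi|^2\le\int_{\mathbb R^3}|x|\left|(i\alpha\cdot\nabla-m\beta\pm i\epsilon)\psi\right|^2,$$ and this is sharp: if $C\ge0$ is such that $\int\frac1{|x|}|\psi|^2\le C\int|x||(i\alpha\cdot\nabla-m\beta\pm i\epsilon)\psi|^2$ for all such $\psi$, then $C\ge1$. -/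

import Mathlib

open MeasureTheory Set
open scoped ENNReal NNReal ContDiff

noncomputable section

/-- Physical space `ℝ³` with its Euclidean norm. -/
abbrev Space3 : Type := EuclideanSpace ℝ (Fin 3)

/-- Four-component spinors: `ℂ⁴ = ℂ² ⊕ ℂ²` with its Hermitian norm (upper and lower components). -/
abbrev Spinor : Type := EuclideanSpace ℂ (Fin 2 ⊕ Fin 2)

/-- The Pauli matrices `σ₁, σ₂, σ₃`. -/
def pauli : Fin 3 → Matrix (Fin 2) (Fin 2) ℂ :=
  ![!![0, 1; 1, 0], !![0, -Complex.I; Complex.I, 0], !![1, 0; 0, -1]]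

/-- The Dirac matrices `α₁, α₂, α₃`. -/
def diracAlpha (k : Fin 3) : Matrix (Fin 2 ⊕ Fin 2) (Fin 2 ⊕ Fin 2) ℂ :=
  Matrix.fromBlocks 0 (pauli k) (pauli k) 0

/-- The Dirac matrix `β`. -/
def diracBeta : Matrix (Fin 2 ⊕ Fin 2) (Fin 2 ⊕ Fin 2) ℂ :=
  Matrix.fromBlocks 1 0 0 (-1)

/-- A `4 × 4` matrix acting on a spinor. -/
def matAct (A : Matrix (Fin 2 ⊕ Fin 2) (Fin 2 ⊕ Fin 2) ℂ) (v : Spinor) : Spinor :=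
  WithLp.toLp 2 (A.mulVec v.ofLp)

/-- The partial derivative `∂ₖ φ`. -/
def partialDeriv (k : Fin 3) (φ : Space3 → ℝ) (x : Space3) : ℝ :=
  fderiv ℝ φ x (EuclideanSpace.single k 1)

/-- `G = α · ∇ψ` in the sense of distributions on `ℝ³`, with `ψ` and `G` locally integrable:
`∫ ∑ₖ (∂ₖφ) αₖψ = - ∫ φ G` for every test function `φ`. -/
def HasWeakDirac (ψ G : Space3 → Spinor) : Prop :=
  LocallyIntegrable ψ volume ∧ LocallyIntegrable G volume ∧
    ∀ φ : Space3 → ℝ, ContDiff ℝ ∞ φ → HasCompactSupport φ →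
      ∫ x, ∑ k : Fin 3, partialDeriv k φ x • matAct (diracAlpha k) (ψ x) = -∫ x, φ x • G x

/-- `h⁺(r) = r⁻² ∫₀ʳ V(t) t² dt`, with values in `[0, ∞]` (`V` is positive on `(0, ∞)`). -/
def hPlus (V : ℝ → ℝ) (r : ℝ) : ℝ≥0∞ :=
  ENNReal.ofReal (1 / r ^ 2) * ∫⁻ t in Ioo 0 r, ENNReal.ofReal (V t * t ^ 2)

/-- `h⁻(r) = r² ∫ᵣ^∞ V(t) t⁻² dt`, with values in `[0, ∞]` (`V` is positive on `(0, ∞)`). -/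
def hMinus (V : ℝ → ℝ) (r : ℝ) : ℝ≥0∞ :=
  ENNReal.ofReal (r ^ 2) * ∫⁻ t in Ioi r, ENNReal.ofReal (V t / t ^ 2)

/-- The `L^∞(0, ∞)` norm of a `[0, ∞]`-valued function of the radius. -/
def radialSupNorm (h : ℝ → ℝ≥0∞) : ℝ≥0∞ :=
  essSup h (volume.restrict (Ioi (0 : ℝ)))

/-- `(α · ∇ + i m β + e 𝕀₄) ψ`, where `G = α · ∇ψ`. -/
def massiveDirac (m e : ℝ) (ψ G : Space3 → Spinor) (x : Space3) : Spinor :=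
  G x + (Complex.I * (m : ℂ)) • matAct diracBeta (ψ x) + (e : ℂ) • ψ x

/-- `(i α · ∇ - m β + i e 𝕀₄) ψ`, where `G = α · ∇ψ`. -/
def massiveDirac' (m e : ℝ) (ψ G : Space3 → Spinor) (x : Space3) : Spinor :=
  Complex.I • G x - (m : ℂ) • matAct diracBeta (ψ x) + ((e : ℂ) * Complex.I) • ψ x

end

noncomputable section

/-! The bound `∫ V|ψ|² ≤ ∫ V⁻¹|(α·∇ + imβ ± ε)ψ|²` already holds without the second summand on the
right, which is simply dropped at the end. It is reduced to a one-dimensional inequality on every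
pair of spherical modes, and that inequality is proved with an explicit quadratic multiplier.

Separation of variables: on the unit sphere the fields `P` and `(α·x)P`, with `P` a homogeneous
polynomial satisfying `α·∇P = 0` (monogenic) and an eigenvector of `β`, give a Hilbert basis
(`sphBasis`). Completeness comes from the Fischer decomposition `homPoly_eq_fischerSpan` and
Stone-Weierstrass; orthogonality between degrees comes from the radial equations themselves. The
Dirac operator couples only the two members of a pair. After multiplication by `r` and by one unit
phase, which absorbs both the sign of `ε` and the mass term, real and imaginary parts each solve `G'
+ kG/r + μF = D₁`, `F' - kF/r + μG = D₂`, with `k = l + 1` and `μ = √(m² + ε²) ≥ 0`.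

The multiplier: put `p = h⁻ - h⁺` and `f = 1 - h⁻ - h⁺`, let `R` be the reflection with entries `cos
f, sin f, sin f, -cos f`, and `M = (sin p + R)/cos p`. Since `R² = 1`, `2 ∂M/∂p = M² + 1`. The
averages satisfy `p' = 2(h⁺ + h⁻)/r - 2V` and `f' = -2p/r`, so for `v = (G, F)` the `V`-part of
`(vᵀMv)'` is exactly `-V|Mv|² - V|v|²`. Completing the square, `V⁻¹|D - V Mv|² ≥ 0`, leaves a form
without `V` (`curvatureForm_nonneg`), whose sign follows from `1 - y ≤ cos y + μr sin y` at `y = f ±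
p`, both in `[0, 1]` because `h^± ≤ 1/2`. Hence `(vᵀMv)' ≤ V⁻¹|D|² - V|v|²`
(`ae_deriv_multiplierForm_le`). Integrating gives the radial inequality, since `v` becomes small
along radii tending to `0` and along radii tending to infinity (`exists_small_near_zero`,
`exists_small_near_infinity`).

Summing over modes uses Parseval for `ψ` and Bessel for its image. The Coulomb case is `V = 1/r`.
Sharpness is seen on `χ(|x|)v` with `χ(r) = g(log r / L)/r`: as `L → ∞` the support moves into the
origin, where mass and energy terms are negligible, and the logarithmic dilation makes the
derivative of `g` negligible too. -/

/-! ### Pointwise inequality for the multiplier -/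

/-- A real binary quadratic form with non-negative diagonal and zero determinant is non-negative. -/
lemma quadForm_nonneg_of_mul_eq_sq {x y z : ℝ} (hx : 0 ≤ x) (hy : 0 ≤ y) (h : x * y = z ^ 2)
    (G F : ℝ) : 0 ≤ x * G ^ 2 + 2 * z * (G * F) + y * F ^ 2 := by
  rcases hx.eq_or_lt with rfl | hx
  · have : z = 0 := by simpa using h.symm
    subst this
    simp only [zero_mul, mul_zero, zero_add]
    positivity
  · have h1 : 0 ≤ x * (x * G ^ 2 + 2 * z * (G * F) + y * F ^ 2) := by
      have : x * (x * G ^ 2 + 2 * z * (G * F) + y * F ^ 2) = (x * G + z * F) ^ 2 := by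
        linear_combination F ^ 2 * h
      rw [this]; positivity
    exact nonneg_of_mul_nonneg_right h1 hx

/-- The curvature form of the multiplier is non-negative. Here `c, sp` and `cf, sf` are the cosines
and sines of two angles `p` and `f`. -/
lemma curvatureForm_nonneg {k ρ c sp cf sf s p : ℝ} (hk : 1 ≤ k) (hc : 0 < c)
    (h1 : c ^ 2 + sp ^ 2 = 1) (h2 : cf ^ 2 + sf ^ 2 = 1) (hcf : |sp| ≤ cf)
    (hα : s + p ≤ (cf * c + sf * sp) + ρ * (sf * c - cf * sp))
    (hβ : s - p ≤ (cf * c - sf * sp) + ρ * (sf * c + cf * sp)) (G F : ℝ) :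
    0 ≤ (c * (k * (sp + cf) + ρ * sf) - s * (1 + sp * cf) - p * sf * c) * G ^ 2
      + 2 * (c * (p * cf + ρ * sp) - s * sf * sp) * (G * F)
      + (c * (k * (cf - sp) + ρ * sf) - s * (1 - sp * cf) + p * sf * c) * F ^ 2 := by
  obtain ⟨h3, h4⟩ := abs_le.1 hcf
  have cβ : (sf * c + cf * sp) ^ 2 + (cf * c - sf * sp) ^ 2 = 1 := by
    linear_combination (cf ^ 2 + sf ^ 2) * h1 + h2
  have cα : (sf * c - cf * sp) ^ 2 + (cf * c + sf * sp) ^ 2 = 1 := by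
    linear_combination (cf ^ 2 + sf ^ 2) * h1 + h2
  have bβ := abs_le.1 ((sq_le_one_iff_abs_le_one (sf * c + cf * sp)).1 (by nlinarith))
  have bα := abs_le.1 ((sq_le_one_iff_abs_le_one (sf * c - cf * sp)).1 (by nlinarith))
  have q1 := quadForm_nonneg_of_mul_eq_sq (x := 1 + (sf * c + cf * sp))
    (y := 1 - (sf * c + cf * sp)) (z := -(cf * c - sf * sp)) (by linarith) (by linarith)
    (by linear_combination (-1 : ℝ) * cβ) G F
  have q2 := quadForm_nonneg_of_mul_eq_sq (x := 1 - (sf * c - cf * sp))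
    (y := 1 + (sf * c - cf * sp)) (z := cf * c + sf * sp) (by linarith) (by linarith)
    (by linear_combination (-1 : ℝ) * cα) G F
  -- The pairing is crossed: the slack at the angle `f - p` multiplies the degenerate form built
  -- from `f + p`, and conversely in `t2`.
  have t1 := mul_nonneg (sub_nonneg.2 hα) q1
  have t2 := mul_nonneg (sub_nonneg.2 hβ) q2
  -- The case `k = 1` is the critical one; the excess `k - 1` contributes a diagonal form,
  -- non-negative because `|sin p| ≤ cos f`.
  have t3 : 0 ≤ (k - 1) * c * ((sp + cf) * G ^ 2 + (cf - sp) * F ^ 2) := by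
    have : 0 ≤ sp + cf := by linarith
    have : 0 ≤ cf - sp := by linarith
    have : 0 ≤ k - 1 := by linarith
    positivity
  refine le_of_le_of_eq (add_nonneg (add_nonneg t1 t2) (mul_nonneg zero_le_two t3) |> fun h =>
    div_nonneg h (zero_le_two (α := ℝ))) ?_
  linear_combination (c * sp * G ^ 2 + 2 * ρ * sp * c * (G * F) - c * sp * F ^ 2) * h2

/-- The pointwise inequality behind the one-dimensional estimate. -/
lemma multiplier_pointwise {r k μ V c sp cf sf s p G F G' F' : ℝ} (hr : 0 < r) (hV : 0 < V)
    (hk : 1 ≤ k) (hc : 0 < c)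
    (h1 : c ^ 2 + sp ^ 2 = 1) (h2 : cf ^ 2 + sf ^ 2 = 1) (hcf : |sp| ≤ cf)
    (hα : s + p ≤ (cf * c + sf * sp) + μ * r * (sf * c - cf * sp))
    (hβ : s - p ≤ (cf * c - sf * sp) + μ * r * (sf * c + cf * sp)) :
    ((2 * s / r - 2 * V) * (1 + sp * cf) / c ^ 2 + (2 * p / r) * sf / c) * G ^ 2
      + 2 * ((2 * s / r - 2 * V) * (sf * sp) / c ^ 2 - (2 * p / r) * cf / c) * (G * F)
      + ((2 * s / r - 2 * V) * (1 - sp * cf) / c ^ 2 - (2 * p / r) * sf / c) * F ^ 2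
      + (2 * ((sp + cf) / c) * (G * G') + 2 * (sf / c) * (G' * F + G * F')
        + 2 * ((sp - cf) / c) * (F * F')) ≤
    V⁻¹ * ((G' + k * G / r + μ * F) ^ 2 + (F' - k * F / r + μ * G) ^ 2)
      - V * (G ^ 2 + F ^ 2) := by
  have key := curvatureForm_nonneg (ρ := μ * r) hk hc h1 h2 hcf hα hβ G F
  obtain ⟨x, hx⟩ : ∃ x, x = G' + k * G / r + μ * F := ⟨_, rfl⟩
  obtain ⟨y, hy⟩ : ∃ y, y = F' - k * F / r + μ * G := ⟨_, rfl⟩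
  have hG : G' = x - k * G / r - μ * F := by linarith
  have hF : F' = y + k * F / r - μ * G := by linarith
  rw [← hx, ← hy, hG, hF]
  -- `(m, n) = M (G, F)`; the square below is completed around `(x, y) = V (m, n)`.
  obtain ⟨m, hm⟩ : ∃ m, m = ((sp + cf) * G + sf * F) / c := ⟨_, rfl⟩
  obtain ⟨n, hn⟩ : ∃ n, n = (sf * G + (sp - cf) * F) / c := ⟨_, rfl⟩
  have sq1 : 0 ≤ V⁻¹ * ((x - V * m) ^ 2 + (y - V * n) ^ 2) := by positivity
  have sq2 : V⁻¹ * ((x - V * m) ^ 2 + (y - V * n) ^ 2) =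
      V⁻¹ * (x ^ 2 + y ^ 2) - 2 * (x * m + y * n) + V * (m ^ 2 + n ^ 2) := by
    field_simp; ring
  have key2 := div_nonneg (mul_nonneg zero_le_two key) (by positivity : 0 ≤ r * c ^ 2)
  rw [sq2] at sq1
  refine sub_nonneg.1 (le_of_le_of_eq (add_nonneg sq1 key2) ?_)
  rw [hm, hn]
  -- The defect of `M² + 1 = 2 ∂M/∂p` before the two Pythagorean identities are used; with this zero
  -- term inserted, the rest is a rational identity.
  have h3 : V * (G ^ 2 + F ^ 2) / c ^ 2 * ((c ^ 2 + sp ^ 2 - 1) + (cf ^ 2 + sf ^ 2 - 1)) = 0 := by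
    rw [h1, h2]; simp
  rw [← sub_eq_zero, ← h3]
  field_simp
  ring

/-- From `cos y ≥ 1 - y²/2 ≥ 1 - y` on `[0, 1]` and `sin y ≥ 0` there. Both hypotheses of the
curvature estimate are instances of it, and a non-negative mass only helps. -/
lemma one_sub_le_cos_add_mul_sin {y ρ : ℝ} (hy : 0 ≤ y) (hy' : y ≤ 1) (hρ : 0 ≤ ρ) :
    1 - y ≤ Real.cos y + ρ * Real.sin y := by
  have h1 : 0 ≤ Real.sin y := Real.sin_nonneg_of_nonneg_of_le_pi hy (by linarith [Real.pi_gt_three])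
  have h2 := Real.one_sub_sq_div_two_le_cos (x := y)
  have : 0 ≤ ρ * Real.sin y := mul_nonneg hρ h1
  nlinarith

/-! ### Absolutely continuous functions on the half-line -/

/-- Composition of an absolutely continuous function with a `C¹` function. -/
lemma AbsolutelyContinuousOnInterval.comp_contDiffOn {f φ : ℝ → ℝ} {x y a b : ℝ}
    (hf : AbsolutelyContinuousOnInterval f x y) (hφ : ContDiffOn ℝ 1 φ (Icc a b))
    (hfm : ∀ t ∈ uIcc x y, f t ∈ Icc a b) :
    AbsolutelyContinuousOnInterval (fun t => φ (f t)) x y := by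
  obtain ⟨K, hK⟩ := hφ.exists_lipschitzOnWith (by decide) (convex_Icc _ _) isCompact_Icc
  rw [absolutelyContinuousOnInterval_iff] at hf ⊢
  intro ε hε
  obtain ⟨δ, hδ, h⟩ := hf (ε / (K + 1)) (by positivity)
  refine ⟨δ, hδ, fun E hE hE' => ?_⟩
  have h2 := h E hE hE'
  calc ∑ i ∈ Finset.range E.1, dist (φ (f (E.2 i).1)) (φ (f (E.2 i).2))
      ≤ ∑ i ∈ Finset.range E.1, (K + 1) * dist (f (E.2 i).1) (f (E.2 i).2) := by
        refine Finset.sum_le_sum fun i hi => ?_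
        have := hK.dist_le_mul _ (hfm _ (hE.1 i hi).1) _ (hfm _ (hE.1 i hi).2)
        nlinarith [dist_nonneg (x := f (E.2 i).1) (y := f (E.2 i).2)]
    _ = (K + 1) * ∑ i ∈ Finset.range E.1, dist (f (E.2 i).1) (f (E.2 i).2) :=
        (Finset.mul_sum _ _ _).symm
    _ < (K + 1) * (ε / (K + 1)) := by gcongr
    _ = ε := by field

/-- `u` is a primitive of the locally integrable function `u'` on `(0, ∞)`. -/
def IsACPrimitive (u u' : ℝ → ℝ) : Prop :=
  ∀ x y : ℝ, 0 < x → 0 < y → IntervalIntegrable u' volume x y ∧ u y - u x = ∫ t in x..y, u' t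

lemma uIcc_subset_Ioi {x y : ℝ} (hx : 0 < x) (hy : 0 < y) : uIcc x y ⊆ Ioi 0 := fun _ ht =>
  lt_of_lt_of_le (lt_min hx hy) ht.1

lemma AbsolutelyContinuousOnInterval.congr_uIcc {f g : ℝ → ℝ} {x y : ℝ}
    (hf : AbsolutelyContinuousOnInterval f x y) (h : ∀ t ∈ uIcc x y, g t = f t) :
    AbsolutelyContinuousOnInterval g x y := by
  rw [absolutelyContinuousOnInterval_iff] at hf ⊢
  intro ε hε
  obtain ⟨δ, hδ, H⟩ := hf ε hε
  refine ⟨δ, hδ, fun E hE hE' => ?_⟩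
  refine lt_of_eq_of_lt (Finset.sum_congr rfl fun i hi => ?_) (H E hE hE')
  rw [h _ (hE.1 i hi).1, h _ (hE.1 i hi).2]

namespace IsACPrimitive

variable {u u' : ℝ → ℝ}

lemma absolutelyContinuous (h : IsACPrimitive u u') {x y : ℝ} (hx : 0 < x) (hy : 0 < y) :
    AbsolutelyContinuousOnInterval u x y := by
  have h1 := (h x y hx hy).1.absolutelyContinuousOnInterval_intervalIntegral
    (c := x) left_mem_uIcc
  have h2 : AbsolutelyContinuousOnInterval (fun _ : ℝ => u x) x y :=
    (contDiff_const (n := 1)).contDiffOn.absolutelyContinuousOnInterval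
  refine (h2.fun_add h1).congr_uIcc fun t ht => ?_
  rw [← (h x t hx (uIcc_subset_Ioi hx hy ht)).2]
  ring

lemma ae_hasDerivAt (h : IsACPrimitive u u') :
    ∀ᵐ t : ℝ, 0 < t → HasDerivAt u (u' t) t := by
  -- Lebesgue differentiation is available on compact intervals, so `(0, ∞)` is exhausted by
  -- countably many of them.
  have key : ∀ n : ℕ, ∀ᵐ t : ℝ, t ∈ Ioo ((n : ℝ) + 1)⁻¹ (n + 1) → HasDerivAt u (u' t) t := by
    intro n
    have hn : (0 : ℝ) < (n : ℝ) + 1 := by positivity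
    have hn' : (0 : ℝ) < ((n : ℝ) + 1)⁻¹ := by positivity
    filter_upwards [(h _ _ hn' hn).1.ae_hasDerivAt_integral] with t ht htm
    have ht' : t ∈ uIcc ((n : ℝ) + 1)⁻¹ (n + 1) := Icc_subset_uIcc (Ioo_subset_Icc_self htm)
    have h1 := (ht ht' _ left_mem_uIcc).const_add (u ((n : ℝ) + 1)⁻¹)
    refine h1.congr_of_eventuallyEq ?_
    filter_upwards [Ioi_mem_nhds (hn'.trans htm.1)] with s hs
    rw [← (h _ s hn' hs).2]
    ring
  filter_upwards [ae_all_iff.2 key] with t ht hpos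
  obtain ⟨n, hn⟩ := exists_nat_gt (max t t⁻¹)
  refine ht n ⟨?_, (le_max_left _ _).trans_lt (hn.trans (by linarith))⟩
  rw [inv_lt_comm₀ (by positivity) hpos]
  exact (le_max_right _ _).trans_lt (hn.trans (by linarith))

lemma continuousOn (h : IsACPrimitive u u') {x y : ℝ} (hx : 0 < x) (hy : 0 < y) :
    ContinuousOn u (uIcc x y) := (h.absolutelyContinuous hx hy).continuousOn

end IsACPrimitive

/-! ### The averages of the weight and the angles -/

/-- The two radial averages of the weight are at most `1 / 2`, in terms of Bochner integrals. -/
structure AveragesLeHalf (V : ℝ → ℝ) : Prop where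
  measurable : Measurable V
  pos : ∀ r, 0 < r → 0 < V r
  integrableOn_plus : ∀ r, 0 < r → IntegrableOn (fun t => V t * t ^ 2) (Ioc 0 r)
  plus_le : ∀ r, 0 < r → ∫ t in Ioc 0 r, V t * t ^ 2 ≤ r ^ 2 / 2
  integrableOn_minus : ∀ r, 0 < r → IntegrableOn (fun t => V t / t ^ 2) (Ioi r)
  minus_le : ∀ r, 0 < r → ∫ t in Ioi r, V t / t ^ 2 ≤ 1 / (2 * r ^ 2)

namespace AveragesLeHalf

variable {V : ℝ → ℝ} (hV : AveragesLeHalf V)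
include hV

lemma intervalIntegrable {x y : ℝ} (hx : 0 < x) (hy : 0 < y) :
    IntervalIntegrable V volume x y := by
  have h0 := uIcc_subset_Ioi hx hy
  have h1 : IntervalIntegrable (fun t => V t * t ^ 2) volume x y := by
    rw [intervalIntegrable_iff]
    exact (hV.integrableOn_plus (max x y) (lt_max_of_lt_left hx)).mono_set fun t ht =>
      ⟨h0 (uIoc_subset_uIcc ht), ht.2⟩
  have h2 : IntervalIntegrable (fun t => V t * t ^ 2 * (t ^ 2)⁻¹) volume x y := by
    refine h1.mul_continuousOn (ContinuousOn.inv₀ (by fun_prop) fun t ht => ?_)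
    have := h0 ht
    exact (pow_pos this 2).ne'
  refine h2.congr fun t ht => ?_
  have := h0 (uIoc_subset_uIcc ht)
  have : t ≠ 0 := ne_of_gt this
  field_simp

end AveragesLeHalf

/-- Twice the lower average `h⁺`, as a real number. -/
def avgPlus (V : ℝ → ℝ) (r : ℝ) : ℝ := 2 * (r ^ 2)⁻¹ * ∫ t in Ioc 0 r, V t * t ^ 2

/-- Twice the upper average `h⁻`, as a real number. -/
def avgMinus (V : ℝ → ℝ) (r : ℝ) : ℝ := 2 * r ^ 2 * ∫ t in Ioi r, V t / t ^ 2

namespace AveragesLeHalf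

variable {V : ℝ → ℝ} (hV : AveragesLeHalf V)
include hV

lemma avgPlus_mem {r : ℝ} (hr : 0 < r) : 0 ≤ avgPlus V r ∧ avgPlus V r ≤ 1 := by
  have h1 : 0 ≤ ∫ t in Ioc 0 r, V t * t ^ 2 := setIntegral_nonneg measurableSet_Ioc fun t ht => by
    have := hV.pos t ht.1
    positivity
  refine ⟨by unfold avgPlus; positivity, ?_⟩
  have h2 := hV.plus_le r hr
  calc avgPlus V r ≤ 2 * (r ^ 2)⁻¹ * (r ^ 2 / 2) := by unfold avgPlus; gcongr
    _ = 1 := by field_simp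

lemma avgMinus_mem {r : ℝ} (hr : 0 < r) : 0 ≤ avgMinus V r ∧ avgMinus V r ≤ 1 := by
  have h1 : 0 ≤ ∫ t in Ioi r, V t / t ^ 2 := setIntegral_nonneg measurableSet_Ioi fun t ht => by
    have := hV.pos t (hr.trans ht)
    positivity
  refine ⟨by unfold avgMinus; positivity, ?_⟩
  have h2 := hV.minus_le r hr
  calc avgMinus V r ≤ 2 * r ^ 2 * (1 / (2 * r ^ 2)) := by unfold avgMinus; gcongr
    _ = 1 := by field_simp

lemma isACPrimitive_plus :
    IsACPrimitive (fun r => ∫ t in Ioc 0 r, V t * t ^ 2) (fun t => V t * t ^ 2) := by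
  intro x y hx hy
  have h : ∀ z, 0 < z → IntervalIntegrable (fun t => V t * t ^ 2) volume 0 z := fun z hz =>
    (intervalIntegrable_iff_integrableOn_Ioc_of_le hz.le).2 (hV.integrableOn_plus z hz)
  refine ⟨(h x hx).symm.trans (h y hy), ?_⟩
  simp only [← intervalIntegral.integral_of_le hx.le, ← intervalIntegral.integral_of_le hy.le]
  exact intervalIntegral.integral_interval_sub_left (h y hy) (h x hx)

lemma isACPrimitive_minus :
    IsACPrimitive (fun r => ∫ t in Ioi r, V t / t ^ 2) (fun t => -(V t / t ^ 2)) := by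
  have key : ∀ x y, 0 < x → x ≤ y → IntervalIntegrable (fun t => V t / t ^ 2) volume x y ∧
      (∫ t in Ioi x, V t / t ^ 2) - (∫ t in Ioi y, V t / t ^ 2) = ∫ t in x..y, V t / t ^ 2 := by
    intro x y hx hxy
    have h1 := (hV.integrableOn_minus x hx).mono_set (Ioc_subset_Ioi_self : Ioc x y ⊆ Ioi x)
    refine ⟨(intervalIntegrable_iff_integrableOn_Ioc_of_le hxy).2 h1, ?_⟩
    rw [intervalIntegral.integral_of_le hxy, sub_eq_iff_eq_add, ← setIntegral_union _ measurableSet_Ioi h1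
      (hV.integrableOn_minus y (hx.trans_le hxy)), Ioc_union_Ioi_eq_Ioi hxy]
    exact Ioc_disjoint_Ioi le_rfl
  intro x y hx hy
  rw [intervalIntegral.integral_neg]
  rcases le_total x y with h | h
  · obtain ⟨h1, h2⟩ := key x y hx h
    exact ⟨h1.neg, by rw [← h2]; ring⟩
  · obtain ⟨h1, h2⟩ := key y x hy h
    refine ⟨h1.symm.neg, ?_⟩
    rw [intervalIntegral.integral_symm, neg_neg, ← h2]

lemma absolutelyContinuous_avgPlus {x y : ℝ} (hx : 0 < x) (hy : 0 < y) :
    AbsolutelyContinuousOnInterval (avgPlus V) x y := by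
  have h1 : ContDiffOn ℝ 1 (fun r : ℝ => 2 * (r ^ 2)⁻¹) (uIcc x y) := by
    refine contDiffOn_const.mul (ContDiffOn.inv (by fun_prop) fun t ht => ?_)
    exact (pow_pos (uIcc_subset_Ioi hx hy ht) 2).ne'
  exact h1.absolutelyContinuousOnInterval.fun_mul (hV.isACPrimitive_plus.absolutelyContinuous hx hy)

lemma absolutelyContinuous_avgMinus {x y : ℝ} (hx : 0 < x) (hy : 0 < y) :
    AbsolutelyContinuousOnInterval (avgMinus V) x y := by
  have h1 : ContDiffOn ℝ 1 (fun r : ℝ => 2 * r ^ 2) (uIcc x y) := by fun_prop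
  exact h1.absolutelyContinuousOnInterval.fun_mul (hV.isACPrimitive_minus.absolutelyContinuous hx hy)

/-- Product rule. `V` enters the derivatives of `avgPlus` and `avgMinus` with opposite signs: it
cancels in their sum, hence in the angle `f`, and survives in their difference, the angle `p`. -/
lemma ae_hasDerivAt_avgPlus :
    ∀ᵐ t : ℝ, 0 < t → HasDerivAt (avgPlus V) (-(2 * avgPlus V t / t) + 2 * V t) t := by
  filter_upwards [hV.isACPrimitive_plus.ae_hasDerivAt] with t ht h0
  have h1 : HasDerivAt (fun r : ℝ => 2 * (r ^ 2)⁻¹) (2 * (-(2 * t) / (t ^ 2) ^ 2)) t := by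
    have := ((hasDerivAt_pow 2 t).inv (pow_pos h0 2).ne').const_mul 2
    simpa using this
  convert! h1.mul (ht h0) using 1
  unfold avgPlus
  field_simp

lemma ae_hasDerivAt_avgMinus :
    ∀ᵐ t : ℝ, 0 < t → HasDerivAt (avgMinus V) (2 * avgMinus V t / t - 2 * V t) t := by
  filter_upwards [hV.isACPrimitive_minus.ae_hasDerivAt] with t ht h0
  have h1 : HasDerivAt (fun r : ℝ => 2 * r ^ 2) (2 * (2 * t)) t := by
    simpa using (hasDerivAt_pow 2 t).const_mul 2
  convert! h1.mul (ht h0) using 1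
  unfold avgMinus
  field_simp
  ring

end AveragesLeHalf

/-- The angle `p = h⁻ - h⁺`. -/
def angleP (V : ℝ → ℝ) (r : ℝ) : ℝ := (avgMinus V r - avgPlus V r) / 2

/-- The angle `f = 1 - h⁻ - h⁺`. -/
def angleF (V : ℝ → ℝ) (r : ℝ) : ℝ := 1 - (avgMinus V r + avgPlus V r) / 2

/-- The quadratic form of the radial multiplier. -/
def multiplierForm (V G F : ℝ → ℝ) (r : ℝ) : ℝ :=
  (Real.sin (angleP V r) + Real.cos (angleF V r)) * (Real.cos (angleP V r))⁻¹ * (G r * G r)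
    + 2 * (Real.sin (angleF V r) * (Real.cos (angleP V r))⁻¹) * (G r * F r)
    + (Real.sin (angleP V r) - Real.cos (angleF V r)) * (Real.cos (angleP V r))⁻¹ * (F r * F r)

namespace AveragesLeHalf

variable {V : ℝ → ℝ} (hV : AveragesLeHalf V)
include hV

lemma angleP_mem {r : ℝ} (hr : 0 < r) : angleP V r ∈ Icc (-(1 / 2) : ℝ) (1 / 2) := by
  have h1 := hV.avgPlus_mem hr
  have h2 := hV.avgMinus_mem hr
  constructor <;> unfold angleP <;> linarith

lemma cos_angleP_pos {r : ℝ} (hr : 0 < r) : 1 / 2 ≤ Real.cos (angleP V r) := by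
  have h := hV.angleP_mem hr
  have h2 := Real.one_sub_sq_div_two_le_cos (x := angleP V r)
  nlinarith [h.1, h.2]

/-- `f + p = 1 - avgPlus` and `f - p = 1 - avgMinus` are at most `1 < π/2`, so `±p ≤ π/2 - f`, and
the sine is increasing on the relevant range. -/
lemma abs_sin_angleP_le {r : ℝ} (hr : 0 < r) :
    |Real.sin (angleP V r)| ≤ Real.cos (angleF V r) := by
  have h1 := hV.avgPlus_mem hr
  have h2 := hV.avgMinus_mem hr
  have hpi := Real.pi_gt_three
  have e : Real.cos (angleF V r) = Real.sin (Real.pi / 2 - angleF V r) :=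
    (Real.sin_pi_div_two_sub _).symm
  rw [abs_le, e]
  constructor
  · rw [← Real.sin_neg]
    apply Real.sin_le_sin_of_le_of_le_pi_div_two <;> simp only [angleP, angleF] <;> linarith
  · apply Real.sin_le_sin_of_le_of_le_pi_div_two <;> simp only [angleP, angleF] <;> linarith

/-- A crude bound for the boundary terms; the constant `8` has no significance, as those terms are
made arbitrarily small. -/
lemma abs_multiplierForm_le (G F : ℝ → ℝ) {r : ℝ} (hr : 0 < r) :
    |multiplierForm V G F r| ≤ 8 * (G r ^ 2 + F r ^ 2) := by
  have hc := hV.cos_angleP_pos hr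
  have hi : (Real.cos (angleP V r))⁻¹ ≤ 2 := by
    rw [inv_le_comm₀ (by linarith) two_pos]; linarith
  have hi0 : 0 ≤ (Real.cos (angleP V r))⁻¹ := by
    rw [inv_nonneg]; linarith
  unfold multiplierForm
  generalize (Real.cos (angleP V r))⁻¹ = i at *
  have a1 := abs_le.1 (Real.abs_sin_le_one (angleP V r))
  have a2 := abs_le.1 (Real.abs_cos_le_one (angleF V r))
  have a3 := abs_le.1 (Real.abs_sin_le_one (angleF V r))
  generalize Real.sin (angleP V r) = x at *
  generalize Real.cos (angleF V r) = y at *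
  generalize Real.sin (angleF V r) = z at *
  have e1 : |(x + y) * i * (G r * G r)| ≤ 2 * 2 * G r ^ 2 := by
    rw [abs_mul, abs_mul, abs_of_nonneg hi0, abs_of_nonneg (mul_self_nonneg (G r)), ← sq]
    have : |x + y| ≤ 2 := abs_le.2 ⟨by linarith, by linarith⟩
    gcongr
  have e2 : |(x - y) * i * (F r * F r)| ≤ 2 * 2 * F r ^ 2 := by
    rw [abs_mul, abs_mul, abs_of_nonneg hi0, abs_of_nonneg (mul_self_nonneg (F r)), ← sq]
    have : |x - y| ≤ 2 := abs_le.2 ⟨by linarith, by linarith⟩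
    gcongr
  have e3 : |2 * (z * i) * (G r * F r)| ≤ 2 * (1 * 2) * ((G r ^ 2 + F r ^ 2) / 2) := by
    rw [abs_mul, abs_mul, abs_mul, abs_of_nonneg hi0, abs_of_pos (two_pos (α := ℝ))]
    have : |z| ≤ 1 := abs_le.2 a3
    have : |G r * F r| ≤ (G r ^ 2 + F r ^ 2) / 2 := by
      rw [abs_le]; constructor <;> nlinarith [sq_nonneg (G r + F r), sq_nonneg (G r - F r)]
    gcongr
  refine (abs_add_three _ _ _).trans ?_
  nlinarith [sq_nonneg (G r), sq_nonneg (F r)]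

end AveragesLeHalf

/-! ### The radial Dirac system -/

/-- A real solution `(G, F)` of the radial Dirac system with angular parameter `k`, mass `μ` and
right-hand side `(D₁, D₂)`, with the integrability of the one-dimensional inequality. -/
structure RadialPair (V : ℝ → ℝ) (k : ℕ) (μ : ℝ) (G F D₁ D₂ : ℝ → ℝ) : Prop where
  one_le : 1 ≤ k
  mass_nonneg : 0 ≤ μ
  primG : IsACPrimitive (fun t => t ^ k * G t) (fun t => t ^ k * (D₁ t - μ * F t))
  primF : IsACPrimitive (fun t => (t ^ k)⁻¹ * F t) (fun t => (t ^ k)⁻¹ * (D₂ t - μ * G t))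
  intG : IntegrableOn (fun t => G t ^ 2) (Ioi 0)
  intF : IntegrableOn (fun t => F t ^ 2) (Ioi 0)
  intD : IntegrableOn (fun t => (V t)⁻¹ * (D₁ t ^ 2 + D₂ t ^ 2)) (Ioi 0)

namespace RadialPair

variable {V : ℝ → ℝ} {k : ℕ} {μ : ℝ} {G F D₁ D₂ : ℝ → ℝ}

lemma absolutelyContinuous_G (h : RadialPair V k μ G F D₁ D₂) {x y : ℝ} (hx : 0 < x) (hy : 0 < y) :
    AbsolutelyContinuousOnInterval G x y := by
  have h1 : ContDiffOn ℝ 1 (fun r : ℝ => (r ^ k)⁻¹) (uIcc x y) :=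
    ContDiffOn.inv (by fun_prop) fun t ht => (pow_pos (mem_Ioi.1 (uIcc_subset_Ioi hx hy ht)) k).ne'
  refine (h1.absolutelyContinuousOnInterval.fun_mul
    (h.primG.absolutelyContinuous hx hy)).congr_uIcc fun t ht => ?_
  have := (pow_pos (mem_Ioi.1 (uIcc_subset_Ioi hx hy ht)) k).ne'
  field_simp

lemma absolutelyContinuous_F (h : RadialPair V k μ G F D₁ D₂) {x y : ℝ} (hx : 0 < x) (hy : 0 < y) :
    AbsolutelyContinuousOnInterval F x y := by
  have h1 : ContDiffOn ℝ 1 (fun r : ℝ => r ^ k) (uIcc x y) := by fun_prop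
  refine (h1.absolutelyContinuousOnInterval.fun_mul
    (h.primF.absolutelyContinuous hx hy)).congr_uIcc fun t ht => ?_
  have := (pow_pos (mem_Ioi.1 (uIcc_subset_Ioi hx hy ht)) k).ne'
  field_simp

lemma ae_hasDerivAt_G (h : RadialPair V k μ G F D₁ D₂) :
    ∀ᵐ t : ℝ, 0 < t → HasDerivAt G (D₁ t - μ * F t - k * G t / t) t := by
  filter_upwards [h.primG.ae_hasDerivAt] with t ht h0
  have hk := h.one_le
  have hp : t ^ k ≠ 0 := (pow_pos h0 k).ne'
  have h1 := ((hasDerivAt_pow k t).inv hp).mul (ht h0)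
  have h2 : HasDerivAt G _ t := h1.congr_of_eventuallyEq <| by
    filter_upwards [Ioi_mem_nhds h0] with s hs
    have : s ^ k ≠ 0 := (pow_pos hs k).ne'
    simp only [Pi.mul_apply, Pi.inv_apply]
    field_simp
  convert! h2 using 1
  obtain ⟨j, rfl⟩ : ∃ j, k = j + 1 := ⟨k - 1, by omega⟩
  simp only [Pi.inv_apply, Nat.add_sub_cancel]
  field_simp
  ring

lemma ae_hasDerivAt_F (h : RadialPair V k μ G F D₁ D₂) :
    ∀ᵐ t : ℝ, 0 < t → HasDerivAt F (D₂ t - μ * G t + k * F t / t) t := by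
  filter_upwards [h.primF.ae_hasDerivAt] with t ht h0
  have hk := h.one_le
  have hp : t ^ k ≠ 0 := (pow_pos h0 k).ne'
  have h1 := (hasDerivAt_pow k t).mul (ht h0)
  have h2 : HasDerivAt F _ t := h1.congr_of_eventuallyEq <| by
    filter_upwards [Ioi_mem_nhds h0] with s hs
    have : s ^ k ≠ 0 := (pow_pos hs k).ne'
    simp only [Pi.mul_apply]
    field_simp
  convert! h2 using 1
  obtain ⟨j, rfl⟩ : ∃ j, k = j + 1 := ⟨k - 1, by omega⟩
  simp only [Nat.add_sub_cancel]
  field_simp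
  ring

/-- This is what allows the derivative bound, known only almost everywhere, to be integrated: sums,
products and smooth functions of absolutely continuous functions, with `cos p` bounded away from
`0`. -/
lemma absolutelyContinuous_multiplierForm (hV : AveragesLeHalf V) (h : RadialPair V k μ G F D₁ D₂)
    {x y : ℝ} (hx : 0 < x) (hy : 0 < y) :
    AbsolutelyContinuousOnInterval (multiplierForm V G F) x y := by
  have hG := h.absolutelyContinuous_G hx hy
  have hF := h.absolutelyContinuous_F hx hy
  have ha := hV.absolutelyContinuous_avgMinus hx hy
  have hb := hV.absolutelyContinuous_avgPlus hx hy
  have hp : AbsolutelyContinuousOnInterval (angleP V) x y :=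
    ((ha.fun_sub hb).const_mul (1 / 2)).congr_uIcc fun t _ => by unfold angleP; ring
  have hc : AbsolutelyContinuousOnInterval (fun _ : ℝ => (1 : ℝ)) x y :=
    (contDiff_const (n := 1)).contDiffOn.absolutelyContinuousOnInterval
  have hf : AbsolutelyContinuousOnInterval (angleF V) x y :=
    (hc.fun_sub ((ha.fun_add hb).const_mul (1 / 2))).congr_uIcc fun t _ => by unfold angleF; ring
  have hpm : ∀ t ∈ uIcc x y, angleP V t ∈ Icc (-(1 / 2) : ℝ) (1 / 2) := fun t ht =>
    hV.angleP_mem (uIcc_subset_Ioi hx hy ht)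
  have hfm : ∀ t ∈ uIcc x y, angleF V t ∈ Icc (0 : ℝ) 1 := fun t ht => by
    have h1 := hV.avgPlus_mem (uIcc_subset_Ioi hx hy ht)
    have h2 := hV.avgMinus_mem (uIcc_subset_Ioi hx hy ht)
    constructor <;> unfold angleF <;> linarith
  have h1 := hp.comp_contDiffOn Real.contDiff_sin.contDiffOn hpm
  have h2 := hf.comp_contDiffOn Real.contDiff_sin.contDiffOn hfm
  have h3 := hf.comp_contDiffOn Real.contDiff_cos.contDiffOn hfm
  have h4 := hp.comp_contDiffOn (φ := fun s => (Real.cos s)⁻¹)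
    (Real.contDiff_cos.contDiffOn.inv fun s hs => by
      have := Real.one_sub_sq_div_two_le_cos (x := s)
      have : 0 < Real.cos s := by nlinarith [hs.1, hs.2]
      exact this.ne') hpm
  exact ((((h1.fun_add h3).fun_mul h4).fun_mul (hG.fun_mul hG)).fun_add
    (((h2.fun_mul h4).const_mul 2).fun_mul (hG.fun_mul hF))).fun_add
    (((h1.fun_sub h3).fun_mul h4).fun_mul (hF.fun_mul hF))

lemma ae_deriv_multiplierForm_le (hV : AveragesLeHalf V) (h : RadialPair V k μ G F D₁ D₂) :
    ∀ᵐ t : ℝ, 0 < t → deriv (multiplierForm V G F) t ≤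
      (V t)⁻¹ * (D₁ t ^ 2 + D₂ t ^ 2) - V t * (G t ^ 2 + F t ^ 2) := by
  filter_upwards [h.ae_hasDerivAt_G, h.ae_hasDerivAt_F, hV.ae_hasDerivAt_avgPlus,
    hV.ae_hasDerivAt_avgMinus] with t hG hF hb ha h0
  have ha := ha h0
  have hb := hb h0
  have hG := hG h0
  have hF := hF h0
  -- `s = h⁺ + h⁻ = 1 - f`.
  obtain ⟨s, hs⟩ : ∃ s, s = (avgMinus V t + avgPlus V t) / 2 := ⟨_, rfl⟩
  have hp : HasDerivAt (angleP V) (2 * s / t - 2 * V t) t := by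
    convert! (ha.sub hb).div_const 2 using 1
    rw [hs]; ring
  have hf : HasDerivAt (angleF V) (-(2 * angleP V t / t)) t := by
    convert! ((ha.add hb).div_const 2).const_sub 1 using 1
    unfold angleP; ring
  have hc : Real.cos (angleP V t) ≠ 0 := by
    have := hV.cos_angleP_pos h0
    exact (by linarith : 0 < Real.cos (angleP V t)).ne'
  have d4 : HasDerivAt (fun r => (Real.cos (angleP V r))⁻¹) _ t := hp.cos.inv hc
  have D := ((((hp.sin.add hf.cos).mul d4).mul (hG.mul hG)).add
    (((hf.sin.mul d4).const_mul 2).mul (hG.mul hF))).add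
    (((hp.sin.sub hf.cos).mul d4).mul (hF.mul hF))
  have D' : HasDerivAt (multiplierForm V G F) _ t := D
  rw [D'.deriv]
  have h2 := hV.avgPlus_mem h0
  have h3 := hV.avgMinus_mem h0
  have hμ : 0 ≤ μ * t := mul_nonneg h.mass_nonneg h0.le
  have core := multiplier_pointwise (r := t) (k := k) (μ := μ) (V := V t)
    (c := Real.cos (angleP V t)) (sp := Real.sin (angleP V t)) (cf := Real.cos (angleF V t))
    (sf := Real.sin (angleF V t)) (s := s) (p := angleP V t) (G := G t) (F := F t)
    (G' := D₁ t - μ * F t - k * G t / t) (F' := D₂ t - μ * G t + k * F t / t) h0 (hV.pos t h0)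
    (by exact_mod_cast h.one_le) (by linarith [hV.cos_angleP_pos h0])
    (Real.cos_sq_add_sin_sq _) (Real.cos_sq_add_sin_sq _) (hV.abs_sin_angleP_le h0)
    (by
      -- Here `s + p = avgMinus = 1 - (f - p)`; in the next hypothesis `s - p = avgPlus = 1 - (f +
      -- p)`.
      have := one_sub_le_cos_add_mul_sin (y := angleF V t - angleP V t) (ρ := μ * t)
        (by unfold angleF angleP; linarith) (by unfold angleF angleP; linarith) hμ
      rw [Real.cos_sub, Real.sin_sub] at this
      refine le_trans (le_of_eq ?_) this
      rw [hs]; unfold angleF angleP; ring)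
    (by
      have := one_sub_le_cos_add_mul_sin (y := angleF V t + angleP V t) (ρ := μ * t)
        (by unfold angleF angleP; linarith) (by unfold angleF angleP; linarith) hμ
      rw [Real.cos_add, Real.sin_add] at this
      refine le_trans (le_of_eq ?_) this
      rw [hs]; unfold angleF angleP; ring)
  refine le_of_eq_of_le ?_ (core.trans (le_of_eq (by ring)))
  have e1 := Real.sin_sq_add_cos_sq (angleP V t)
  simp only [Pi.add_apply, Pi.mul_apply, Pi.sub_apply]
  generalize Real.sin (angleP V t) = sp at *
  generalize Real.cos (angleP V t) = c at *
  generalize Real.sin (angleF V t) = sf at *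
  generalize Real.cos (angleF V t) = cf at *
  -- Differentiating `1 / cos p` produces `sin² p + cos² p` where the pointwise inequality has `1`.
  have h4 : (2 * s / t - 2 * V t) * (G t ^ 2 + F t ^ 2) / c ^ 2 * (sp ^ 2 + c ^ 2 - 1) = 0 := by
    rw [e1]; simp
  rw [← sub_eq_zero, ← h4]
  field_simp
  ring

end RadialPair

/-! ### Boundary values and the one-dimensional inequality -/

lemma exists_mul_le_setIntegral_Ioc {f : ℝ → ℝ} {a b : ℝ} (hab : a < b)
    (hf : IntegrableOn f (Ioc a b)) : ∃ x ∈ Ioc a b, f x * (b - a) ≤ ∫ t in Ioc a b, f t := by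
  obtain ⟨x, hx, h⟩ := exists_le_setAverage (μ := volume) (s := Ioc a b) (by simp [hab])
    (by simp) hf
  refine ⟨x, hx, ?_⟩
  rw [setAverage_eq, smul_eq_mul] at h
  simp only [measureReal_def, Real.volume_Ioc, ENNReal.toReal_ofReal (sub_nonneg.2 hab.le)] at h
  have : 0 < b - a := sub_pos.2 hab
  calc f x * (b - a) ≤ ((b - a)⁻¹ * ∫ t in Ioc a b, f t) * (b - a) := by gcongr
    _ = _ := by field_simp

/-- Young's inequality with a free parameter `τ`. It is applied with `x = t/r` or `x = r/t`, so that
the `V`-term integrates to one of the averages. -/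
lemma abs_mul_le_weighted {V τ : ℝ} (hV : 0 < V) (hτ : 0 < τ) (x D : ℝ) :
    x * |D| ≤ 1 / 2 * (τ * (V * x ^ 2) + τ⁻¹ * (V⁻¹ * D ^ 2)) := by
  have h : 0 ≤ (τ * V * x - |D|) ^ 2 / (τ * V) := by positivity
  have e : (τ * V * x - |D|) ^ 2 / (τ * V)
      = τ * (V * x ^ 2) + τ⁻¹ * (V⁻¹ * D ^ 2) - 2 * (x * |D|) := by
    rw [← sq_abs D]; field_simp; ring
  linarith

namespace RadialPair

variable {V : ℝ → ℝ} {k : ℕ} {μ : ℝ} {G F D₁ D₂ : ℝ → ℝ}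

lemma intervalIntegrable_weighted_sq (hV : AveragesLeHalf V) (h : RadialPair V k μ G F D₁ D₂)
    {x y : ℝ} (hx : 0 < x) (hy : 0 < y) :
    IntervalIntegrable (fun t => V t * (G t ^ 2 + F t ^ 2)) volume x y := by
  refine (hV.intervalIntegrable hx hy).mul_continuousOn ?_
  exact ((h.absolutelyContinuous_G hx hy).continuousOn.pow 2).add
    ((h.absolutelyContinuous_F hx hy).continuousOn.pow 2)

/-- The fundamental theorem of calculus for the multiplier on a compact interval, its end values
being estimated crudely. -/
lemma integral_weighted_sq_le (hV : AveragesLeHalf V) (h : RadialPair V k μ G F D₁ D₂)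
    {x y : ℝ} (hx : 0 < x) (hxy : x ≤ y) :
    ∫ t in x..y, V t * (G t ^ 2 + F t ^ 2) ≤ (∫ t in x..y, (V t)⁻¹ * (D₁ t ^ 2 + D₂ t ^ 2))
      + 8 * (G x ^ 2 + F x ^ 2) + 8 * (G y ^ 2 + F y ^ 2) := by
  have hy := hx.trans_le hxy
  have hq := h.absolutelyContinuous_multiplierForm hV hx hy
  have i1 := h.intervalIntegrable_weighted_sq hV hx hy
  have i2 : IntervalIntegrable (fun t => (V t)⁻¹ * (D₁ t ^ 2 + D₂ t ^ 2)) volume x y :=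
    (intervalIntegrable_iff_integrableOn_Ioc_of_le hxy).2
      (h.intD.mono_set fun t ht => hx.trans ht.1)
  have key : ∫ t in x..y, deriv (multiplierForm V G F) t ≤
      ∫ t in x..y, ((V t)⁻¹ * (D₁ t ^ 2 + D₂ t ^ 2) - V t * (G t ^ 2 + F t ^ 2)) := by
    refine intervalIntegral.integral_mono_ae_restrict hxy hq.intervalIntegrable_deriv (i2.sub i1) ?_
    filter_upwards [ae_restrict_mem measurableSet_Icc,
      ae_restrict_of_ae (h.ae_deriv_multiplierForm_le hV)] with t ht h1
    exact h1 (hx.trans_le ht.1)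
  rw [hq.integral_deriv_eq_sub, intervalIntegral.integral_sub i2 i1] at key
  have b1 := abs_le.1 (hV.abs_multiplierForm_le G F hx)
  have b2 := abs_le.1 (hV.abs_multiplierForm_le G F hy)
  linarith [b1.2, b2.1]

/-- The density controlling the boundary values at the origin. -/
def originDensity (V G F D₁ D₂ : ℝ → ℝ) (t : ℝ) : ℝ :=
  (V t)⁻¹ * (D₁ t ^ 2 + D₂ t ^ 2) + (G t ^ 2 + F t ^ 2 + 1)

lemma integrableOn_originDensity (h : RadialPair V k μ G F D₁ D₂) (r : ℝ) :
    IntegrableOn (originDensity V G F D₁ D₂) (Ioc 0 r) :=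
  (h.intD.mono_set Ioc_subset_Ioi_self).add (((h.intG.mono_set Ioc_subset_Ioi_self).add
    (h.intF.mono_set Ioc_subset_Ioi_self)).add (integrableOn_const (by simp)))

lemma tendsto_integral_originDensity (h : RadialPair V k μ G F D₁ D₂) {δ : ℝ} (hδ : 0 < δ) :
    ∃ r > 0, r ≤ 1 ∧ ∀ s, 0 < s → s ≤ r → ∫ t in Ioc 0 s, originDensity V G F D₁ D₂ t < δ := by
  have h1 : IntegrableOn (originDensity V G F D₁ D₂) (uIcc 0 1) := by
    rw [uIcc_of_le zero_le_one, integrableOn_Icc_iff_integrableOn_Ioc]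
    exact h.integrableOn_originDensity 1
  have h2 := (intervalIntegral.continuousOn_primitive_interval h1) 0 left_mem_uIcc
  have h3 := h2.eventually_lt_const (u := δ) (by simpa using hδ)
  rw [uIcc_of_le zero_le_one] at h3
  obtain ⟨ε, hε, H⟩ := Metric.mem_nhdsWithin_iff.1 h3
  refine ⟨min (ε / 2) 1, by positivity, min_le_right _ _, fun s hs hsr => ?_⟩
  have := @H s ⟨by
    rw [Metric.mem_ball, Real.dist_eq, sub_zero, abs_of_pos hs]
    linarith [hsr.trans (min_le_left _ _)], hs.le, hsr.trans (min_le_right _ _)⟩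
  rwa [mem_ofPred_eq, intervalIntegral.integral_of_le hs.le] at this

lemma originDensity_nonneg (hV : AveragesLeHalf V) {t : ℝ} (ht : 0 < t) :
    0 ≤ originDensity V G F D₁ D₂ t := by
  have := hV.pos t ht
  unfold originDensity
  positivity

lemma integral_originDensity_mono (hV : AveragesLeHalf V) (h : RadialPair V k μ G F D₁ D₂)
    {x r : ℝ} (hx : 0 ≤ x) :
    ∫ t in Ioc x r, originDensity V G F D₁ D₂ t ≤ ∫ t in Ioc 0 r, originDensity V G F D₁ D₂ t := by
  refine setIntegral_mono_set (h.integrableOn_originDensity r) ?_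
    (Ioc_subset_Ioc_left hx).eventuallyLE
  filter_upwards [ae_restrict_mem measurableSet_Ioc] with t ht
  exact originDensity_nonneg hV ht.1

/-- Some point of `(w/2, w]` has `G²` at most the mean, and `x^(2k) ≤ x ≤ w` because `k ≥ 1` and `x
≤ 1`; so `(x^k G)²` is at most twice an integral that vanishes with `w`. It supplies the initial
value for the primitive `r^k G`. -/
lemma exists_small_scaled_G (hV : AveragesLeHalf V) (h : RadialPair V k μ G F D₁ D₂) {r δ : ℝ}
    (hr : 0 < r) (hδ : 0 < δ) : ∃ x, 0 < x ∧ x ≤ r ∧ |x ^ k * G x| ≤ δ := by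
  obtain ⟨z, hz, hz1, H⟩ := h.tendsto_integral_originDensity (δ := δ ^ 2 / 2) (by positivity)
  obtain ⟨w, hw, hwz, hwr⟩ : ∃ w, 0 < w ∧ w ≤ z ∧ w ≤ r :=
    ⟨min z r, lt_min hz hr, min_le_left _ _, min_le_right _ _⟩
  have hJ := H w hw hwz
  obtain ⟨x, hx, hle⟩ := exists_mul_le_setIntegral_Ioc (by linarith : w / 2 < w)
    (h.intG.mono_set (fun t ht => lt_trans (by positivity) ht.1 : Ioc (w / 2) w ⊆ Ioi 0))
  have hx0 : 0 < x := lt_trans (by positivity) hx.1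
  refine ⟨x, hx0, hx.2.trans hwr, abs_le_of_sq_le_sq ?_ hδ.le⟩
  have h1 : ∫ t in Ioc (w / 2) w, G t ^ 2 ≤ ∫ t in Ioc (w / 2) w, originDensity V G F D₁ D₂ t := by
    refine setIntegral_mono_on (h.intG.mono_set fun t ht => lt_trans (by positivity) ht.1)
      ((h.integrableOn_originDensity w).mono_set (Ioc_subset_Ioc_left (by positivity)))
      measurableSet_Ioc fun t ht => ?_
    have := hV.pos t (lt_trans (by positivity) ht.1)
    have h2 : 0 ≤ (V t)⁻¹ * (D₁ t ^ 2 + D₂ t ^ 2) := by positivity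
    unfold originDensity
    nlinarith [sq_nonneg (F t)]
  have h2 := integral_originDensity_mono hV h (r := w) (by positivity : 0 ≤ w / 2)
  have hx1 : x ≤ 1 := hx.2.trans (hwz.trans hz1)
  have h3 : (x ^ k) ^ 2 ≤ w := by
    have := h.one_le
    calc (x ^ k) ^ 2 = x ^ (k * 2) := (pow_mul x k 2).symm
      _ ≤ x ^ 1 := pow_le_pow_of_le_one hx0.le hx1 (by omega)
      _ ≤ w := by simpa using hx.2
  calc (x ^ k * G x) ^ 2 = (x ^ k) ^ 2 * G x ^ 2 := by ring
    _ ≤ w * G x ^ 2 := by gcongr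
    _ ≤ δ ^ 2 := by linarith

/-- Integrate `(t^k G)' = t^k (D₁ - μF)` from a point near `0`. In Young's inequality `h⁺ ≤ 1/2`
turns the `V`-term into `τ/4`, while the rest is controlled by an integral that is small near the
origin. -/
lemma abs_G_le (hV : AveragesLeHalf V) (h : RadialPair V k μ G F D₁ D₂) {r τ : ℝ}
    (hr : 0 < r) (hτ : 0 < τ) :
    |G r| ≤ τ / 4 + (τ⁻¹ + μ) / 2 * ∫ t in Ioc 0 r, originDensity V G F D₁ D₂ t := by
  obtain ⟨j, hj⟩ : ∃ j, k = j + 1 := ⟨k - 1, by have := h.one_le; omega⟩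
  have hμ := h.mass_nonneg
  set J := ∫ t in Ioc 0 r, originDensity V G F D₁ D₂ t with hJ
  have hrk : 0 < r ^ k := pow_pos hr k
  have key : ∀ x, 0 < x → x ≤ r →
      |r ^ k * G r - x ^ k * G x| ≤ r ^ k * (τ / 4 + (τ⁻¹ + μ) / 2 * J) := by
    intro x hx hxr
    have i1 : IntegrableOn (fun t => τ / (2 * r ^ 2) * (V t * t ^ 2)) (Ioc x r) :=
      ((hV.integrableOn_plus r hr).mono_set (Ioc_subset_Ioc_left hx.le)).const_mul _
    have i2 : IntegrableOn (fun t => (τ⁻¹ + μ) / 2 * originDensity V G F D₁ D₂ t) (Ioc x r) :=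
      ((h.integrableOn_originDensity r).mono_set (Ioc_subset_Ioc_left hx.le)).const_mul _
    have i3 : IntegrableOn (fun t => τ / (2 * r ^ 2) * (V t * t ^ 2) +
      (τ⁻¹ + μ) / 2 * originDensity V G F D₁ D₂ t) (Ioc x r) := Integrable.add i1 i2
    rw [(h.primG x r hx hr).2, ← Real.norm_eq_abs]
    refine (intervalIntegral.norm_integral_le_of_norm_le (g := fun t => r ^ k *
      (τ / (2 * r ^ 2) * (V t * t ^ 2) + (τ⁻¹ + μ) / 2 * originDensity V G F D₁ D₂ t)) hxr ?_
      ((intervalIntegrable_iff_integrableOn_Ioc_of_le hxr).2 (i3.const_mul _))).trans ?_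
    · refine Filter.Eventually.of_forall fun t ht => ?_
      have ht0 : 0 < t := hx.trans ht.1
      have hVt := hV.pos t ht0
      have a1 := abs_mul_le_weighted hVt hτ (t / r) (D₁ t)
      -- One of the `k ≥ 1` powers of `t/r` is kept: squared, it makes the weight `V t²` of `h⁺`.
      have a2 : t ^ k ≤ r ^ k * (t / r) := by
        have : t ^ j ≤ r ^ j := pow_le_pow_left₀ ht0.le ht.2 j
        rw [hj]
        calc t ^ (j + 1) = t ^ j * t := pow_succ t j
          _ ≤ r ^ j * t := by gcongr
          _ = _ := by rw [pow_succ]; field_simp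
      have a3 : t ^ k ≤ r ^ k := pow_le_pow_left₀ ht0.le ht.2 k
      -- This is what the summand `1` in `originDensity` is for.
      have a4 : |F t| ≤ 1 / 2 * (F t ^ 2 + 1) := by
        rw [← sq_abs]; nlinarith [sq_nonneg (|F t| - 1)]
      have a5 : 0 ≤ (V t)⁻¹ * D₂ t ^ 2 := by positivity
      have a7 : 0 ≤ (V t)⁻¹ * D₁ t ^ 2 := by positivity
      have a6 : |D₁ t - μ * F t| ≤ |D₁ t| + μ * |F t| := by
        refine (abs_sub _ _).trans_eq ?_
        rw [abs_mul, abs_of_nonneg hμ]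
      rw [Real.norm_eq_abs, abs_mul, abs_of_pos (pow_pos ht0 k)]
      calc t ^ k * |D₁ t - μ * F t| ≤ t ^ k * (|D₁ t| + μ * |F t|) := by gcongr
        _ = t ^ k * |D₁ t| + t ^ k * (μ * |F t|) := mul_add _ _ _
        _ ≤ r ^ k * (t / r) * |D₁ t| + r ^ k * (μ * |F t|) := by gcongr
        _ = r ^ k * (t / r * |D₁ t| + μ * |F t|) := by ring
        _ ≤ r ^ k * (1 / 2 * (τ * (V t * (t / r) ^ 2) + τ⁻¹ * ((V t)⁻¹ * D₁ t ^ 2))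
              + μ * (1 / 2 * (F t ^ 2 + 1))) := by gcongr
        _ ≤ _ := by
          refine mul_le_mul_of_nonneg_left ?_ hrk.le
          have e : 1 / 2 * (τ * (V t * (t / r) ^ 2)) = τ / (2 * r ^ 2) * (V t * t ^ 2) := by
            field_simp
          unfold originDensity
          have p1 : 0 ≤ τ⁻¹ * ((V t)⁻¹ * D₂ t ^ 2) := by positivity
          have p2 : 0 ≤ τ⁻¹ * (G t ^ 2 + F t ^ 2 + 1) := by positivity
          have p3 : 0 ≤ μ * ((V t)⁻¹ * (D₁ t ^ 2 + D₂ t ^ 2) + G t ^ 2) := by positivity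
          linarith
    · rw [intervalIntegral.integral_of_le hxr, integral_const_mul, integral_add i1 i2,
        integral_const_mul, integral_const_mul]
      have b1 := integral_originDensity_mono hV h (r := r) hx.le
      have b2 : ∫ t in Ioc x r, V t * t ^ 2 ≤ r ^ 2 / 2 := by
        refine le_trans (setIntegral_mono_set (hV.integrableOn_plus r hr) ?_
          (Ioc_subset_Ioc_left hx.le).eventuallyLE) (hV.plus_le r hr)
        filter_upwards [ae_restrict_mem measurableSet_Ioc] with t ht
        have := hV.pos t ht.1
        simp only [Pi.zero_apply]
        positivity
      calc _ ≤ r ^ k * (τ / (2 * r ^ 2) * (r ^ 2 / 2) + (τ⁻¹ + μ) / 2 * J) := by gcongr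
        _ = _ := by field_simp; ring
  -- The starting point `x` is sent to `0` along radii where `x^k G x` is small; the bound in `key`
  -- does not depend on `x`.
  refine le_of_forall_pos_le_add fun δ hδ => ?_
  obtain ⟨x, hx, hxr, hxG⟩ := h.exists_small_scaled_G hV hr (δ := r ^ k * δ) (by positivity)
  have h1 := key x hx hxr
  have h2 : |r ^ k * G r| ≤ r ^ k * (τ / 4 + (τ⁻¹ + μ) / 2 * J) + r ^ k * δ := by
    have := abs_sub_abs_le_abs_sub (r ^ k * G r) (x ^ k * G x)
    linarith
  rw [abs_mul, abs_of_pos hrk, ← mul_add] at h2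
  exact le_of_mul_le_mul_left h2 hrk

/-- The factor `t^(-k)` is singular at the origin, so `t^(-k) F` is integrated outwards from `r` to
a fixed `ε`, with `h⁻ ≤ 1/2` in the role of `h⁺`. The price is the value at `ε`, damped by `r^k`. -/
lemma abs_F_le (hV : AveragesLeHalf V) (h : RadialPair V k μ G F D₁ D₂) {r ε τ : ℝ}
    (hr : 0 < r) (hε : r ≤ ε) (hτ : 0 < τ) :
    |F r| ≤ r ^ k * ((ε ^ k)⁻¹ * |F ε|) + (τ / 4 +
      (τ⁻¹ + μ) / 2 * ∫ t in Ioc 0 ε, originDensity V G F D₁ D₂ t) := by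
  obtain ⟨j, hj⟩ : ∃ j, k = j + 1 := ⟨k - 1, by have := h.one_le; omega⟩
  have hμ := h.mass_nonneg
  set J := ∫ t in Ioc 0 ε, originDensity V G F D₁ D₂ t with hJ
  have hrk : 0 < r ^ k := pow_pos hr k
  have hε0 := hr.trans_le hε
  have key : |(ε ^ k)⁻¹ * F ε - (r ^ k)⁻¹ * F r| ≤ (r ^ k)⁻¹ * (τ / 4 + (τ⁻¹ + μ) / 2 * J) := by
    have i1 : IntegrableOn (fun t => τ * r ^ 2 / 2 * (V t / t ^ 2)) (Ioc r ε) :=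
      ((hV.integrableOn_minus r hr).mono_set Ioc_subset_Ioi_self).const_mul _
    have i2 : IntegrableOn (fun t => (τ⁻¹ + μ) / 2 * originDensity V G F D₁ D₂ t) (Ioc r ε) :=
      ((h.integrableOn_originDensity ε).mono_set (Ioc_subset_Ioc_left hr.le)).const_mul _
    have i3 : IntegrableOn (fun t => τ * r ^ 2 / 2 * (V t / t ^ 2) +
      (τ⁻¹ + μ) / 2 * originDensity V G F D₁ D₂ t) (Ioc r ε) := Integrable.add i1 i2
    rw [(h.primF r ε hr hε0).2, ← Real.norm_eq_abs]
    refine (intervalIntegral.norm_integral_le_of_norm_le (g := fun t => (r ^ k)⁻¹ *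
      (τ * r ^ 2 / 2 * (V t / t ^ 2) + (τ⁻¹ + μ) / 2 * originDensity V G F D₁ D₂ t)) hε ?_
      ((intervalIntegrable_iff_integrableOn_Ioc_of_le hε).2 (i3.const_mul _))).trans ?_
    · refine Filter.Eventually.of_forall fun t ht => ?_
      have ht0 : 0 < t := hr.trans ht.1
      have hVt := hV.pos t ht0
      have a1 := abs_mul_le_weighted hVt hτ (r / t) (D₂ t)
      have a2 : (t ^ k)⁻¹ ≤ (r ^ k)⁻¹ * (r / t) := by
        have : (t ^ j)⁻¹ ≤ (r ^ j)⁻¹ := by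
          gcongr; exact ht.1.le
        rw [hj]
        calc (t ^ (j + 1))⁻¹ = (t ^ j)⁻¹ * t⁻¹ := by rw [pow_succ, mul_inv]
          _ ≤ (r ^ j)⁻¹ * t⁻¹ := by gcongr
          _ = _ := by rw [pow_succ]; field_simp
      have a3 : (t ^ k)⁻¹ ≤ (r ^ k)⁻¹ := by
        gcongr; exact ht.1.le
      have a4 : |G t| ≤ 1 / 2 * (G t ^ 2 + 1) := by
        rw [← sq_abs]; nlinarith [sq_nonneg (|G t| - 1)]
      have a6 : |D₂ t - μ * G t| ≤ |D₂ t| + μ * |G t| := by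
        refine (abs_sub _ _).trans_eq ?_
        rw [abs_mul, abs_of_nonneg hμ]
      rw [Real.norm_eq_abs, abs_mul, abs_of_pos (inv_pos.2 (pow_pos ht0 k))]
      calc (t ^ k)⁻¹ * |D₂ t - μ * G t| ≤ (t ^ k)⁻¹ * (|D₂ t| + μ * |G t|) := by gcongr
        _ = (t ^ k)⁻¹ * |D₂ t| + (t ^ k)⁻¹ * (μ * |G t|) := mul_add _ _ _
        _ ≤ (r ^ k)⁻¹ * (r / t) * |D₂ t| + (r ^ k)⁻¹ * (μ * |G t|) := by gcongr
        _ = (r ^ k)⁻¹ * (r / t * |D₂ t| + μ * |G t|) := by ring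
        _ ≤ (r ^ k)⁻¹ * (1 / 2 * (τ * (V t * (r / t) ^ 2) + τ⁻¹ * ((V t)⁻¹ * D₂ t ^ 2))
              + μ * (1 / 2 * (G t ^ 2 + 1))) := by gcongr
        _ ≤ _ := by
          refine mul_le_mul_of_nonneg_left ?_ (inv_pos.2 hrk).le
          have e : 1 / 2 * (τ * (V t * (r / t) ^ 2)) = τ * r ^ 2 / 2 * (V t / t ^ 2) := by
            field_simp
          unfold originDensity
          have p1 : 0 ≤ τ⁻¹ * ((V t)⁻¹ * D₁ t ^ 2) := by positivity
          have p2 : 0 ≤ τ⁻¹ * (G t ^ 2 + F t ^ 2 + 1) := by positivity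
          have p3 : 0 ≤ μ * ((V t)⁻¹ * (D₁ t ^ 2 + D₂ t ^ 2) + F t ^ 2) := by positivity
          linarith
    · rw [intervalIntegral.integral_of_le hε, integral_const_mul, integral_add i1 i2,
        integral_const_mul, integral_const_mul]
      have b1 := integral_originDensity_mono hV h (r := ε) hr.le
      have b2 : ∫ t in Ioc r ε, V t / t ^ 2 ≤ 1 / (2 * r ^ 2) := by
        refine le_trans (setIntegral_mono_set (hV.integrableOn_minus r hr) ?_
          (Ioc_subset_Ioi_self).eventuallyLE) (hV.minus_le r hr)
        filter_upwards [ae_restrict_mem measurableSet_Ioi] with t ht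
        have := hV.pos t (hr.trans ht)
        simp only [Pi.zero_apply]
        positivity
      calc _ ≤ (r ^ k)⁻¹ * (τ * r ^ 2 / 2 * (1 / (2 * r ^ 2)) + (τ⁻¹ + μ) / 2 * J) := by gcongr
        _ = _ := by field_simp; ring
  have h2 : (r ^ k)⁻¹ * |F r| ≤ (ε ^ k)⁻¹ * |F ε| + (r ^ k)⁻¹ * (τ / 4 + (τ⁻¹ + μ) / 2 * J) := by
    have := abs_sub_abs_le_abs_sub ((r ^ k)⁻¹ * F r) ((ε ^ k)⁻¹ * F ε)
    rw [abs_sub_comm, abs_mul, abs_mul, abs_of_pos (inv_pos.2 hrk),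
      abs_of_pos (inv_pos.2 (pow_pos hε0 k))] at this
    linarith
  calc |F r| = r ^ k * ((r ^ k)⁻¹ * |F r|) := by field_simp
    _ ≤ r ^ k * ((ε ^ k)⁻¹ * |F ε| + (r ^ k)⁻¹ * (τ / 4 + (τ⁻¹ + μ) / 2 * J)) := by gcongr
    _ = _ := by field_simp

/-- Take `τ = η` in both bounds. The order of choices matters: first `ε`, making the integrals near
`0` small, and only then `x`, small enough to damp the value of `F` at `ε`. -/
lemma exists_small_near_zero (hV : AveragesLeHalf V) (h : RadialPair V k μ G F D₁ D₂) {δ : ℝ}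
    (hδ : 0 < δ) (x₀ : ℝ) (hx₀ : 0 < x₀) : ∃ x, 0 < x ∧ x ≤ x₀ ∧ G x ^ 2 + F x ^ 2 ≤ δ := by
  obtain ⟨η, hη, hηδ⟩ : ∃ η > 0, 2 * η ^ 2 ≤ δ :=
    ⟨√(δ / 2), by positivity, by rw [Real.sq_sqrt (by positivity)]; linarith⟩
  have hμ := h.mass_nonneg
  have hc : 0 < ((η)⁻¹ + μ) / 2 := by positivity
  obtain ⟨ε, hε, -, H⟩ := h.tendsto_integral_originDensity
    (δ := η / 4 / (((η)⁻¹ + μ) / 2)) (by positivity)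
  have hK : 0 ≤ (ε ^ k)⁻¹ * |F ε| := by positivity
  obtain ⟨x, hx, hx1, hxε, hxx, hxK⟩ : ∃ x, 0 < x ∧ x ≤ 1 ∧ x ≤ ε ∧ x ≤ x₀ ∧
      x * ((ε ^ k)⁻¹ * |F ε|) ≤ η / 4 := by
    refine ⟨min (min 1 ε) (min x₀ (η / 4 / ((ε ^ k)⁻¹ * |F ε| + 1))), by positivity,
      (min_le_left _ _).trans (min_le_left _ _), (min_le_left _ _).trans (min_le_right _ _),
      (min_le_right _ _).trans (min_le_left _ _), ?_⟩
    calc _ ≤ η / 4 / ((ε ^ k)⁻¹ * |F ε| + 1) * ((ε ^ k)⁻¹ * |F ε| + 1) := by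
          gcongr
          · exact (min_le_right _ _).trans (min_le_right _ _)
          · linarith
      _ = η / 4 := by field_simp
  have bound : ∀ s, 0 < s → s ≤ ε →
      ((η)⁻¹ + μ) / 2 * ∫ t in Ioc 0 s, originDensity V G F D₁ D₂ t ≤ η / 4 := fun s hs hs' => by
    have := H s hs hs'
    rw [lt_div_iff₀ hc] at this
    linarith
  have hG := (h.abs_G_le hV hx hη).trans (add_le_add le_rfl (bound x hx hxε))
  have hF := h.abs_F_le hV hx hxε hη
  have hxk : x ^ k ≤ x := by
    simpa using pow_le_pow_of_le_one hx.le hx1 h.one_le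
  have hF2 : |F x| ≤ η := by
    have := mul_le_mul_of_nonneg_right hxk hK
    linarith [bound ε hε le_rfl]
  refine ⟨x, hx, hxx, ?_⟩
  have g2 := sq_le_sq' (by linarith [abs_nonneg (G x)]) (by linarith : |G x| ≤ η)
  have f2 := sq_le_sq' (by linarith [abs_nonneg (F x)]) hF2
  rw [sq_abs] at g2 f2
  linarith

lemma exists_small_near_infinity (h : RadialPair V k μ G F D₁ D₂) {δ : ℝ}
    (hδ : 0 < δ) (y₀ : ℝ) : ∃ y, y₀ ≤ y ∧ G y ^ 2 + F y ^ 2 ≤ δ := by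
  set I := ∫ t in Ioi 0, (G t ^ 2 + F t ^ 2) with hI
  have hI0 : 0 ≤ I := setIntegral_nonneg measurableSet_Ioi fun t _ => by positivity
  have hint : IntegrableOn (fun t => G t ^ 2 + F t ^ 2) (Ioi 0) := h.intG.add h.intF
  set A := max y₀ 0
  -- An interval of length at least `I/δ` contains a point where the integrand is at most `δ`.
  set L := I / δ + 1
  have hL : 0 < L := by positivity
  have hA : 0 ≤ A := le_max_right _ _
  have hsub : Ioc A (A + L) ⊆ Ioi 0 := fun t ht => lt_of_le_of_lt hA ht.1
  obtain ⟨y, hy, hle⟩ := exists_mul_le_setIntegral_Ioc (by linarith : A < A + L)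
    (hint.mono_set hsub)
  refine ⟨y, (le_max_left _ _).trans hy.1.le, ?_⟩
  have h1 : ∫ t in Ioc A (A + L), (G t ^ 2 + F t ^ 2) ≤ I :=
    setIntegral_mono_set hint (Filter.Eventually.of_forall fun t => by
      simp only [Pi.zero_apply]; positivity) hsub.eventuallyLE
  rw [add_sub_cancel_left] at hle
  have h2 : I ≤ δ * L := by
    simp only [L]
    rw [mul_add, mul_div_cancel₀ _ hδ.ne']
    linarith
  exact le_of_mul_le_mul_right (hle.trans (h1.trans h2)) hL

/-- The one-dimensional weighted inequality. -/
theorem lintegral_weighted_sq_le (hV : AveragesLeHalf V) (h : RadialPair V k μ G F D₁ D₂) :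
    ∫⁻ t in Ioi 0, ENNReal.ofReal (V t * (G t ^ 2 + F t ^ 2)) ≤
      ∫⁻ t in Ioi 0, ENNReal.ofReal ((V t)⁻¹ * (D₁ t ^ 2 + D₂ t ^ 2)) := by
  have hw0 : ∀ t, 0 < t → 0 ≤ (V t)⁻¹ * (D₁ t ^ 2 + D₂ t ^ 2) := fun t ht => by
    have := hV.pos t ht
    positivity
  have hv0 : ∀ t, 0 < t → 0 ≤ V t * (G t ^ 2 + F t ^ 2) := fun t ht => by
    have := hV.pos t ht
    positivity
  have hae : ∀ᵐ t ∂(volume.restrict (Ioi (0 : ℝ))), 0 ≤ (V t)⁻¹ * (D₁ t ^ 2 + D₂ t ^ 2) := by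
    filter_upwards [ae_restrict_mem measurableSet_Ioi] with t ht using hw0 t ht
  rw [← ofReal_integral_eq_lintegral_ofReal h.intD hae]
  set Y := ∫ t in Ioi 0, (V t)⁻¹ * (D₁ t ^ 2 + D₂ t ^ 2)
  have main : ∀ x₀ y₀ : ℝ, 0 < x₀ → x₀ ≤ y₀ →
      ∫⁻ t in Ioc x₀ y₀, ENNReal.ofReal (V t * (G t ^ 2 + F t ^ 2)) ≤ ENNReal.ofReal Y := by
    intro x₀ y₀ hx₀ hxy
    refine ENNReal.le_of_forall_pos_le_add fun δ hδ _ => ?_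
    -- Two endpoints, each contributing at most `8 · δ/16`.
    have hδ' : (0 : ℝ) < δ / 16 := by positivity
    obtain ⟨x, hx, hxx, hsx⟩ := h.exists_small_near_zero hV hδ' x₀ hx₀
    obtain ⟨y, hy, hsy⟩ := h.exists_small_near_infinity hδ' y₀
    have hxy' : x ≤ y := hxx.trans (hxy.trans hy)
    have i1 := h.intervalIntegrable_weighted_sq hV hx (hx.trans_le hxy')
    have hle := h.integral_weighted_sq_le hV hx hxy'
    have hsub : Ioc x y ⊆ Ioi 0 := fun t ht => hx.trans ht.1
    have hYle : ∫ t in x..y, (V t)⁻¹ * (D₁ t ^ 2 + D₂ t ^ 2) ≤ Y := by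
      rw [intervalIntegral.integral_of_le hxy']
      exact setIntegral_mono_set h.intD hae hsub.eventuallyLE
    calc ∫⁻ t in Ioc x₀ y₀, ENNReal.ofReal (V t * (G t ^ 2 + F t ^ 2))
        ≤ ∫⁻ t in Ioc x y, ENNReal.ofReal (V t * (G t ^ 2 + F t ^ 2)) :=
          lintegral_mono_set (Ioc_subset_Ioc hxx hy)
      _ = ENNReal.ofReal (∫ t in x..y, V t * (G t ^ 2 + F t ^ 2)) := by
          rw [intervalIntegral.integral_of_le hxy', ofReal_integral_eq_lintegral_ofReal
            ((intervalIntegrable_iff_integrableOn_Ioc_of_le hxy').1 i1)]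
          filter_upwards [ae_restrict_mem measurableSet_Ioc] with t ht
          exact hv0 t (hsub ht)
      _ ≤ ENNReal.ofReal (Y + δ) := ENNReal.ofReal_le_ofReal (by linarith)
      _ ≤ ENNReal.ofReal Y + δ := by
          refine ENNReal.ofReal_add_le.trans_eq ?_
          rw [ENNReal.ofReal_coe_nnreal]
  have hU : Ioi (0 : ℝ) = ⋃ n : ℕ, Ioc ((n : ℝ) + 1)⁻¹ (n + 1) := by
    ext t
    simp only [mem_Ioi, mem_iUnion, mem_Ioc]
    constructor
    · intro ht
      obtain ⟨n, hn⟩ := exists_nat_gt (max t t⁻¹)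
      refine ⟨n, ?_, ((le_max_left _ _).trans_lt (hn.trans (by linarith))).le⟩
      rw [inv_lt_comm₀ (by positivity) ht]
      exact (le_max_right _ _).trans_lt (hn.trans (by linarith))
    · rintro ⟨n, hn, -⟩
      exact lt_trans (by positivity) hn
  have hmono : Monotone fun n : ℕ => Ioc ((n : ℝ) + 1)⁻¹ ((n : ℝ) + 1) := by
    intro m n hmn
    have : (m : ℝ) ≤ n := by exact_mod_cast hmn
    exact Ioc_subset_Ioc (by gcongr) (by gcongr)
  rw [hU, setLIntegral_iUnion_of_directed _ hmono.directed_le]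
  refine iSup_le fun n => main _ _ (by positivity) ?_
  refine (inv_le_one_of_one_le₀ ?_).trans ?_ <;> linarith [n.cast_nonneg (α := ℝ)]

end RadialPair

/-! ### Pointwise bounds from essential suprema; the Coulomb weight -/

lemma monotone_sq_mul_hPlus (V : ℝ → ℝ) : Monotone fun r : ℝ =>
    ∫⁻ t in Ioo 0 r, ENNReal.ofReal (V t * t ^ 2) := fun _ _ h =>
  lintegral_mono_set (Ioo_subset_Ioo_right h)

/-- The essential suprema of the averages bound the averages at every radius. -/
lemma AveragesLeHalf.of_radialSupNorm {V : ℝ → ℝ} (hV : Measurable V) (hpos : ∀ r, 0 < r → 0 < V r)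
    (hP : radialSupNorm (hPlus V) ≤ 1 / 2) (hM : radialSupNorm (hMinus V) ≤ 1 / 2) :
    AveragesLeHalf V := by
  have aeP : ∀ᵐ r ∂(volume.restrict (Ioi (0 : ℝ))), hPlus V r ≤ 1 / 2 :=
    (ENNReal.ae_le_essSup (hPlus V)).mono fun r hr => hr.trans hP
  have aeM : ∀ᵐ r ∂(volume.restrict (Ioi (0 : ℝ))), hMinus V r ≤ 1 / 2 :=
    (ENNReal.ae_le_essSup (hMinus V)).mono fun r hr => hr.trans hM
  -- Every non-empty interval contains a radius where both bounds hold. The integrals in `h^±` are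
  -- monotone in the radius, so a bound at nearby radii passes to every radius in the limit.
  have ex : ∀ a b : ℝ, 0 ≤ a → a < b → ∃ r ∈ Ioo a b, hPlus V r ≤ 1 / 2 ∧ hMinus V r ≤ 1 / 2 := by
    intro a b ha hab
    have hsub : Ioo a b ⊆ Ioi 0 := fun t ht => lt_of_le_of_lt ha ht.1
    have h2 : ∀ᵐ r ∂(volume.restrict (Ioo a b)), hPlus V r ≤ 1 / 2 ∧ hMinus V r ≤ 1 / 2 :=
      ae_restrict_of_ae_restrict_of_subset hsub (aeP.and aeM)
    have h3 : volume.restrict (Ioo a b) ≠ 0 := by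
      simp [Measure.restrict_eq_zero, hab]
    have : (ae (volume.restrict (Ioo a b))).NeBot := ae_neBot.2 h3
    obtain ⟨r, hr, hr'⟩ := (h2.and (ae_restrict_mem measurableSet_Ioo)).exists
    exact ⟨r, hr', hr⟩
  have half : (1 / 2 : ℝ≥0∞) = ENNReal.ofReal (1 / 2) := by
    rw [ENNReal.ofReal_div_of_pos two_pos]; simp
  have keyP : ∀ r, 0 < r →
      ∫⁻ t in Ioc 0 r, ENNReal.ofReal (V t * t ^ 2) ≤ ENNReal.ofReal (r ^ 2 / 2) := by
    intro r hr
    rw [← restrict_Ioo_eq_restrict_Ioc]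
    have step : ∀ s, r < s → ∫⁻ t in Ioo 0 r, ENNReal.ofReal (V t * t ^ 2) ≤
        ENNReal.ofReal (s ^ 2 / 2) := by
      intro s hs
      obtain ⟨ρ, hρ, h1, -⟩ := ex r s hr.le hs
      have hρ0 : 0 < ρ := hr.trans hρ.1
      refine (monotone_sq_mul_hPlus V hρ.1.le).trans ?_
      have h2 : ENNReal.ofReal (ρ ^ 2) * hPlus V ρ ≤ ENNReal.ofReal (ρ ^ 2) * (1 / 2) := by gcongr
      rw [hPlus, ← mul_assoc, ← ENNReal.ofReal_mul (by positivity), mul_one_div_cancel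
        (by positivity), ENNReal.ofReal_one, one_mul, half, ← ENNReal.ofReal_mul (by positivity)] at h2
      refine h2.trans (ENNReal.ofReal_le_ofReal ?_)
      have := hρ.2.le
      rw [mul_one_div]
      gcongr
    refine ge_of_tendsto (x := nhdsWithin r (Ioi r)) (f := fun s => ENNReal.ofReal (s ^ 2 / 2)) ?_
      (by filter_upwards [self_mem_nhdsWithin] with s hs using step s hs)
    exact (ENNReal.continuous_ofReal.comp (by fun_prop : Continuous fun s : ℝ => s ^ 2 / 2)).tendsto r
      |>.mono_left nhdsWithin_le_nhds
  have keyM : ∀ r, 0 < r →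
      ∫⁻ t in Ioi r, ENNReal.ofReal (V t / t ^ 2) ≤ ENNReal.ofReal (1 / (2 * r ^ 2)) := by
    intro r hr
    have step : ∀ s, 0 < s → s < r → ∫⁻ t in Ioi r, ENNReal.ofReal (V t / t ^ 2) ≤
        ENNReal.ofReal (1 / (2 * s ^ 2)) := by
      intro s hs0 hs
      obtain ⟨ρ, hρ, -, h1⟩ := ex s r hs0.le hs
      have hρ0 : 0 < ρ := hs0.trans hρ.1
      refine (lintegral_mono_set (Ioi_subset_Ioi hρ.2.le)).trans ?_
      have h2 : ENNReal.ofReal (1 / ρ ^ 2) * hMinus V ρ ≤ ENNReal.ofReal (1 / ρ ^ 2) * (1 / 2) := by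
        gcongr
      rw [hMinus, ← mul_assoc, ← ENNReal.ofReal_mul (by positivity), one_div_mul_cancel
        (by positivity), ENNReal.ofReal_one, one_mul, half, ← ENNReal.ofReal_mul (by positivity)] at h2
      refine h2.trans (ENNReal.ofReal_le_ofReal ?_)
      have := hρ.1.le
      rw [one_div_mul_one_div, mul_comm]
      gcongr
    refine ge_of_tendsto (x := nhdsWithin r (Iio r)) (f := fun s => ENNReal.ofReal (1 / (2 * s ^ 2))) ?_
      (by filter_upwards [self_mem_nhdsWithin, mem_nhdsWithin_of_mem_nhds (Ioi_mem_nhds hr)]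
            with s hs hs0 using step s hs0 hs)
    refine Filter.Tendsto.mono_left ?_ nhdsWithin_le_nhds
    refine (ENNReal.continuous_ofReal.tendsto _).comp ?_
    exact ContinuousAt.div (by fun_prop) (by fun_prop) (by positivity)
  have nnP : ∀ r, 0 < r → 0 ≤ᵐ[volume.restrict (Ioc 0 r)] fun t => V t * t ^ 2 := by
    intro r hr
    filter_upwards [ae_restrict_mem measurableSet_Ioc] with t ht
    have := hpos t ht.1
    simp only [Pi.zero_apply]
    positivity
  have nnM : ∀ r, 0 < r → 0 ≤ᵐ[volume.restrict (Ioi r)] fun t => V t / t ^ 2 := by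
    intro r hr
    filter_upwards [ae_restrict_mem measurableSet_Ioi] with t ht
    have := hpos t (hr.trans ht)
    simp only [Pi.zero_apply]
    positivity
  have mP : Measurable fun t => V t * t ^ 2 := by fun_prop
  have mM : Measurable fun t => V t / t ^ 2 := by fun_prop
  have iP : ∀ r, 0 < r → IntegrableOn (fun t => V t * t ^ 2) (Ioc 0 r) := fun r hr =>
    ⟨mP.aestronglyMeasurable, by
      rw [hasFiniteIntegral_iff_ofReal (nnP r hr)]
      exact (keyP r hr).trans_lt ENNReal.ofReal_lt_top⟩
  have iM : ∀ r, 0 < r → IntegrableOn (fun t => V t / t ^ 2) (Ioi r) := fun r hr =>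
    ⟨mM.aestronglyMeasurable, by
      rw [hasFiniteIntegral_iff_ofReal (nnM r hr)]
      exact (keyM r hr).trans_lt ENNReal.ofReal_lt_top⟩
  refine ⟨hV, hpos, iP, fun r hr => ?_, iM, fun r hr => ?_⟩
  · have := keyP r hr
    rwa [← ofReal_integral_eq_lintegral_ofReal (iP r hr) (nnP r hr),
      ENNReal.ofReal_le_ofReal_iff (by positivity)] at this
  · have := keyM r hr
    rwa [← ofReal_integral_eq_lintegral_ofReal (iM r hr) (nnM r hr),
      ENNReal.ofReal_le_ofReal_iff (by positivity)] at this

/-- For the Coulomb weight both averages are identically `1 / 2`. -/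
lemma hPlus_hMinus_inv {r : ℝ} (hr : 0 < r) :
    hPlus (fun t => 1 / t) r = 1 / 2 ∧ hMinus (fun t => 1 / t) r = 1 / 2 := by
  have half : (1 / 2 : ℝ≥0∞) = ENNReal.ofReal (1 / 2) := by
    rw [ENNReal.ofReal_div_of_pos two_pos]; simp
  constructor
  · have e : ∫⁻ t in Ioo 0 r, ENNReal.ofReal (1 / t * t ^ 2) = ENNReal.ofReal (r ^ 2 / 2) := by
      have e1 : ∫⁻ t in Ioo 0 r, ENNReal.ofReal (1 / t * t ^ 2) = ∫⁻ t in Ioo 0 r, ENNReal.ofReal t :=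
        setLIntegral_congr_fun measurableSet_Ioo fun t ht => by
          have := ht.1.ne'
          congr 1
          field_simp
      rw [e1, restrict_Ioo_eq_restrict_Ioc, ← ofReal_integral_eq_lintegral_ofReal,
        ← intervalIntegral.integral_of_le hr.le, integral_id]
      · congr 1; ring
      · exact (continuous_id.integrableOn_Icc (a := 0) (b := r)).mono_set Ioc_subset_Icc_self
      · filter_upwards [ae_restrict_mem measurableSet_Ioc] with t ht using ht.1.le
    rw [hPlus, e, half, ← ENNReal.ofReal_mul (by positivity)]
    congr 1
    field_simp
  · have e : ∫⁻ t in Ioi r, ENNReal.ofReal (1 / t / t ^ 2) = ENNReal.ofReal (1 / (2 * r ^ 2)) := by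
      have e1 : ∫⁻ t in Ioi r, ENNReal.ofReal (1 / t / t ^ 2) =
          ∫⁻ t in Ioi r, ENNReal.ofReal (t ^ (-3 : ℝ)) :=
        setLIntegral_congr_fun measurableSet_Ioi fun t ht => by
          have h0 : 0 < t := hr.trans ht
          congr 1
          rw [Real.rpow_neg h0.le]
          norm_cast
          field_simp
      rw [e1, ← ofReal_integral_eq_lintegral_ofReal (integrableOn_Ioi_rpow_of_lt (by norm_num) hr),
        integral_Ioi_rpow_of_lt (by norm_num) hr]
      · congr 1
        norm_num
        ring
      · filter_upwards [ae_restrict_mem measurableSet_Ioi] with t ht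
        have h0 : 0 < t := hr.trans ht
        positivity
    rw [hMinus, e, half, ← ENNReal.ofReal_mul (by positivity)]
    congr 1
    field_simp

/-! ### Dirac matrices and Clifford multiplication -/

/-- The Dirac matrix `α_k` as an operator on spinors. -/
def alphaOp (k : Fin 3) : Spinor →L[ℂ] Spinor := Matrix.toEuclideanCLM (𝕜 := ℂ) (diracAlpha k)

/-- The Dirac matrix `β` as an operator on spinors. -/
def betaOp : Spinor →L[ℂ] Spinor := Matrix.toEuclideanCLM (𝕜 := ℂ) diracBeta

lemma alphaOp_apply (k : Fin 3) (v : Spinor) : alphaOp k v = matAct (diracAlpha k) v := rfl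

lemma betaOp_apply (v : Spinor) : betaOp v = matAct diracBeta v := rfl

lemma pauli_anticomm (j k : Fin 3) :
    pauli j * pauli k + pauli k * pauli j = (if j = k then (2 : ℂ) else 0) • 1 := by
  fin_cases j <;> fin_cases k <;> ext a b <;> fin_cases a <;> fin_cases b <;>
    simp [pauli] <;> norm_num

lemma pauli_isHermitian (k : Fin 3) : (pauli k).conjTranspose = pauli k := by
  fin_cases k <;> ext a b <;> fin_cases a <;> fin_cases b <;> simp [pauli]

lemma diracAlpha_anticomm (j k : Fin 3) :
    diracAlpha j * diracAlpha k + diracAlpha k * diracAlpha j =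
      (if j = k then (2 : ℂ) else 0) • 1 := by
  rw [diracAlpha, diracAlpha, Matrix.fromBlocks_multiply, Matrix.fromBlocks_multiply,
    Matrix.fromBlocks_add]
  simp only [zero_mul, mul_zero, zero_add, add_zero, pauli_anticomm]
  rw [← Matrix.fromBlocks_one, Matrix.fromBlocks_smul, smul_zero]

lemma diracBeta_anticomm (k : Fin 3) : diracBeta * diracAlpha k = -(diracAlpha k * diracBeta) := by
  rw [diracAlpha, diracBeta, Matrix.fromBlocks_multiply, Matrix.fromBlocks_multiply,
    Matrix.fromBlocks_neg]
  simp

lemma alphaOp_anticomm (j k : Fin 3) :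
    alphaOp j * alphaOp k + alphaOp k * alphaOp j =
      (if j = k then (2 : ℂ) else 0) • 1 := by
  simp only [alphaOp, ← map_mul, ← map_add, diracAlpha_anticomm, map_smul, map_one]

lemma betaOp_mul_alphaOp (k : Fin 3) : betaOp * alphaOp k = -(alphaOp k * betaOp) := by
  rw [alphaOp, betaOp, ← map_mul, ← map_mul, ← map_neg, diracBeta_anticomm]

lemma betaOp_mul_self : betaOp * betaOp = 1 := by
  simp only [betaOp, ← map_mul, diracBeta, Matrix.fromBlocks_multiply]
  simp

lemma star_alphaOp (k : Fin 3) : star (alphaOp k) = alphaOp k := by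
  rw [alphaOp, ← map_star, Matrix.star_eq_conjTranspose, diracAlpha,
    Matrix.fromBlocks_conjTranspose, pauli_isHermitian]
  simp

lemma star_betaOp : star betaOp = betaOp := by
  rw [betaOp, ← map_star, Matrix.star_eq_conjTranspose, diracBeta,
    Matrix.fromBlocks_conjTranspose]
  simp

lemma inner_alphaOp (k : Fin 3) (u v : Spinor) :
    inner ℂ (alphaOp k u) v = inner ℂ u (alphaOp k v) := by
  rw [← ContinuousLinearMap.adjoint_inner_right, ← ContinuousLinearMap.star_eq_adjoint, star_alphaOp]

lemma inner_betaOp (u v : Spinor) : inner ℂ (betaOp u) v = inner ℂ u (betaOp v) := by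
  rw [← ContinuousLinearMap.adjoint_inner_right, ← ContinuousLinearMap.star_eq_adjoint, star_betaOp]

/-- Clifford multiplication by a vector: `α · x`. -/
def slash (x : Space3) : Spinor →L[ℂ] Spinor := ∑ k, ((x k : ℝ) : ℂ) • alphaOp k

lemma slash_apply (x : Space3) (v : Spinor) : slash x v = ∑ k, ((x k : ℝ) : ℂ) • alphaOp k v := by
  simp [slash]

lemma inner_slash (x : Space3) (u v : Spinor) : inner ℂ (slash x u) v = inner ℂ u (slash x v) := by
  simp only [slash_apply, sum_inner, inner_sum, inner_smul_left, inner_smul_right, inner_alphaOp,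
    Complex.conj_ofReal]

lemma alphaOp_alphaOp_add (j k : Fin 3) (v : Spinor) :
    alphaOp j (alphaOp k v) + alphaOp k (alphaOp j v) = (if j = k then (2 : ℂ) else 0) • v := by
  have h := congrArg (fun A : Spinor →L[ℂ] Spinor => A v) (alphaOp_anticomm j k)
  exact h

/-- Add the double sum to its transpose: the anticommutation relations leave only the diagonal,
counted twice. -/
lemma slash_slash (x : Space3) (v : Spinor) : slash x (slash x v) = ((‖x‖ ^ 2 : ℝ) : ℂ) • v := by
  have e1 : slash x (slash x v) = ∑ j, ∑ k, (((x j : ℝ) : ℂ) * ((x k : ℝ) : ℂ)) •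
      alphaOp j (alphaOp k v) := by
    simp only [slash_apply, map_sum, map_smul, Finset.smul_sum, smul_smul]
    refine Finset.sum_comm.trans (Finset.sum_congr rfl fun j _ =>
      Finset.sum_congr rfl fun k _ => ?_)
    rw [mul_comm]
  have e2 : slash x (slash x v) = ∑ j, ∑ k, (((x j : ℝ) : ℂ) * ((x k : ℝ) : ℂ)) •
      alphaOp k (alphaOp j v) := by
    refine e1.trans (Finset.sum_comm.trans (Finset.sum_congr rfl fun j _ =>
      Finset.sum_congr rfl fun k _ => ?_))
    rw [mul_comm]
  have h : (2 : ℂ) • slash x (slash x v) = (2 : ℂ) • (((‖x‖ ^ 2 : ℝ) : ℂ) • v) := by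
    rw [two_smul ℂ (slash x (slash x v))]
    nth_rewrite 1 [e1]
    rw [e2]
    simp only [← Finset.sum_add_distrib, ← smul_add, alphaOp_alphaOp_add, smul_ite, smul_smul,
      ite_smul, zero_smul, smul_zero, Finset.sum_ite_eq, Finset.mem_univ, if_true]
    rw [← Finset.sum_smul, EuclideanSpace.norm_sq_eq]
    congr 1
    push_cast
    rw [Finset.mul_sum]
    refine Finset.sum_congr rfl fun j _ => ?_
    rw [Real.norm_eq_abs, ← Complex.ofReal_pow, sq_abs]
    push_cast
    ring
  exact smul_right_injective _ (two_ne_zero (α := ℂ)) h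

lemma norm_slash (x : Space3) (v : Spinor) : ‖slash x v‖ = ‖x‖ * ‖v‖ := by
  have h : ‖slash x v‖ ^ 2 = (‖x‖ * ‖v‖) ^ 2 := by
    have h1 : (inner ℂ (slash x v) (slash x v) : ℂ) = ((‖x‖ ^ 2 : ℝ) : ℂ) * inner ℂ v v := by
      rw [inner_slash, slash_slash, inner_smul_right]
    rw [inner_self_eq_norm_sq_to_K, inner_self_eq_norm_sq_to_K] at h1
    rw [mul_pow]
    have h2 : ((‖slash x v‖ ^ 2 : ℝ) : ℂ) = ((‖x‖ ^ 2 * ‖v‖ ^ 2 : ℝ) : ℂ) := by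
      push_cast
      simpa using h1
    exact_mod_cast h2
  exact (sq_eq_sq₀ (norm_nonneg _) (by positivity)).1 h

lemma betaOp_slash (x : Space3) (v : Spinor) : betaOp (slash x v) = -slash x (betaOp v) := by
  have h : ∀ k, betaOp (alphaOp k v) = -alphaOp k (betaOp v) := fun k => by
    simpa using congrArg (fun A : Spinor →L[ℂ] Spinor => A v) (betaOp_mul_alphaOp k)
  simp only [slash_apply, map_sum, map_smul, h, smul_neg, Finset.sum_neg_distrib]

lemma betaOp_betaOp (v : Spinor) : betaOp (betaOp v) = v := by
  simpa using congrArg (fun A : Spinor →L[ℂ] Spinor => A v) betaOp_mul_self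

/-! ### Homogeneous polynomial spinor fields -/

/-- The partial derivative of a spinor field. -/
def pderiv (k : Fin 3) (f : Space3 → Spinor) (x : Space3) : Spinor :=
  fderiv ℝ f x (EuclideanSpace.single k 1)

/-- The Dirac operator `α · ∇` on differentiable spinor fields. -/
def diracOp (f : Space3 → Spinor) (x : Space3) : Spinor := ∑ k, alphaOp k (pderiv k f x)

/-- Multiplication of a spinor field by a coordinate. -/
def coordMul (k : Fin 3) : (Space3 → Spinor) →ₗ[ℂ] (Space3 → Spinor) where
  toFun f x := ((x k : ℝ) : ℂ) • f x
  map_add' f g := by ext1 x; simp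
  map_smul' c f := by ext1 x; simp [smul_comm c]

/-- Homogeneous polynomial spinor fields of degree `l`. -/
def homPoly : ℕ → Submodule ℂ (Space3 → Spinor)
  | 0 => LinearMap.range (LinearMap.const : Spinor →ₗ[ℂ] (Space3 → Spinor))
  | l + 1 => ⨆ k : Fin 3, (homPoly l).map (coordMul k)

lemma coordMul_mem_homPoly {l : ℕ} {f : Space3 → Spinor} (k : Fin 3) (hf : f ∈ homPoly l) :
    coordMul k f ∈ homPoly (l + 1) :=
  Submodule.mem_iSup_of_mem k (Submodule.mem_map_of_mem hf)

@[elab_as_elim]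
lemma homPoly_induction {P : ℕ → (Space3 → Spinor) → Prop}
    (const : ∀ v : Spinor, P 0 fun _ => v)
    (coord : ∀ l k f, f ∈ homPoly l → P l f → P (l + 1) (coordMul k f))
    (zero : ∀ l, P l 0) (add : ∀ l f g, f ∈ homPoly l → g ∈ homPoly l → P l f → P l g → P l (f + g))
    {l : ℕ} {f : Space3 → Spinor} (hf : f ∈ homPoly l) : P l f := by
  induction l generalizing f with
  | zero =>
    obtain ⟨v, rfl⟩ := hf
    exact const v
  | succ l ih =>
    have : f ∈ homPoly (l + 1) ∧ P (l + 1) f := by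
      refine Submodule.iSup_induction _ (motive := fun f => f ∈ homPoly (l + 1) ∧ P (l + 1) f) hf
        ?_ ⟨zero_mem _, zero _⟩ fun f g hf hg =>
          ⟨add_mem hf.1 hg.1, add _ _ _ hf.1 hg.1 hf.2 hg.2⟩
      rintro k _ ⟨g, hg, rfl⟩
      exact ⟨coordMul_mem_homPoly k hg, coord l k g hg (ih hg)⟩
    exact this.2

instance homPoly_finiteDimensional (l : ℕ) : FiniteDimensional ℂ (homPoly l) := by
  induction l with
  | zero =>
    rw [homPoly]
    infer_instance
  | succ l ih =>
    rw [homPoly]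
    infer_instance

lemma contDiff_of_mem_homPoly {l : ℕ} {f : Space3 → Spinor} (hf : f ∈ homPoly l) :
    ContDiff ℝ ∞ f := by
  refine homPoly_induction (P := fun _ f => ContDiff ℝ ∞ f) (fun v => contDiff_const)
    (fun l k f _ h => ?_) (fun l => contDiff_const) (fun l f g _ _ h1 h2 => h1.add h2) hf
  have : ContDiff ℝ ∞ fun x : Space3 => ((x k : ℝ) : ℂ) :=
    Complex.ofRealCLM.contDiff.comp (EuclideanSpace.proj (𝕜 := ℝ) k).contDiff
  exact this.smul h

lemma differentiable_of_mem_homPoly {l : ℕ} {f : Space3 → Spinor} (hf : f ∈ homPoly l) :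
    Differentiable ℝ f :=
  (contDiff_of_mem_homPoly hf).differentiable (by simp)

lemma homPoly_smul {l : ℕ} {f : Space3 → Spinor} (hf : f ∈ homPoly l) (t : ℝ) (x : Space3) :
    f (t • x) = ((t ^ l : ℝ) : ℂ) • f x := by
  refine homPoly_induction (P := fun l f => f (t • x) = ((t ^ l : ℝ) : ℂ) • f x) (fun v => by simp)
    (fun l k f _ h => ?_) (fun l => by simp) (fun l f g _ _ h1 h2 => by simp [h1, h2]) hf
  simp only [coordMul, LinearMap.coe_mk, AddHom.coe_mk, h, smul_smul]
  congr 1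
  simp only [PiLp.smul_apply, smul_eq_mul]
  push_cast
  ring

lemma clm_comp_mem_homPoly {l : ℕ} {f : Space3 → Spinor} (A : Spinor →L[ℂ] Spinor)
    (hf : f ∈ homPoly l) : (fun x => A (f x)) ∈ homPoly l := by
  refine homPoly_induction (P := fun l f => (fun x => A (f x)) ∈ homPoly l)
    (fun v => ⟨A v, rfl⟩) (fun l k f _ h => ?_) (fun l => ?_) (fun l f g _ _ h1 h2 => ?_) hf
  · convert! coordMul_mem_homPoly k h using 1
    ext1 x
    simp [coordMul]
  · have : (fun x => A ((0 : Space3 → Spinor) x)) = 0 := by ext1 x; simp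
    rw [this]
    exact zero_mem _
  · simpa [Pi.add_def] using add_mem h1 h2

lemma pderiv_add {f g : Space3 → Spinor} (hf : Differentiable ℝ f) (hg : Differentiable ℝ g)
    (k : Fin 3) : pderiv k (f + g) = pderiv k f + pderiv k g := by
  ext1 x
  simp [pderiv, fderiv_add (hf x) (hg x)]

lemma fderiv_coordMul {f : Space3 → Spinor} (hf : Differentiable ℝ f) (k : Fin 3)
    (x y : Space3) : fderiv ℝ (coordMul k f) x y =
      ((y k : ℝ) : ℂ) • f x + ((x k : ℝ) : ℂ) • fderiv ℝ f x y := by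
  have h1 : HasFDerivAt (fun x : Space3 => x k) (EuclideanSpace.proj (𝕜 := ℝ) k) x :=
    (EuclideanSpace.proj (𝕜 := ℝ) k).hasFDerivAt
  have h2 : HasFDerivAt (fun x : Space3 => x k • f x) _ x := h1.smul (hf x).hasFDerivAt
  have e : coordMul k f = fun x : Space3 => (x k) • f x := by
    ext1 x; simp [coordMul]
  rw [e, h2.fderiv]
  simp [add_comm]

lemma pderiv_coordMul {f : Space3 → Spinor} (hf : Differentiable ℝ f) (j k : Fin 3) :
    pderiv j (coordMul k f) = (if j = k then f else 0) + coordMul k (pderiv j f) := by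
  ext1 x
  rw [pderiv, fderiv_coordMul hf, Pi.add_apply]
  congr 1
  split_ifs with h
  · subst h; simp
  · have : k ≠ j := fun h' => h h'.symm
    simp [this]

/-- Degree `0` is kept apart because a truncated `l - 1` would send derivatives of constants to
degree `0` instead of to zero; the two statements have to be carried through one induction. -/
lemma pderiv_mem_homPoly {l : ℕ} {f : Space3 → Spinor} (k : Fin 3) (hf : f ∈ homPoly l) :
    (l = 0 → pderiv k f = 0) ∧ ∀ j, l = j + 1 → pderiv k f ∈ homPoly j := by
  refine homPoly_induction
    (P := fun l f => (l = 0 → pderiv k f = 0) ∧ ∀ j, l = j + 1 → pderiv k f ∈ homPoly j)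
    (fun v => ⟨fun _ => ?_, fun j hj => by omega⟩) (fun l i f hf h => ⟨fun h => by omega, ?_⟩)
    (fun l => ?_) (fun l f g hf hg h1 h2 => ?_) hf
  · ext1 x; simp [pderiv]
  · intro j hj
    obtain rfl : l = j := by omega
    rw [pderiv_coordMul (differentiable_of_mem_homPoly hf)]
    refine add_mem (by split_ifs; exacts [hf, zero_mem _]) ?_
    rcases l with _ | l
    · rw [h.1 rfl, map_zero]; exact zero_mem _
    · exact coordMul_mem_homPoly i (h.2 l rfl)
  · have : pderiv k 0 = 0 := by ext1 x; simp [pderiv]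
    rw [this]
    exact ⟨fun _ => rfl, fun j _ => zero_mem _⟩
  · rw [pderiv_add (differentiable_of_mem_homPoly hf) (differentiable_of_mem_homPoly hg)]
    exact ⟨fun h => by rw [h1.1 h, h2.1 h, add_zero], fun j hj => add_mem (h1.2 j hj) (h2.2 j hj)⟩

/-- Euler's identity. -/
lemma euler_homPoly {l : ℕ} {f : Space3 → Spinor} (hf : f ∈ homPoly l) (x : Space3) :
    fderiv ℝ f x x = (l : ℂ) • f x := by
  refine homPoly_induction (P := fun l f => fderiv ℝ f x x = (l : ℂ) • f x) (fun v => by simp)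
    (fun l k f hf h => ?_) (fun l => by simp) (fun l f g hf hg h1 h2 => ?_) hf
  · rw [fderiv_coordMul (differentiable_of_mem_homPoly hf), h]
    simp only [coordMul, LinearMap.coe_mk, AddHom.coe_mk, smul_smul, ← add_smul]
    congr 1
    push_cast
    ring
  · rw [fderiv_add (differentiable_of_mem_homPoly hf x) (differentiable_of_mem_homPoly hg x)]
    simp [h1, h2]

lemma fderiv_eq_sum_pderiv (f : Space3 → Spinor) (x y : Space3) :
    fderiv ℝ f x y = ∑ k, ((y k : ℝ) : ℂ) • pderiv k f x := by
  have hy : y = ∑ k, y k • EuclideanSpace.single k (1 : ℝ) := by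
    ext i
    simp [Fin.sum_univ_three]
    fin_cases i <;> simp
  conv_lhs => rw [hy]
  simp [map_sum, pderiv]

/-- Clifford multiplication of a spinor field by the position vector. -/
def slashMul (f : Space3 → Spinor) (x : Space3) : Spinor := slash x (f x)

lemma slashMul_eq_sum (f : Space3 → Spinor) :
    slashMul f = ∑ k, coordMul k (fun x => alphaOp k (f x)) := by
  ext1 x
  simp [slashMul, slash_apply, coordMul]

lemma slashMul_mem_homPoly {l : ℕ} {f : Space3 → Spinor} (hf : f ∈ homPoly l) :
    slashMul f ∈ homPoly (l + 1) := by
  rw [slashMul_eq_sum]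
  exact sum_mem fun k _ => coordMul_mem_homPoly k (clm_comp_mem_homPoly _ hf)

lemma diracOp_mem_homPoly {l : ℕ} {f : Space3 → Spinor} (hf : f ∈ homPoly (l + 1)) :
    diracOp f ∈ homPoly l := by
  have : diracOp f = ∑ k, fun x => alphaOp k (pderiv k f x) := by
    ext1 x; simp [diracOp]
  rw [this]
  exact sum_mem fun k _ => clm_comp_mem_homPoly _ ((pderiv_mem_homPoly k hf).2 l rfl)

lemma diracOp_const {f : Space3 → Spinor} (hf : f ∈ homPoly 0) : diracOp f = 0 := by
  ext1 x
  simp [diracOp, (pderiv_mem_homPoly _ hf).1 rfl]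

lemma pderiv_clm_comp {f : Space3 → Spinor} (hf : Differentiable ℝ f) (A : Spinor →L[ℂ] Spinor)
    (k : Fin 3) (x : Space3) : pderiv k (fun x => A (f x)) x = A (pderiv k f x) := by
  have h := ((A.restrictScalars ℝ).hasFDerivAt (x := f x)).comp x (hf x).hasFDerivAt
  have e : (fun x => A (f x)) = (A.restrictScalars ℝ) ∘ f := rfl
  rw [pderiv, e, h.fderiv]
  rfl

/-- The commutation relation `(α·∇)(α·x) = 3 + 2 x·∇ - (α·x)(α·∇)`. -/
lemma diracOp_slashMul {f : Space3 → Spinor} (hf : Differentiable ℝ f) (x : Space3) :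
    diracOp (slashMul f) x = (3 : ℂ) • f x + (2 : ℂ) • fderiv ℝ f x x - slashMul (diracOp f) x := by
  have hA : ∀ k, Differentiable ℝ fun x => alphaOp k (f x) := fun k =>
    ((alphaOp k).restrictScalars ℝ).differentiable.comp hf
  have hd : ∀ k, Differentiable ℝ (coordMul k fun x => alphaOp k (f x)) := fun k => by
    have h1 : Differentiable ℝ fun x : Space3 => x k :=
      (EuclideanSpace.proj (𝕜 := ℝ) k).differentiable
    have e : (coordMul k fun x => alphaOp k (f x)) = fun x : Space3 => x k • alphaOp k (f x) := by
      ext1 x; simp [coordMul]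
    rw [e]
    exact h1.smul (hA k)
  have e1 : ∀ j, pderiv j (slashMul f) x =
      alphaOp j (f x) + ∑ k, ((x k : ℝ) : ℂ) • alphaOp k (pderiv j f x) := fun j => by
    have : pderiv j (slashMul f) x = ∑ k, pderiv j (coordMul k fun x => alphaOp k (f x)) x := by
      simp only [slashMul_eq_sum, pderiv, Fin.sum_univ_three]
      rw [fderiv_add ((hd 0 x).add (hd 1 x)) (hd 2 x), fderiv_add (hd 0 x) (hd 1 x)]
      rfl
    rw [this]
    simp only [pderiv_coordMul (hA _), Pi.add_apply, Finset.sum_add_distrib]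
    congr 1
    · rw [Finset.sum_eq_single j (fun k _ h => by rw [if_neg h.symm]; rfl) (by simp), if_pos rfl]
    · exact Finset.sum_congr rfl fun k _ => by
        simp [coordMul, pderiv_clm_comp hf]
  have e2 : ∀ j, alphaOp j (alphaOp j (f x)) = f x := fun j => by
    have h := alphaOp_alphaOp_add j j (f x)
    rw [if_pos rfl, ← two_smul ℂ] at h
    exact smul_right_injective _ (two_ne_zero (α := ℂ)) h
  have e3 : ∀ j k, alphaOp j (alphaOp k (pderiv j f x)) =
      (if j = k then (2 : ℂ) else 0) • pderiv j f x - alphaOp k (alphaOp j (pderiv j f x)) :=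
    fun j k => eq_sub_of_add_eq (alphaOp_alphaOp_add j k _)
  simp only [diracOp, e1, map_add, e2, map_sum, map_smul, e3, Finset.sum_add_distrib, smul_sub,
    Finset.sum_sub_distrib, slashMul, slash_apply, smul_smul]
  rw [fderiv_eq_sum_pderiv, Finset.smul_sum, add_sub_assoc]
  congr 1
  · simp only [Finset.sum_const, Finset.card_univ, Fintype.card_fin]
    norm_cast
  · congr 1
    · refine Finset.sum_congr rfl fun j _ => ?_
      rw [Finset.sum_eq_single j (fun k _ h => by rw [if_neg h.symm]; simp) (by simp), if_pos rfl,
        mul_comm, mul_smul]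

lemma diracOp_add {f g : Space3 → Spinor} (hf : Differentiable ℝ f) (hg : Differentiable ℝ g) :
    diracOp (f + g) = diracOp f + diracOp g := by
  ext1 x
  simp [diracOp, pderiv_add hf hg, Finset.sum_add_distrib]

lemma diracOp_smul {f : Space3 → Spinor} (hf : Differentiable ℝ f) (c : ℂ) :
    diracOp (c • f) = c • diracOp f := by
  ext1 x
  have : ∀ k, pderiv k (c • f) x = c • pderiv k f x := fun k => by
    simp [pderiv, fderiv_const_smul (hf x)]
  simp [diracOp, this, Finset.smul_sum]

lemma diracOp_betaOp {f : Space3 → Spinor} (hf : Differentiable ℝ f) (x : Space3) :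
    diracOp (fun x => betaOp (f x)) x = -betaOp (diracOp f x) := by
  have h : ∀ k v, betaOp (alphaOp k v) = -alphaOp k (betaOp v) := fun k v => by
    simpa using congrArg (fun A : Spinor →L[ℂ] Spinor => A v) (betaOp_mul_alphaOp k)
  simp only [diracOp, pderiv_clm_comp hf, map_sum, h, Finset.sum_neg_distrib, neg_neg]

/-! ### Monogenic polynomials and the Fischer decomposition -/

/-- Monogenic (`α · ∇`-harmonic) homogeneous polynomial spinor fields of degree `l`. -/
def monogenic (l : ℕ) : Submodule ℂ (Space3 → Spinor) where
  carrier := {f | f ∈ homPoly l ∧ diracOp f = 0}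
  add_mem' := fun {f g} hf hg => ⟨add_mem hf.1 hg.1, by
    rw [diracOp_add (differentiable_of_mem_homPoly hf.1) (differentiable_of_mem_homPoly hg.1),
      hf.2, hg.2, add_zero]⟩
  zero_mem' := ⟨zero_mem _, by
    ext1 x
    have : ∀ k, pderiv k 0 = 0 := fun k => by ext1 x; simp [pderiv]
    simp [diracOp, this]⟩
  smul_mem' := fun c f hf => ⟨Submodule.smul_mem _ _ hf.1, by
    rw [diracOp_smul (differentiable_of_mem_homPoly hf.1), hf.2, smul_zero]⟩

/-- The sign attached to an eigenvalue of `β`. -/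
def betaSign (b : Bool) : ℝ := if b then 1 else -1

/-- Monogenic homogeneous polynomials in an eigenspace of `β`. -/
def monogenicBeta (l : ℕ) (b : Bool) : Submodule ℂ (Space3 → Spinor) where
  carrier := {f | f ∈ monogenic l ∧ ∀ x, betaOp (f x) = (betaSign b : ℂ) • f x}
  add_mem' := fun {f g} hf hg => ⟨add_mem hf.1 hg.1, fun x => by simp [hf.2 x, hg.2 x]⟩
  zero_mem' := ⟨zero_mem _, fun x => by simp⟩
  smul_mem' := fun c f hf => ⟨Submodule.smul_mem _ _ hf.1, fun x => by
    simp [hf.2 x, smul_comm c]⟩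

lemma monogenicBeta_le_homPoly (l : ℕ) (b : Bool) : monogenicBeta l b ≤ homPoly l :=
  fun _ hf => hf.1.1

instance (l : ℕ) (b : Bool) : FiniteDimensional ℂ (monogenicBeta l b) :=
  Submodule.finiteDimensional_of_le (monogenicBeta_le_homPoly l b)

/-- `β` anticommutes with `α·∇`, hence preserves monogenic fields, and `β² = 1`; so `(1 ± β)/2` are
the projections. -/
lemma monogenic_le_sup_monogenicBeta (l : ℕ) :
    monogenic l ≤ monogenicBeta l true ⊔ monogenicBeta l false := by
  intro f hf
  have hd := differentiable_of_mem_homPoly hf.1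
  have hβ : (fun x => betaOp (f x)) ∈ monogenic l := by
    refine ⟨clm_comp_mem_homPoly _ hf.1, ?_⟩
    ext1 x
    rw [diracOp_betaOp hd, hf.2]
    simp
  have e : f = (1 / 2 : ℂ) • (f + fun x => betaOp (f x)) +
      (1 / 2 : ℂ) • (f - fun x => betaOp (f x)) := by
    ext1 x
    simp only [Pi.add_apply, Pi.smul_apply, Pi.sub_apply]
    module
  rw [e]
  refine Submodule.add_mem_sup (Submodule.smul_mem _ _ ⟨add_mem hf hβ, fun x => ?_⟩)
    (Submodule.smul_mem _ _ ⟨sub_mem hf hβ, fun x => ?_⟩)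
  · simp [betaSign, betaOp_betaOp, add_comm]
  · simp [betaSign, betaOp_betaOp]

lemma slashMul_smul (c : ℂ) (f : Space3 → Spinor) : slashMul (c • f) = c • slashMul f := by
  ext1 x; simp [slashMul]

lemma iterate_slashMul_mem_homPoly {d : ℕ} {f : Space3 → Spinor} (hf : f ∈ homPoly d) (j : ℕ) :
    slashMul^[j] f ∈ homPoly (d + j) := by
  induction j with
  | zero => exact hf
  | succ j ih =>
    rw [Function.iterate_succ_apply']
    exact slashMul_mem_homPoly ih

/-- The Dirac operator lowers the exponent in `(α · x)ʲ m` for monogenic `m`. -/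
lemma exists_diracOp_iterate_slashMul {d : ℕ} {f : Space3 → Spinor} (hf : f ∈ monogenic d) (j : ℕ) :
    ∃ c : ℝ, 0 < c ∧ c ≤ 2 * (d + j) + 3 ∧
      diracOp (slashMul^[j + 1] f) = (c : ℂ) • slashMul^[j] f := by
  have key : ∀ j x, diracOp (slashMul^[j + 1] f) x = ((3 + 2 * (d + j) : ℝ) : ℂ) • slashMul^[j] f x -
      slashMul (diracOp (slashMul^[j] f)) x := fun j x => by
    have h := iterate_slashMul_mem_homPoly hf.1 j
    rw [Function.iterate_succ_apply', diracOp_slashMul (differentiable_of_mem_homPoly h),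
      euler_homPoly h, smul_smul, ← add_smul]
    push_cast
    rfl
  induction j with
  | zero =>
    refine ⟨3 + 2 * d, by positivity, by push_cast; linarith, ?_⟩
    ext1 x
    rw [key, Function.iterate_zero, id, hf.2]
    simp [slashMul]
  | succ j ih =>
    obtain ⟨c, h0, h1, h2⟩ := ih
    -- The upper bound on `c` is carried along to keep the next constant positive: it is at least
    -- `2`.
    refine ⟨3 + 2 * (d + (j + 1 : ℕ)) - c, by push_cast; linarith, by linarith, ?_⟩
    ext1 x
    rw [key, h2, slashMul_smul, ← Function.iterate_succ_apply' slashMul, Pi.smul_apply,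
      Pi.smul_apply, ← sub_smul]
    push_cast
    rfl

/-- The span of the fields `(α · x)ʲ m` with `m` monogenic. -/
def fischerSpan (l : ℕ) : Submodule ℂ (Space3 → Spinor) :=
  Submodule.span ℂ {f | ∃ d j m, d + j = l ∧ m ∈ monogenic d ∧ f = slashMul^[j] m}

lemma fischerSpan_le_homPoly (l : ℕ) : fischerSpan l ≤ homPoly l := by
  refine Submodule.span_le.2 ?_
  rintro _ ⟨d, j, m, rfl, hm, rfl⟩
  exact iterate_slashMul_mem_homPoly hm.1 j

/-- Surjectivity of `α·∇` between consecutive Fischer spans: on generators it lowers the exponent of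
`α·x` with a non-zero factor, which can be divided out. In the decomposition it allows any
polynomial to be corrected to a monogenic one. -/
lemma exists_diracOp_eq_of_mem_fischerSpan {l : ℕ} {q : Space3 → Spinor} (hq : q ∈ fischerSpan l) :
    ∃ p ∈ fischerSpan (l + 1), diracOp p = q := by
  refine Submodule.span_induction ?_ ⟨0, zero_mem _, (zero_mem (monogenic 0)).2⟩ ?_ ?_ hq
  · rintro _ ⟨d, j, m, rfl, hm, rfl⟩
    obtain ⟨c, h0, -, h⟩ := exists_diracOp_iterate_slashMul hm j
    refine ⟨(c : ℂ)⁻¹ • slashMul^[j + 1] m, Submodule.smul_mem _ _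
      (Submodule.subset_span ⟨d, j + 1, m, rfl, hm, rfl⟩), ?_⟩
    rw [diracOp_smul (differentiable_of_mem_homPoly (iterate_slashMul_mem_homPoly hm.1 _)), h,
      smul_smul, inv_mul_cancel₀ (by exact_mod_cast h0.ne'), one_smul]
  · rintro _ _ _ _ ⟨p, hp, rfl⟩ ⟨p', hp', rfl⟩
    exact ⟨p + p', add_mem hp hp', diracOp_add
      (differentiable_of_mem_homPoly (fischerSpan_le_homPoly _ hp))
      (differentiable_of_mem_homPoly (fischerSpan_le_homPoly _ hp'))⟩
  · rintro c _ _ ⟨p, hp, rfl⟩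
    exact ⟨c • p, Submodule.smul_mem _ _ hp,
      diracOp_smul (differentiable_of_mem_homPoly (fischerSpan_le_homPoly _ hp)) _⟩

lemma monogenic_le_fischerSpan (l : ℕ) : monogenic l ≤ fischerSpan l := fun m hm =>
  Submodule.subset_span ⟨l, 0, m, rfl, hm, rfl⟩

/-- Fischer decomposition of homogeneous polynomial spinor fields. -/
theorem homPoly_eq_fischerSpan (l : ℕ) : homPoly l = fischerSpan l := by
  refine le_antisymm ?_ (fischerSpan_le_homPoly l)
  induction l with
  | zero => exact fun f hf => monogenic_le_fischerSpan 0 ⟨hf, diracOp_const hf⟩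
  | succ l ih =>
    intro f hf
    obtain ⟨p, hp, h⟩ := exists_diracOp_eq_of_mem_fischerSpan (ih (diracOp_mem_homPoly hf))
    have hp' := fischerSpan_le_homPoly _ hp
    have : f - p ∈ monogenic (l + 1) := by
      refine ⟨sub_mem hf hp', ?_⟩
      have e : f - p = f + (-1 : ℂ) • p := by simp [sub_eq_add_neg]
      have hd := differentiable_of_mem_homPoly hp'
      rw [e, diracOp_add (differentiable_of_mem_homPoly hf) (hd.const_smul (-1 : ℂ)),
        diracOp_smul hd, h]
      simp
    simpa using add_mem (monogenic_le_fischerSpan _ this) hp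

/-! ### Polar coordinates -/

/-- The unit sphere of `ℝ³`. -/
abbrev Sphere2 : Type := Metric.sphere (0 : Space3) 1

/-- The surface measure of the unit sphere of `ℝ³`. -/
abbrev surfaceMeasure : Measure Sphere2 := (volume : Measure Space3).toSphere

/-- The measure `r² dr` on the half-line. -/
def radialMeasure : Measure ℝ :=
  (volume.restrict (Ioi (0 : ℝ))).withDensity fun r => ENNReal.ofReal (r ^ 2)

instance : SFinite radialMeasure := by
  unfold radialMeasure; infer_instance

/-- Polar coordinates. -/
def polar (p : ℝ × Sphere2) : Space3 := p.1 • (p.2 : Space3)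

lemma measurable_polar : Measurable polar := by
  unfold polar; fun_prop

lemma measurePreserving_val_volumeIoiPow :
    MeasurePreserving (Subtype.val : Ioi (0 : ℝ) → ℝ) (Measure.volumeIoiPow 2) radialMeasure := by
  refine ⟨measurable_subtype_coe, ?_⟩
  ext s hs
  rw [Measure.map_apply measurable_subtype_coe hs, Measure.volumeIoiPow, radialMeasure,
    withDensity_apply _ (measurable_subtype_coe hs), withDensity_apply _ hs]
  rw [setLIntegral_subtype measurableSet_Ioi _ fun a : ℝ => ENNReal.ofReal (a ^ 2),
    Subtype.image_preimage_coe, Measure.restrict_restrict hs, inter_comm]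

/-- The homeomorphism of the punctured space with sphere times half-line preserves measure, and the
origin is null. The half-line subtype is replaced by `ℝ` with a density, so that radial functions
need no coercions. -/
lemma measurePreserving_polar :
    MeasurePreserving polar (radialMeasure.prod surfaceMeasure) volume := by
  have hn : Module.finrank ℝ Space3 - 1 = 2 := by simp
  have h1 := (volume : Measure Space3).measurePreserving_homeomorphUnitSphereProd
  rw [hn] at h1
  have h1' : MeasurePreserving (homeomorphUnitSphereProd Space3).symm
      (surfaceMeasure.prod (Measure.volumeIoiPow 2)) ((volume : Measure Space3).comap (↑)) :=
    h1.symm (homeomorphUnitSphereProd Space3).toMeasurableEquiv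
  have h2 : MeasurePreserving (Subtype.val : ({0}ᶜ : Set Space3) → Space3)
      ((volume : Measure Space3).comap (↑)) volume := by
    refine ⟨measurable_subtype_coe, ?_⟩
    rw [map_comap_subtype_coe (measurableSet_singleton _).compl]
    exact Measure.restrict_eq_self_of_ae_mem (by simp [ae_iff])
  have h3 : MeasurePreserving (Prod.map (id : Sphere2 → Sphere2) (Subtype.val : Ioi (0 : ℝ) → ℝ))
      (surfaceMeasure.prod (Measure.volumeIoiPow 2)) (surfaceMeasure.prod radialMeasure) :=
    (MeasurePreserving.id _).prod measurePreserving_val_volumeIoiPow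
  have h4 := h2.comp h1'
  have h5 : MeasurePreserving (fun p : Sphere2 × ℝ => polar p.swap)
      (surfaceMeasure.prod radialMeasure) volume := by
    refine ⟨measurable_polar.comp measurable_swap, ?_⟩
    have hm : Measurable fun p : Sphere2 × ℝ => polar p.swap :=
      measurable_polar.comp measurable_swap
    rw [← h3.map_eq, Measure.map_map hm h3.measurable, ← h4.map_eq]
    congr 1
  exact h5.comp Measure.measurePreserving_swap

lemma ae_radialMeasure_iff {p : ℝ → Prop} :
    (∀ᵐ r ∂radialMeasure, p r) ↔ ∀ᵐ r ∂volume.restrict (Ioi (0 : ℝ)), p r := by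
  rw [radialMeasure, ae_withDensity_iff (by fun_prop)]
  refine ⟨fun h => ?_, fun h => h.mono fun r hr _ => hr⟩
  filter_upwards [h, ae_restrict_mem measurableSet_Ioi] with r hr h0
  exact hr (by simpa using (mem_Ioi.1 h0).ne')

lemma ae_radialMeasure_pos : ∀ᵐ r ∂radialMeasure, 0 < r :=
  ae_radialMeasure_iff.2 (ae_restrict_mem measurableSet_Ioi)

lemma lintegral_radialMeasure {f : ℝ → ℝ≥0∞} (hf : AEMeasurable f (volume.restrict (Ioi 0))) :
    ∫⁻ r, f r ∂radialMeasure = ∫⁻ r in Ioi 0, ENNReal.ofReal (r ^ 2) * f r := by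
  rw [radialMeasure, lintegral_withDensity_eq_lintegral_mul₀ (by fun_prop) hf]
  rfl

lemma integrable_radialMeasure_iff {E : Type*} [NormedAddCommGroup E] [NormedSpace ℝ E]
    {f : ℝ → E} :
    Integrable f radialMeasure ↔ IntegrableOn (fun r => r ^ 2 • f r) (Ioi 0) := by
  rw [radialMeasure, integrable_withDensity_iff_integrable_smul' (by fun_prop) (by simp)]
  refine integrable_congr (.of_forall fun r => ?_)
  simp [ENNReal.toReal_ofReal (sq_nonneg r)]

lemma integral_radialMeasure {E : Type*} [NormedAddCommGroup E] [NormedSpace ℝ E] (f : ℝ → E) :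
    ∫ r, f r ∂radialMeasure = ∫ r in Ioi 0, r ^ 2 • f r := by
  rw [radialMeasure, integral_withDensity_eq_integral_toReal_smul (by fun_prop) (by simp)]
  refine integral_congr_ae (.of_forall fun r => ?_)
  simp [ENNReal.toReal_ofReal (sq_nonneg r)]

lemma norm_polar {r : ℝ} (hr : 0 < r) (w : Sphere2) : ‖r • (w : Space3)‖ = r := by
  rw [norm_smul, norm_eq_of_mem_sphere, mul_one, Real.norm_eq_abs, abs_of_pos hr]

/-- Integration in polar coordinates. -/
lemma lintegral_polar {f : Space3 → ℝ≥0∞} (hf : AEMeasurable f) :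
    ∫⁻ x, f x = ∫⁻ r, ∫⁻ w : Sphere2, f (r • (w : Space3)) ∂surfaceMeasure ∂radialMeasure := by
  rw [← measurePreserving_polar.map_eq] at hf
  conv_lhs => rw [← measurePreserving_polar.map_eq]
  rw [lintegral_map' hf measurable_polar.aemeasurable]
  exact lintegral_prod _ (hf.comp_measurable measurable_polar)

lemma Integrable.comp_polar {E : Type*} [NormedAddCommGroup E] {f : Space3 → E}
    (hf : Integrable f) : Integrable (fun p => f (polar p)) (radialMeasure.prod surfaceMeasure) :=
  measurePreserving_polar.integrable_comp_of_integrable hf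

lemma integral_polar {E : Type*} [NormedAddCommGroup E] [NormedSpace ℝ E] {f : Space3 → E}
    (hf : Integrable f) :
    ∫ x, f x = ∫ r, ∫ w : Sphere2, f (r • (w : Space3)) ∂surfaceMeasure ∂radialMeasure := by
  have h : AEStronglyMeasurable f ((radialMeasure.prod surfaceMeasure).map polar) := by
    rw [measurePreserving_polar.map_eq]; exact hf.1
  conv_lhs => rw [← measurePreserving_polar.map_eq]
  rw [integral_map measurable_polar.aemeasurable h, integral_prod _ (Integrable.comp_polar hf)]
  rfl

/-! ### Spinor-valued test fields and radial test functions -/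

lemma integrable_smul_of_locallyIntegrable {E : Type*} [NormedAddCommGroup E] [NormedSpace ℝ E]
    {φ : Space3 → ℝ} (hφ : Continuous φ) (hc : HasCompactSupport φ) {f : Space3 → E}
    (hf : LocallyIntegrable f) : Integrable fun x => φ x • f x :=
  hf.integrable_smul_left_of_hasCompactSupport hφ hc

lemma integrable_inner_of_locallyIntegrable {Φ ψ : Space3 → Spinor} (hΦ : Continuous Φ)
    (hc : HasCompactSupport Φ) (hψ : LocallyIntegrable ψ) :
    Integrable fun x => inner ℂ (Φ x) (ψ x) := by
  have h := integrable_smul_of_locallyIntegrable hΦ.norm hc.norm hψ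
  have hm : AEStronglyMeasurable (fun x => inner ℂ (Φ x) (ψ x)) volume :=
    hΦ.aestronglyMeasurable.inner hψ.aestronglyMeasurable
  refine h.norm.mono' hm (.of_forall fun x => ?_)
  rw [norm_smul, norm_norm]
  exact norm_inner_le_norm _ _

lemma pderiv_smul_const {φ : Space3 → ℝ} (hφ : Differentiable ℝ φ) (v : Spinor) (k : Fin 3)
    (x : Space3) : pderiv k (fun x => φ x • v) x = partialDeriv k φ x • v := by
  rw [pderiv, fderiv_smul_const (hφ x)]
  rfl

/-- The weak Dirac equation tested against spinor fields. -/
lemma HasWeakDirac.integral_inner_diracOp {ψ G : Space3 → Spinor} (h : HasWeakDirac ψ G)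
    {Φ : Space3 → Spinor} (hΦ : ContDiff ℝ ∞ Φ) (hc : HasCompactSupport Φ) :
    ∫ x, inner ℂ (diracOp Φ x) (ψ x) = -∫ x, inner ℂ (Φ x) (G x) := by
  obtain ⟨hψ, hG, h⟩ := h
  -- The weak equation is only given for real scalar test functions; a real basis of the spinor
  -- space reduces spinor tests to those.
  let b := Module.finBasis ℝ Spinor
  let φ : Fin (Module.finrank ℝ Spinor) → Space3 → ℝ := fun a x =>
    LinearMap.toContinuousLinearMap (b.coord a) (Φ x)
  have hφ : ∀ a, ContDiff ℝ ∞ (φ a) := fun a => (ContinuousLinearMap.contDiff _).comp hΦ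
  have hφd : ∀ a, Differentiable ℝ (φ a) := fun a => (hφ a).differentiable (by simp)
  have hφc : ∀ a, HasCompactSupport (φ a) := fun a => hc.comp_left (map_zero _)
  have hpc : ∀ a k, Continuous (partialDeriv k (φ a)) := fun a k =>
    ((hφ a).continuous_fderiv (by simp)).clm_apply continuous_const
  have hps : ∀ a k, HasCompactSupport (partialDeriv k (φ a)) := fun a k =>
    (hφc a).fderiv_apply (𝕜 := ℝ) _
  have e : ∀ x, Φ x = ∑ a, φ a x • b a := fun x => (b.sum_repr (Φ x)).symm
  have hαψ : ∀ k, LocallyIntegrable fun x => matAct (diracAlpha k) (ψ x) := fun k => by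
    intro x
    obtain ⟨s, hs, hi⟩ := hψ x
    exact ⟨s, hs, (alphaOp k).integrable_comp hi⟩
  have i1 : ∀ a, Integrable fun x => ∑ k, partialDeriv k (φ a) x • matAct (diracAlpha k) (ψ x) :=
    fun a => integrable_finsetSum _ fun k _ =>
      integrable_smul_of_locallyIntegrable (hpc a k) (hps a k) (hαψ k)
  have i2 : ∀ a, Integrable fun x => φ a x • G x := fun a =>
    integrable_smul_of_locallyIntegrable (hφ a).continuous (hφc a) hG
  have e1 : ∀ x, inner ℂ (diracOp Φ x) (ψ x) =
      ∑ a, inner ℂ (b a) (∑ k, partialDeriv k (φ a) x • matAct (diracAlpha k) (ψ x)) := by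
    intro x
    have e0 : Φ = ∑ a, fun x => φ a x • b a := by ext1 x; simp [e x]
    have e2 : ∀ k, pderiv k Φ x = ∑ a, partialDeriv k (φ a) x • b a := fun k => by
      rw [e0, pderiv, fderiv_sum fun a _ => ((hφd a).smul_const _) x, sum_apply]
      exact Finset.sum_congr rfl fun a _ => pderiv_smul_const (hφd a) _ k x
    simp only [diracOp, e2, map_sum, sum_inner, inner_sum]
    rw [Finset.sum_comm]
    refine Finset.sum_congr rfl fun a _ => Finset.sum_congr rfl fun k _ => ?_
    rw [← Complex.coe_smul, map_smul, Complex.coe_smul, inner_smul_left_eq_smul,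
      inner_smul_right_eq_smul, ← alphaOp_apply, inner_alphaOp]
  have e2 : ∀ x, inner ℂ (Φ x) (G x) = ∑ a, inner ℂ (b a) (φ a x • G x) := by
    intro x
    rw [e x, sum_inner]
    refine Finset.sum_congr rfl fun a _ => ?_
    rw [inner_smul_left_eq_smul, inner_smul_right_eq_smul]
  simp only [e1, e2]
  rw [integral_finsetSum _ fun a _ => (i1 a).const_inner _,
    integral_finsetSum _ fun a _ => (i2 a).const_inner _, ← Finset.sum_neg_distrib]
  refine Finset.sum_congr rfl fun a _ => ?_
  rw [integral_inner (i1 a), integral_inner (i2 a), h _ (hφ a) (hφc a), inner_neg_right]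

/-- Smooth functions with compact support in the open half-line. -/
structure IsHalfLineTest (χ : ℝ → ℝ) : Prop where
  contDiff : ContDiff ℝ ∞ χ
  exists_eq_zero : ∃ a b, 0 < a ∧ a < b ∧ ∀ r, r ∉ Icc a b → χ r = 0

namespace IsHalfLineTest

variable {χ : ℝ → ℝ}

lemma hasCompactSupport (h : IsHalfLineTest χ) : HasCompactSupport χ := by
  obtain ⟨a, b, -, -, hz⟩ := h.exists_eq_zero
  exact HasCompactSupport.intro isCompact_Icc hz

protected lemma deriv (h : IsHalfLineTest χ) : IsHalfLineTest (deriv χ) := by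
  refine ⟨h.contDiff.deriv', ?_⟩
  obtain ⟨a, b, ha, hab, hz⟩ := h.exists_eq_zero
  refine ⟨a, b, ha, hab, fun r hr => ?_⟩
  have : χ =ᶠ[nhds r] fun _ => 0 := by
    filter_upwards [isClosed_Icc.isOpen_compl.mem_nhds hr] with t ht using hz t ht
  rw [this.deriv_eq, deriv_const]

/-- Multiplication of a test function by a function that is smooth on the half-line. -/
lemma mul (h : IsHalfLineTest χ) {u : ℝ → ℝ} (hu : ContDiffOn ℝ ∞ u (Ioi 0)) :
    IsHalfLineTest fun r => u r * χ r := by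
  obtain ⟨a, b, ha, hab, hz⟩ := h.exists_eq_zero
  refine ⟨contDiff_iff_contDiffAt.2 fun r => ?_, a, b, ha, hab, fun r hr => by rw [hz r hr, mul_zero]⟩
  rcases lt_or_ge 0 r with hr | hr
  · exact (hu.contDiffAt (Ioi_mem_nhds hr)).mul h.contDiff.contDiffAt
  · refine contDiffAt_const (c := (0 : ℝ)) |>.congr_of_eventuallyEq ?_
    filter_upwards [Iio_mem_nhds (hr.trans_lt ha)] with t ht
    rw [hz t fun h => (not_lt.2 h.1) ht, mul_zero]

lemma contDiff_comp_norm (h : IsHalfLineTest χ) : ContDiff ℝ ∞ fun x : Space3 => χ ‖x‖ := by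
  obtain ⟨a, b, ha, hab, hz⟩ := h.exists_eq_zero
  refine contDiff_iff_contDiffAt.2 fun x => ?_
  rcases eq_or_ne x 0 with rfl | hx
  · refine contDiffAt_const (c := (0 : ℝ)) |>.congr_of_eventuallyEq ?_
    filter_upwards [Metric.ball_mem_nhds (0 : Space3) ha] with t ht
    exact hz _ fun h => (not_lt.2 h.1) (by simpa using ht)
  · exact h.contDiff.contDiffAt.comp x (contDiffAt_norm ℝ hx)

lemma hasCompactSupport_comp_norm (h : IsHalfLineTest χ) :
    HasCompactSupport fun x : Space3 => χ ‖x‖ := by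
  obtain ⟨a, b, ha, hab, hz⟩ := h.exists_eq_zero
  refine HasCompactSupport.intro (isCompact_closedBall (0 : Space3) b) fun x hx => hz _ fun h => hx ?_
  simpa using h.2

lemma partialDeriv_comp_norm (h : IsHalfLineTest χ) (k : Fin 3) (x : Space3) :
    partialDeriv k (fun x => χ ‖x‖) x = deriv χ ‖x‖ / ‖x‖ * x k := by
  obtain ⟨a, b, ha, hab, hz⟩ := h.exists_eq_zero
  rcases eq_or_ne x 0 with rfl | hx
  · have : (fun x : Space3 => χ ‖x‖) =ᶠ[nhds 0] fun _ => 0 := by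
      filter_upwards [Metric.ball_mem_nhds (0 : Space3) ha] with t ht
      exact hz _ fun h => (not_lt.2 h.1) (by simpa using ht)
    rw [partialDeriv, this.fderiv_eq]
    simp
  · have h0 : HasFDerivAt (fun x : Space3 => ‖x‖) ((1 / (2 * ‖x‖)) • (2 • innerSL ℝ x)) x := by
      have := (hasStrictFDerivAt_norm_sq x).hasFDerivAt.sqrt (by simpa using hx)
      simpa only [Real.sqrt_sq (norm_nonneg _)] using this
    have h1 : HasFDerivAt (fun x : Space3 => χ ‖x‖) _ x :=
      (h.contDiff.differentiable (by simp) ‖x‖).hasDerivAt.comp_hasFDerivAt x h0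
    rw [partialDeriv, h1.fderiv]
    have hn : ‖x‖ ≠ 0 := norm_ne_zero_iff.2 hx
    simp only [smul_apply, innerSL_apply_apply, EuclideanSpace.inner_single_right]
    simp
    field_simp

lemma diracOp_smul (h : IsHalfLineTest χ) {F : Space3 → Spinor} (hF : Differentiable ℝ F)
    (x : Space3) : diracOp (fun x => χ ‖x‖ • F x) x =
      (deriv χ ‖x‖ / ‖x‖) • slashMul F x + χ ‖x‖ • diracOp F x := by
  have hχ := h.contDiff_comp_norm.differentiable (by simp)
  have e : ∀ k, pderiv k (fun x => χ ‖x‖ • F x) x =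
      χ ‖x‖ • pderiv k F x + (deriv χ ‖x‖ / ‖x‖ * x k) • F x := fun k => by
    rw [pderiv, fderiv_fun_smul (hχ x) (hF x), ← h.partialDeriv_comp_norm]
    rfl
  simp only [diracOp, e, map_add, Finset.sum_add_distrib, slashMul, slash_apply, Finset.smul_sum]
  rw [add_comm]
  congr 1 <;> refine Finset.sum_congr rfl fun k _ => ?_
  · rw [← Complex.coe_smul, map_smul, Complex.coe_smul, mul_smul, Complex.coe_smul]
  · rw [← Complex.coe_smul, map_smul, Complex.coe_smul]

end IsHalfLineTest

namespace IsHalfLineTest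

variable {χ : ℝ → ℝ}

lemma deriv_eq_zero {a b : ℝ} (hz : ∀ r, r ∉ Icc a b → χ r = 0) {r : ℝ} (hr : r ∉ Icc a b) :
    deriv χ r = 0 := by
  have : χ =ᶠ[nhds r] fun _ => 0 := by
    filter_upwards [isClosed_Icc.isOpen_compl.mem_nhds hr] with t ht using hz t ht
  rw [this.deriv_eq, deriv_const]

lemma setIntegral_Ioi_eq {a b : ℝ} (ha : 0 < a) (hab : a < b) (hz : ∀ r, r ∉ Icc a b → χ r = 0)
    (f : ℝ → ℝ) : ∫ r in Ioi 0, χ r * f r = ∫ r in (a / 2)..(b + 1), χ r * f r := by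
  rw [intervalIntegral.integral_of_le (by linarith)]
  refine setIntegral_eq_of_subset_of_forall_sdiff_eq_zero measurableSet_Ioi
    (fun t ht => (half_pos ha).trans ht.1) fun t ht => ?_
  rw [hz t fun h => ht.2 ⟨by linarith [h.1], by linarith [h.2]⟩, zero_mul]

lemma integrableOn_mul (h : IsHalfLineTest χ) {u : ℝ → ℝ}
    (hu : ∀ x y, 0 < x → 0 < y → IntervalIntegrable u volume x y) :
    IntegrableOn (fun r => χ r * u r) (Ioi 0) := by
  obtain ⟨a, b, ha, hab, hz⟩ := h.exists_eq_zero
  have h1 : IntegrableOn (fun r => χ r * u r) (Ioc (a / 2) (b + 1)) :=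
    ((hu (a / 2) (b + 1) (by linarith) (by linarith)).continuousOn_mul
      h.contDiff.continuous.continuousOn).1
  refine h1.of_forall_sdiff_eq_zero measurableSet_Ioi fun t ht => ?_
  rw [hz t fun h => ht.2 ⟨by linarith [h.1], by linarith [h.2]⟩, zero_mul]

/-- A test function of zero mean is the derivative of a test function. -/
lemma exists_deriv_eq (h : IsHalfLineTest χ) (h0 : ∫ r, χ r = 0) :
    ∃ η, IsHalfLineTest η ∧ deriv η = χ := by
  obtain ⟨a, b, ha, hab, hz⟩ := h.exists_eq_zero
  have hc := h.contDiff.continuous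
  have hd : ∀ r, HasDerivAt (fun r => ∫ t in (a / 2)..r, χ t) (χ r) r := fun r =>
    intervalIntegral.integral_hasDerivAt_right (hc.intervalIntegrable _ _)
      (hc.stronglyMeasurableAtFilter _ _) hc.continuousAt
  have hd' : deriv (fun r => ∫ t in (a / 2)..r, χ t) = χ := funext fun r => (hd r).deriv
  refine ⟨fun r => ∫ t in (a / 2)..r, χ t, ⟨?_, a, b, ha, hab, fun r hr => ?_⟩, hd'⟩
  · rw [contDiff_infty_iff_deriv, hd']
    exact ⟨fun r => (hd r).differentiableAt, h.contDiff⟩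
  · rcases lt_or_ge r a with hr' | hr'
    · refine (intervalIntegral.integral_congr (g := fun _ => 0) fun t ht => hz t fun h => ?_).trans
        (by simp)
      have := h.1.trans ht.2
      rcases le_max_iff.1 this with h | h <;> linarith
    · have hbr : b < r := by
        by_contra hbr
        exact hr ⟨hr', not_lt.1 hbr⟩
      show ∫ t in (a / 2)..r, χ t = 0
      rw [intervalIntegral.integral_of_le (by linarith), ← h0]
      refine setIntegral_eq_integral_of_forall_compl_eq_zero fun t ht => hz t fun h => ht ?_
      exact ⟨by linarith [h.1], by linarith [h.2]⟩

lemma exists_integral_eq_one : ∃ θ, IsHalfLineTest θ ∧ ∫ r, θ r = 1 := by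
  let f : ContDiffBump (2 : ℝ) := ⟨1 / 2, 1, by norm_num, by norm_num⟩
  refine ⟨f.normed volume, ⟨f.contDiff_normed, 1, 3, by norm_num, by norm_num, fun r hr => ?_⟩,
    f.integral_normed⟩
  by_contra h
  have : r ∈ Function.support (f.normed volume) := h
  rw [f.support_normed_eq, Metric.mem_ball, Real.dist_eq] at this
  have := abs_lt.1 this
  exact hr ⟨by linarith [this.1], by linarith [this.2]⟩

lemma sub_smul {θ : ℝ → ℝ} (h : IsHalfLineTest χ) (hθ : IsHalfLineTest θ) (c : ℝ) :
    IsHalfLineTest fun r => χ r - c * θ r := by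
  obtain ⟨a, b, ha, hab, hz⟩ := h.exists_eq_zero
  obtain ⟨a', b', ha', hab', hz'⟩ := hθ.exists_eq_zero
  refine ⟨h.contDiff.sub (contDiff_const.mul hθ.contDiff), min a a', max b b', lt_min ha ha',
    (min_le_left _ _).trans_lt (hab.trans_le (le_max_left _ _)), fun r hr => ?_⟩
  rw [hz r fun h => hr ⟨(min_le_left _ _).trans h.1, h.2.trans (le_max_left _ _)⟩,
    hz' r fun h => hr ⟨(min_le_right _ _).trans h.1, h.2.trans (le_max_right _ _)⟩]
  simp

end IsHalfLineTest

lemma IsACPrimitive.integral_deriv_mul {w w' : ℝ → ℝ} (h : IsACPrimitive w w') {χ : ℝ → ℝ}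
    (hχ : IsHalfLineTest χ) :
    ∫ r in Ioi 0, deriv χ r * w r = -∫ r in Ioi 0, χ r * w' r := by
  obtain ⟨a, b, ha, hab, hz⟩ := hχ.exists_eq_zero
  rw [IsHalfLineTest.setIntegral_Ioi_eq ha hab (fun r hr => IsHalfLineTest.deriv_eq_zero hz hr),
    IsHalfLineTest.setIntegral_Ioi_eq ha hab hz]
  have ha2 : 0 < a / 2 := half_pos ha
  have hb2 : 0 < b + 1 := by linarith
  have hχac : AbsolutelyContinuousOnInterval χ (a / 2) (b + 1) :=
    (hχ.contDiff.of_le (by simp)).contDiffOn.absolutelyContinuousOnInterval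
  have h1 := hχac.integral_mul_deriv_eq_deriv_mul (h.absolutelyContinuous ha2 hb2)
  rw [hz (a / 2) fun h => by linarith [h.1], hz (b + 1) fun h => by linarith [h.2]] at h1
  have h2 : ∫ r in (a / 2)..(b + 1), χ r * deriv w r = ∫ r in (a / 2)..(b + 1), χ r * w' r := by
    refine intervalIntegral.integral_congr_ae ?_
    filter_upwards [h.ae_hasDerivAt] with t ht htm
    rw [(ht (uIcc_subset_Ioi ha2 hb2 (uIoc_subset_uIcc htm))).deriv]
  rw [← h2, h1]
  ring

lemma isACPrimitive_integral {u' : ℝ → ℝ} (c : ℝ)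
    (hu' : ∀ x y, 0 < x → 0 < y → IntervalIntegrable u' volume x y) :
    IsACPrimitive (fun r => c + ∫ t in (1 : ℝ)..r, u' t) u' := fun x y hx hy => by
  refine ⟨hu' x y hx hy, ?_⟩
  rw [add_sub_add_left_eq_sub,
    intervalIntegral.integral_interval_sub_left (hu' _ _ one_pos hy) (hu' _ _ one_pos hx)]

/-- The du Bois-Reymond lemma on the half-line. -/
theorem exists_isACPrimitive {u u' : ℝ → ℝ}
    (hu : ∀ x y, 0 < x → 0 < y → IntervalIntegrable u volume x y)
    (hu' : ∀ x y, 0 < x → 0 < y → IntervalIntegrable u' volume x y)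
    (h : ∀ χ, IsHalfLineTest χ →
      ∫ r in Ioi 0, deriv χ r * u r = -∫ r in Ioi 0, χ r * u' r) :
    ∃ w, IsACPrimitive w u' ∧ ∀ᵐ r : ℝ, 0 < r → u r = w r := by
  have hH := isACPrimitive_integral 0 hu'
  set H : ℝ → ℝ := fun r => 0 + ∫ t in (1 : ℝ)..r, u' t
  have hHi : ∀ x y, 0 < x → 0 < y → IntervalIntegrable H volume x y := fun x y hx hy =>
    (hH.continuousOn hx hy).intervalIntegrable
  have hv : ∀ x y, 0 < x → 0 < y → IntervalIntegrable (fun r => u r - H r) volume x y :=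
    fun x y hx hy => (hu x y hx hy).sub (hHi x y hx hy)
  obtain ⟨θ, hθ, hθ1⟩ := IsHalfLineTest.exists_integral_eq_one
  set c : ℝ := ∫ r in Ioi 0, θ r * (u r - H r)
  have hd0 : ∀ χ, IsHalfLineTest χ → ∫ r in Ioi 0, deriv χ r * (u r - H r) = 0 := fun χ hχ => by
    simp only [mul_sub]
    rw [integral_sub (hχ.deriv.integrableOn_mul hu) (hχ.deriv.integrableOn_mul hHi), h χ hχ,
      hH.integral_deriv_mul hχ, sub_self]
  have key : ∀ χ, IsHalfLineTest χ → ∫ r in Ioi 0, χ r * (u r - H r - c) = 0 := fun χ hχ => by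
    have hχint : ∫ r in Ioi 0, χ r = ∫ r, χ r := by
      obtain ⟨a, b, ha, hab, hz⟩ := hχ.exists_eq_zero
      refine setIntegral_eq_integral_of_forall_compl_eq_zero fun t ht => hz t fun h => ht ?_
      exact ha.trans_le h.1
    have hI : ∀ {f : ℝ → ℝ}, IsHalfLineTest f → Integrable f := fun hf =>
      hf.contDiff.continuous.integrable_of_hasCompactSupport hf.hasCompactSupport
    have ht := hχ.sub_smul hθ (∫ r, χ r)
    obtain ⟨η, hη, hηd⟩ := ht.exists_deriv_eq (by
      rw [integral_sub (hI hχ) ((hI hθ).const_mul _), integral_const_mul, hθ1]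
      ring)
    have h1 := hd0 η hη
    rw [hηd] at h1
    -- Subtracting `(∫ χ) θ` makes the test function mean-free, hence a derivative; the constant `c`
    -- is the price.
    have e : ∀ r, (χ r - (∫ r, χ r) * θ r) * (u r - H r) =
        χ r * (u r - H r) - (∫ r, χ r) * (θ r * (u r - H r)) := fun r => by ring
    simp only [e] at h1
    rw [integral_sub (hχ.integrableOn_mul hv) ((hθ.integrableOn_mul hv).const_mul _),
      integral_const_mul] at h1
    simp only [mul_sub _ _ c]
    rw [integral_sub (hχ.integrableOn_mul hv) ((hI hχ).integrableOn.mul_const c),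
      integral_mul_const, hχint]
    exact h1
  refine ⟨fun r => c + ∫ t in (1 : ℝ)..r, u' t, isACPrimitive_integral c hu', ?_⟩
  have hloc : LocallyIntegrableOn (fun r => u r - H r - c) (Ioi 0) := by
    rw [locallyIntegrableOn_iff isOpen_Ioi.isLocallyClosed]
    intro K hK hKc
    rcases K.eq_empty_or_nonempty with rfl | hne
    · simp
    obtain ⟨a, ha, hamin⟩ := hKc.exists_isLeast hne
    obtain ⟨b, hb, hbmax⟩ := hKc.exists_isGreatest hne
    have ha0 : 0 < a := hK ha
    have hb0 : 0 < b := hK hb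
    have h1 := (hv (a / 2) b (half_pos ha0) hb0).sub (intervalIntegrable_const (c := c))
    exact h1.1.mono_set fun t ht => ⟨by linarith [hamin ht], hbmax ht⟩
  have := isOpen_Ioi.ae_eq_zero_of_integral_contDiff_smul_eq_zero hloc fun g hg hgc hgs => by
    have hg' : IsHalfLineTest g := by
      refine ⟨hg, ?_⟩
      rcases (tsupport g).eq_empty_or_nonempty with he | hne
      · exact ⟨1, 2, one_pos, one_lt_two, fun r _ => by
          rw [tsupport_eq_empty_iff.1 he]; rfl⟩
      obtain ⟨a, ha, hamin⟩ := IsCompact.exists_isLeast hgc hne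
      obtain ⟨b, hb, hbmax⟩ := IsCompact.exists_isGreatest hgc hne
      have ha0 : 0 < a := hgs ha
      refine ⟨a, b + 1, ha0, by linarith [hamin hb], fun r hr => ?_⟩
      by_contra hne
      have := subset_tsupport g (Function.mem_support.2 hne)
      exact hr ⟨hamin this, by linarith [hbmax this]⟩
    rw [← key g hg']
    refine (setIntegral_eq_integral_of_forall_compl_eq_zero fun t ht => ?_).symm
    rw [image_eq_zero_of_notMem_tsupport fun h => ht (hgs h), zero_smul]
  filter_upwards [this] with r hr h0
  have h2 := hr h0
  have h3 : H r = 0 + ∫ t in (1 : ℝ)..r, u' t := rfl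
  linarith

/-! ### Spherical coefficients and their radial equations -/

/-- The coefficient of `ψ` along the spherical field `Q`, as a function of the radius. -/
def sphCoef (Q ψ : Space3 → Spinor) (r : ℝ) : ℂ :=
  ∫ w : Sphere2, inner ℂ (Q w) (ψ (r • (w : Space3))) ∂surfaceMeasure

/-- In the exponent, `d` is the homogeneity of `Q` and `2` comes from the volume element. No
smoothness of `χ` is assumed, so that indicator functions of annuli are allowed as well. -/
lemma integral_inner_radial_smul {d : ℕ} {Q ψ : Space3 → Spinor} (hQ : Q ∈ homPoly d) {χ : ℝ → ℝ}
    (hi : Integrable fun x => inner ℂ (χ ‖x‖ • Q x) (ψ x)) :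
    IntegrableOn (fun r => (r ^ (d + 2) * χ r) • sphCoef Q ψ r) (Ioi 0) ∧
      ∫ x, inner ℂ (χ ‖x‖ • Q x) (ψ x) =
        ∫ r in Ioi 0, (r ^ (d + 2) * χ r) • sphCoef Q ψ r := by
  have e : (fun r : ℝ => ∫ w : Sphere2, inner ℂ (χ ‖r • (w : Space3)‖ • Q (r • (w : Space3)))
      (ψ (r • (w : Space3))) ∂surfaceMeasure) =ᵐ[radialMeasure]
      fun r => (r ^ d * χ r) • sphCoef Q ψ r := by
    filter_upwards [ae_radialMeasure_pos] with r hr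
    rw [sphCoef, ← integral_smul]
    refine integral_congr_ae (.of_forall fun w => ?_)
    simp only [norm_polar hr, homPoly_smul hQ, Complex.coe_smul, smul_smul]
    rw [inner_smul_left_eq_smul, mul_comm]
  have e2 : ∀ r : ℝ, r ^ 2 • (r ^ d * χ r) • sphCoef Q ψ r =
      (r ^ (d + 2) * χ r) • sphCoef Q ψ r := fun r => by
    rw [smul_smul]
    congr 1
    ring
  constructor
  · have h1 := ((Integrable.comp_polar hi).integral_prod_left).congr e
    rw [integrable_radialMeasure_iff] at h1
    simpa only [e2] using h1
  · rw [integral_polar hi, integral_congr_ae e, integral_radialMeasure]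
    simp only [e2]

/-- Apply the polar formula with the indicator of an annulus as radial factor, then divide by the
power of `r`, which is bounded away from `0` there. -/
lemma intervalIntegrable_sphCoef {d : ℕ} {Q ψ : Space3 → Spinor} (hQ : Q ∈ homPoly d)
    (hψ : LocallyIntegrable ψ) {x y : ℝ} (hx : 0 < x) (hy : 0 < y) :
    IntervalIntegrable (sphCoef Q ψ) volume x y := by
  set a := min x y
  set b := max x y
  have ha : 0 < a := lt_min hx hy
  set χ : ℝ → ℝ := (Icc a b).indicator fun _ => 1
  have hQc := (contDiff_of_mem_homPoly hQ).continuous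
  have hi : Integrable fun x => inner ℂ (χ ‖x‖ • Q x) (ψ x) := by
    have hK := isCompact_closedBall (0 : Space3) b
    obtain ⟨C, hC⟩ := hK.exists_bound_of_continuousOn hQc.continuousOn
    have h0 : IntegrableOn (fun x => C * ‖ψ x‖) (Metric.closedBall (0 : Space3) b) :=
      (hψ.integrableOn_isCompact hK).norm.const_mul C
    have h1 := h0.integrable_indicator Metric.isClosed_closedBall.measurableSet
    have hχm : Measurable χ := measurable_const.indicator measurableSet_Icc
    refine h1.mono' ?_ (.of_forall fun z => ?_)
    · exact (((hχm.comp measurable_norm).smul hQc.measurable).aestronglyMeasurable).inner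
        hψ.aestronglyMeasurable
    · by_cases hz : ‖z‖ ∈ Icc a b
      · have hz' : z ∈ Metric.closedBall (0 : Space3) b := by simpa using hz.2
        rw [indicator_of_mem hz']
        simp only [χ, indicator_of_mem hz, one_smul]
        exact (norm_inner_le_norm _ _).trans (mul_le_mul_of_nonneg_right (hC z hz') (norm_nonneg _))
      · simp only [χ, indicator_of_notMem hz, zero_smul, inner_zero_left, norm_zero]
        refine indicator_nonneg (fun z hz => mul_nonneg ?_ (norm_nonneg _)) _
        exact (norm_nonneg _).trans (hC z hz)
  have h1 := (integral_inner_radial_smul hQ hi).1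
  have h2 : IntegrableOn (fun r => r ^ (d + 2) • sphCoef Q ψ r) (Icc a b) := by
    refine (h1.mono_set fun t ht => ha.trans_le ht.1).congr_fun (fun r hr => ?_) measurableSet_Icc
    simp only [χ, indicator_of_mem hr, mul_one]
  have h3 : IntegrableOn (fun r : ℝ => (r ^ (d + 2))⁻¹ • r ^ (d + 2) • sphCoef Q ψ r) (Icc a b) := by
    refine h2.continuousOn_smul (ContinuousOn.inv₀ (by fun_prop) fun t ht => ?_) isCompact_Icc
    exact (pow_pos (ha.trans_le ht.1) _).ne'
  rw [intervalIntegrable_iff]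
  refine (h3.mono_set Ioc_subset_Icc_self).congr_fun (fun r hr => ?_) measurableSet_Ioc
  have : r ≠ 0 := (ha.trans hr.1).ne'
  simp only [smul_smul]
  rw [inv_mul_cancel₀ (pow_ne_zero _ this), one_smul]

lemma intervalIntegrable_re_sphCoef {d : ℕ} {Q ψ : Space3 → Spinor} (hQ : Q ∈ homPoly d)
    (hψ : LocallyIntegrable ψ) (c : ℂ) {u : ℝ → ℝ} (hu : ContinuousOn u (Ioi 0)) {x y : ℝ}
    (hx : 0 < x) (hy : 0 < y) :
    IntervalIntegrable (fun r => u r * (c * sphCoef Q ψ r).re) volume x y := by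
  have h := (intervalIntegrable_sphCoef hQ hψ hx hy).const_mul c
  have h2 : IntervalIntegrable (fun r => (c * sphCoef Q ψ r).re) volume x y :=
    ⟨h.1.re, h.2.re⟩
  exact h2.continuousOn_mul (hu.mono (uIcc_subset_Ioi hx hy))

section radial

variable {ψ G : Space3 → Spinor} {χ : ℝ → ℝ}

lemma IsHalfLineTest.integrable_inner (hχ : IsHalfLineTest χ) {d : ℕ} {Q : Space3 → Spinor}
    (hQ : Q ∈ homPoly d) (hψ : LocallyIntegrable ψ) :
    Integrable fun x => inner ℂ (χ ‖x‖ • Q x) (ψ x) :=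
  integrable_inner_of_locallyIntegrable
    (hχ.contDiff_comp_norm.continuous.smul (contDiff_of_mem_homPoly hQ).continuous)
    hχ.hasCompactSupport_comp_norm.smul_right hψ

lemma IsHalfLineTest.integral_inner_smul (hχ : IsHalfLineTest χ) {d : ℕ} {Q : Space3 → Spinor}
    (hQ : Q ∈ homPoly d) (hψ : LocallyIntegrable ψ) :
    IntegrableOn (fun r => (r ^ (d + 2) * χ r) • sphCoef Q ψ r) (Ioi 0) ∧
      ∫ x, inner ℂ (χ ‖x‖ • Q x) (ψ x) =
        ∫ r in Ioi 0, (r ^ (d + 2) * χ r) • sphCoef Q ψ r :=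
  integral_inner_radial_smul hQ (hχ.integrable_inner hQ hψ)

lemma contDiffOn_inv_pow (n : ℕ) : ContDiffOn ℝ ∞ (fun r : ℝ => (r ^ n)⁻¹) (Ioi 0) := by
  refine ContDiffOn.inv (by fun_prop) fun r hr => (pow_pos hr n).ne'

/-- The test field is `χ(|x|)P`: as `P` is monogenic, `α·∇` acts only on `χ` and produces `χ'/|x|`
times `(α·x)P`. -/
lemma HasWeakDirac.integral_sphCoef_slashMul (h : HasWeakDirac ψ G) {l : ℕ} {P : Space3 → Spinor}
    (hP : P ∈ monogenic l) (hχ : IsHalfLineTest χ) :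
    ∫ r in Ioi 0, (r ^ (l + 2) * deriv χ r) • sphCoef (slashMul P) ψ r =
      -∫ r in Ioi 0, (r ^ (l + 2) * χ r) • sphCoef P G r := by
  have hPd := differentiable_of_mem_homPoly hP.1
  have hχ' := hχ.deriv.mul (contDiffOn_inv_pow 1)
  have h1 := h.integral_inner_diracOp (Φ := fun x => χ ‖x‖ • P x)
    (hχ.contDiff_comp_norm.smul (contDiff_of_mem_homPoly hP.1))
    hχ.hasCompactSupport_comp_norm.smul_right
  have e : ∀ x, diracOp (fun x => χ ‖x‖ • P x) x = ((‖x‖ ^ 1)⁻¹ * deriv χ ‖x‖) • slashMul P x :=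
    fun x => by
      rw [hχ.diracOp_smul hPd, hP.2]
      simp [div_eq_inv_mul]
  simp only [e] at h1
  rw [(hχ'.integral_inner_smul (slashMul_mem_homPoly hP.1) h.1).2,
    (hχ.integral_inner_smul hP.1 h.2.1).2] at h1
  rw [← h1]
  refine setIntegral_congr_fun measurableSet_Ioi fun r hr => ?_
  have : r ≠ 0 := ne_of_gt hr
  congr 1
  field_simp
  ring

/-- For a radial factor `u`, `α·∇(u (α·x)P) = (r u' + (2l+3) u) P = r^(-2l-2) (r^(2l+3) u)' P`, by
Euler's identity. Thus `u = r^(-2l-3) χ` leaves only a multiple of `χ'`. -/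
lemma HasWeakDirac.integral_sphCoef (h : HasWeakDirac ψ G) {l : ℕ} {P : Space3 → Spinor}
    (hP : P ∈ monogenic l) (hχ : IsHalfLineTest χ) :
    ∫ r in Ioi 0, ((r ^ l)⁻¹ * deriv χ r) • sphCoef P ψ r =
      -∫ r in Ioi 0, ((r ^ l)⁻¹ * χ r) • sphCoef (slashMul P) G r := by
  have hPd := differentiable_of_mem_homPoly hP.1
  have hTP := slashMul_mem_homPoly hP.1
  have hχ2 := hχ.mul (contDiffOn_inv_pow (2 * l + 3))
  have hχ' := hχ.deriv.mul (contDiffOn_inv_pow (2 * l + 2))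
  have h1 := h.integral_inner_diracOp
    (Φ := fun x => ((‖x‖ ^ (2 * l + 3))⁻¹ * χ ‖x‖) • slashMul P x)
    (hχ2.contDiff_comp_norm.smul (contDiff_of_mem_homPoly hTP))
    hχ2.hasCompactSupport_comp_norm.smul_right
  have hd : ∀ r, 0 < r → deriv (fun r : ℝ => (r ^ (2 * l + 3))⁻¹ * χ r) r =
      (r ^ (2 * l + 3))⁻¹ * deriv χ r - (2 * l + 3) * (r ^ (2 * l + 4))⁻¹ * χ r := fun r hr => by
    have h1 := ((hasDerivAt_pow (2 * l + 3) r).inv (pow_pos hr _).ne').mul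
      (hχ.contDiff.differentiable (by simp) r).hasDerivAt
    refine h1.deriv.trans ?_
    have : r ≠ 0 := hr.ne'
    simp only [Pi.inv_apply]
    push_cast
    field_simp
    simp only [show 2 * l + 4 = 2 * l + 3 + 1 by omega]
    ring
  have e : ∀ x, diracOp (fun x => ((‖x‖ ^ (2 * l + 3))⁻¹ * χ ‖x‖) • slashMul P x) x =
      ((‖x‖ ^ (2 * l + 2))⁻¹ * deriv χ ‖x‖) • P x := fun x => by
    rw [hχ2.diracOp_smul (differentiable_of_mem_homPoly hTP), diracOp_slashMul hPd, hP.2,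
      euler_homPoly hP.1]
    rcases eq_or_ne x 0 with rfl | hx
    · obtain ⟨a, b, ha, hab, hz⟩ := hχ.exists_eq_zero
      have h0 : (0 : ℝ) ∉ Icc a b := fun h => (not_lt.2 h.1) ha
      simp [hz 0 h0]
    · have hn : 0 < ‖x‖ := norm_pos_iff.2 hx
      rw [hd _ hn]
      simp only [slashMul, slash_slash, Pi.zero_apply, map_zero, sub_zero, Complex.coe_smul]
      have e3 : (3 : ℂ) • P x + (2 : ℂ) • (l : ℂ) • P x = (3 + 2 * l : ℝ) • P x := by
        rw [smul_smul, ← add_smul, ← Complex.coe_smul]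
        push_cast
        rfl
      rw [e3, smul_smul, smul_smul, ← add_smul]
      congr 1
      field_simp
      ring
  simp only [e] at h1
  rw [(hχ'.integral_inner_smul hP.1 h.1).2, (hχ2.integral_inner_smul hTP h.2.1).2] at h1
  have e4 : ∀ r : ℝ, 0 < r → r ^ (l + 2) * ((r ^ (2 * l + 2))⁻¹ * deriv χ r) =
      (r ^ l)⁻¹ * deriv χ r := fun r hr => by
    have : r ≠ 0 := hr.ne'
    field_simp
    ring
  have e5 : ∀ r : ℝ, 0 < r → r ^ (l + 1 + 2) * ((r ^ (2 * l + 3))⁻¹ * χ r) =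
      (r ^ l)⁻¹ * χ r := fun r hr => by
    have : r ≠ 0 := hr.ne'
    field_simp
    ring
  rw [setIntegral_congr_fun measurableSet_Ioi fun r hr => by rw [← e4 r hr], h1,
    setIntegral_congr_fun measurableSet_Ioi fun r hr => by rw [e5 r hr]]

lemma exists_isACPrimitive_of_sphCoef {d d' : ℕ} {Q Q' : Space3 → Spinor} (hQ : Q ∈ homPoly d)
    (hQ' : Q' ∈ homPoly d') (hψ : LocallyIntegrable ψ) (hG : LocallyIntegrable G) {u : ℝ → ℝ}
    (hu : ContDiffOn ℝ ∞ u (Ioi 0))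
    (h : ∀ χ, IsHalfLineTest χ → ∫ r in Ioi 0, (u r * deriv χ r) • sphCoef Q ψ r =
      -∫ r in Ioi 0, (u r * χ r) • sphCoef Q' G r) (c : ℂ) :
    ∃ w, IsACPrimitive w (fun r => u r * (c * sphCoef Q' G r).re) ∧
      ∀ᵐ r : ℝ, 0 < r → u r * (c * sphCoef Q ψ r).re = w r := by
  have key : ∀ {d : ℕ} {Q φ : Space3 → Spinor}, Q ∈ homPoly d → LocallyIntegrable φ →
      ∀ χ, IsHalfLineTest χ → ∫ r in Ioi 0, χ r * (u r * (c * sphCoef Q φ r).re) =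
        (c * ∫ r in Ioi 0, (u r * χ r) • sphCoef Q φ r).re := by
    intro d Q φ hQ hφ χ hχ
    -- The polar formula creates the factor `r^(d+2)`; it is divided out of the test function
    -- beforehand.
    have hχ2 := (hχ.mul hu).mul (contDiffOn_inv_pow (d + 2))
    have h1 := (hχ2.integral_inner_smul hQ hφ).1
    have h2 : IntegrableOn (fun r => (u r * χ r) • sphCoef Q φ r) (Ioi 0) := by
      refine h1.congr_fun (fun r hr => ?_) measurableSet_Ioi
      simp only
      congr 1
      rw [mul_inv_cancel_left₀ (pow_pos hr _).ne']
    rw [← integral_const_mul]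
    refine Eq.trans ?_ (integral_re (𝕜 := ℂ) (h2.const_mul c))
    refine setIntegral_congr_fun measurableSet_Ioi fun r hr => ?_
    simp
    ring
  refine exists_isACPrimitive
    (fun x y hx hy => intervalIntegrable_re_sphCoef hQ hψ c hu.continuousOn hx hy)
    (fun x y hx hy => intervalIntegrable_re_sphCoef hQ' hG c hu.continuousOn hx hy)
    fun χ hχ => ?_
  rw [key hQ hψ _ hχ.deriv, key hQ' hG _ hχ, h χ hχ]
  simp

/-- The radial equation for the coefficient along `(α · x) P`. -/
lemma HasWeakDirac.exists_primitive_slashMul (h : HasWeakDirac ψ G) {l : ℕ} {P : Space3 → Spinor}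
    (hP : P ∈ monogenic l) (c : ℂ) :
    ∃ w, IsACPrimitive w (fun r => r ^ (l + 2) * (c * sphCoef P G r).re) ∧
      ∀ᵐ r : ℝ, 0 < r → r ^ (l + 2) * (c * sphCoef (slashMul P) ψ r).re = w r :=
  exists_isACPrimitive_of_sphCoef (slashMul_mem_homPoly hP.1) hP.1 h.1 h.2.1 (by fun_prop)
    (fun _ hχ => h.integral_sphCoef_slashMul hP hχ) c

/-- The radial equation for the coefficient along `P`. -/
lemma HasWeakDirac.exists_primitive (h : HasWeakDirac ψ G) {l : ℕ} {P : Space3 → Spinor}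
    (hP : P ∈ monogenic l) (c : ℂ) :
    ∃ w, IsACPrimitive w (fun r => (r ^ l)⁻¹ * (c * sphCoef (slashMul P) G r).re) ∧
      ∀ᵐ r : ℝ, 0 < r → (r ^ l)⁻¹ * (c * sphCoef P ψ r).re = w r :=
  exists_isACPrimitive_of_sphCoef hP.1 (slashMul_mem_homPoly hP.1) h.1 h.2.1
    (contDiffOn_inv_pow l) (fun _ hχ => h.integral_sphCoef hP hχ) c

end radial

/-! ### Density of polynomial fields on the sphere -/

/-- Restriction of homogeneous polynomial spinor fields to the sphere. -/
def restrHom (l : ℕ) : homPoly l →ₗ[ℂ] C(Sphere2, Spinor) where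
  toFun f := ⟨fun w => f.1 w,
    (contDiff_of_mem_homPoly f.2).continuous.comp continuous_subtype_val⟩
  map_add' f g := by ext1 w; rfl
  map_smul' c f := by ext1 w; rfl

/-- The polynomial spinor fields on the sphere. -/
def polyFields : Submodule ℂ C(Sphere2, Spinor) := ⨆ l, LinearMap.range (restrHom l)

lemma restrHom_mem_polyFields {l : ℕ} (f : homPoly l) : restrHom l f ∈ polyFields :=
  Submodule.mem_iSup_of_mem l ⟨f, rfl⟩

/-- The coordinate functions on the sphere. -/
def sphereCoord (k : Fin 3) : C(Sphere2, ℝ) := ⟨fun w => (w : Space3) k, by fun_prop⟩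

lemma sphereCoord_smul_mem_polyFields (k : Fin 3) {F : C(Sphere2, Spinor)} (hF : F ∈ polyFields) :
    sphereCoord k • F ∈ polyFields := by
  refine Submodule.iSup_induction _ (motive := fun F => sphereCoord k • F ∈ polyFields) hF ?_ ?_ ?_
  · rintro l _ ⟨f, rfl⟩
    have := restrHom_mem_polyFields ⟨coordMul k f.1, coordMul_mem_homPoly k f.2⟩
    convert this using 1
    ext1 w
    simp [sphereCoord, restrHom, coordMul]
  · rw [smul_zero]; exact zero_mem _
  · intro F F' h h'
    have e : sphereCoord k • (F + F') = sphereCoord k • F + sphereCoord k • F' := by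
      ext1 w; exact smul_add _ _ _
    rw [e]; exact add_mem h h'

/-- The real functions that act on the polynomial spinor fields. -/
def polyMultipliers : Subalgebra ℝ C(Sphere2, ℝ) where
  carrier := {φ | ∀ F ∈ polyFields, φ • F ∈ polyFields}
  mul_mem' := fun {φ φ'} h h' F hF => by rw [mul_smul]; exact h _ (h' F hF)
  add_mem' := fun {φ φ'} h h' F hF => by
    have e : (φ + φ') • F = φ • F + φ' • F := by ext1 w; exact add_smul _ _ _
    rw [e]; exact add_mem (h F hF) (h' F hF)
  algebraMap_mem' := fun c F hF => by
    have : (algebraMap ℝ C(Sphere2, ℝ) c) • F = (c : ℂ) • F := by ext1 w; simp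
    rw [this]
    exact Submodule.smul_mem _ _ hF

lemma polyMultipliers_topologicalClosure : polyMultipliers.topologicalClosure = ⊤ := by
  refine ContinuousMap.subalgebra_topologicalClosure_eq_top_of_separatesPoints _ fun x y hxy => ?_
  have : ∃ k, (x : Space3) k ≠ (y : Space3) k := by
    by_contra! h
    exact hxy (Subtype.ext (PiLp.ext h))
  obtain ⟨k, hk⟩ := this
  exact ⟨sphereCoord k, ⟨sphereCoord k, fun F hF => sphereCoord_smul_mem_polyFields k hF, rfl⟩, hk⟩

/-- Spinor fields form no algebra, so Stone-Weierstrass is applied to the real multipliers of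
`polyFields`: the coordinates separate points, the multipliers are dense, and they act continuously.
-/
lemma smul_mem_closure_polyFields (φ : C(Sphere2, ℝ)) {F : C(Sphere2, Spinor)}
    (hF : F ∈ polyFields) : φ • F ∈ polyFields.topologicalClosure := by
  have hc : Continuous fun φ : C(Sphere2, ℝ) => φ • F := by
    let L : C(Sphere2, ℝ) →ₗ[ℝ] C(Sphere2, Spinor) :=
      { toFun := fun φ => φ • F
        map_add' := fun φ φ' => by ext1 w; exact add_smul _ _ _
        map_smul' := fun c φ => by ext1 w; exact smul_assoc c (φ w) (F w) }
    refine (L.mkContinuous ‖F‖ fun φ => ?_).continuous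
    refine (ContinuousMap.norm_le _ (by positivity)).2 fun w => ?_
    refine (norm_smul_le _ _).trans ?_
    rw [mul_comm]
    exact mul_le_mul (F.norm_coe_le_norm w) (φ.norm_coe_le_norm w) (norm_nonneg _) (norm_nonneg _)
  have h1 : φ ∈ closure (polyMultipliers : Set C(Sphere2, ℝ)) := by
    rw [← Subalgebra.topologicalClosure_coe, polyMultipliers_topologicalClosure]
    trivial
  exact map_mem_closure (f := fun φ : C(Sphere2, ℝ) => φ • F) hc h1 fun φ (hφ : φ ∈ polyMultipliers) => hφ F hF

/-- Expand in a constant real basis: every continuous field is a finite sum of continuous real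
multiples of constant fields. -/
lemma polyFields_topologicalClosure : polyFields.topologicalClosure = ⊤ := by
  refine eq_top_iff.2 fun F _ => ?_
  let b := Module.finBasis ℝ Spinor
  let φ : Fin (Module.finrank ℝ Spinor) → C(Sphere2, ℝ) := fun a =>
    ⟨fun w => LinearMap.toContinuousLinearMap (b.coord a) (F w), by fun_prop⟩
  let K : Fin (Module.finrank ℝ Spinor) → homPoly 0 := fun a => ⟨fun _ => b a, ⟨b a, rfl⟩⟩
  have e : F = ∑ a, φ a • restrHom 0 (K a) := by
    ext1 w
    rw [ContinuousMap.sum_apply]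
    exact (b.sum_repr (F w)).symm
  rw [e]
  exact sum_mem fun a _ => smul_mem_closure_polyFields _ (restrHom_mem_polyFields _)

/-- Continuous spinor fields on the sphere as square integrable fields. -/
abbrev sphereL2 : C(Sphere2, Spinor) →L[ℂ] Lp Spinor 2 surfaceMeasure :=
  ContinuousMap.toLp 2 surfaceMeasure ℂ

lemma dense_polyFields : (polyFields.map sphereL2.toLinearMap).topologicalClosure = ⊤ := by
  rw [← Submodule.dense_iff_topologicalClosure_eq_top]
  have h1 : Dense (polyFields : Set C(Sphere2, Spinor)) := by
    rw [Submodule.dense_iff_topologicalClosure_eq_top, polyFields_topologicalClosure]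
  exact (ContinuousMap.toLp_denseRange Spinor surfaceMeasure ℂ (by simp)).dense_image
    sphereL2.continuous h1

lemma inner_sphereL2 (F : C(Sphere2, Spinor)) (g : Lp Spinor 2 surfaceMeasure) :
    inner ℂ (sphereL2 F) g = ∫ w, inner ℂ (F w) (g w) ∂surfaceMeasure := by
  rw [L2.inner_def]
  refine integral_congr_ae ?_
  filter_upwards [ContinuousMap.coeFn_toLp (p := 2) (𝕜 := ℂ) surfaceMeasure F] with w hw
  rw [hw]

lemma inner_sphereL2_sphereL2 (F G : C(Sphere2, Spinor)) :
    inner ℂ (sphereL2 F) (sphereL2 G) = ∫ w, inner ℂ (F w) (G w) ∂surfaceMeasure := by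
  rw [inner_sphereL2]
  refine integral_congr_ae ?_
  filter_upwards [ContinuousMap.coeFn_toLp (p := 2) (𝕜 := ℂ) surfaceMeasure G] with w hw
  rw [hw]

/-- Clifford multiplication by the normal on the sphere. -/
def sphereSlash : C(Sphere2, Spinor) →ₗ[ℂ] C(Sphere2, Spinor) where
  toFun F := ⟨fun w => slash (w : Space3) (F w), by
    simp only [slash_apply]
    fun_prop⟩
  map_add' F G := by ext1 w; simp
  map_smul' c F := by ext1 w; simp

lemma sphereSlash_restrHom {l : ℕ} (f : homPoly l) :
    sphereSlash (restrHom l f) =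
      restrHom (l + 1) ⟨slashMul f.1, slashMul_mem_homPoly f.2⟩ := rfl

lemma sphereSlash_sphereSlash (F : C(Sphere2, Spinor)) : sphereSlash (sphereSlash F) = F := by
  ext1 w
  simp [sphereSlash, slash_slash]

lemma inner_sphereSlash (F G : C(Sphere2, Spinor)) :
    inner ℂ (sphereL2 (sphereSlash F)) (sphereL2 (sphereSlash G)) =
      inner ℂ (sphereL2 F) (sphereL2 G) := by
  rw [inner_sphereL2_sphereL2, inner_sphereL2_sphereL2]
  refine integral_congr_ae (.of_forall fun w => ?_)
  simp [sphereSlash, inner_slash, slash_slash]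

/-! ### Orthogonality of monogenic polynomials -/

/-- The weak Dirac derivative of a smooth field is its classical one. -/
lemma hasWeakDirac_diracOp {f : Space3 → Spinor} (hc : ContDiff ℝ ∞ f) :
    HasWeakDirac f (diracOp f) := by
  have hd : Differentiable ℝ f := hc.differentiable (by simp)
  have hA : ∀ k, ContDiff ℝ ∞ fun x => alphaOp k (f x) := fun k =>
    ((alphaOp k).restrictScalars ℝ).contDiff.comp hc
  have hpd : ∀ k, Continuous fun x => pderiv k (fun x => alphaOp k (f x)) x := fun k =>
    ((hA k).continuous_fderiv (by simp)).clm_apply continuous_const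
  have he : diracOp f = fun x => ∑ k, pderiv k (fun x => alphaOp k (f x)) x := by
    ext1 x
    simp only [diracOp, pderiv_clm_comp hd]
  have hDc : Continuous (diracOp f) := by
    rw [he]
    exact continuous_finsetSum _ fun k _ => hpd k
  refine ⟨hc.continuous.locallyIntegrable, hDc.locallyIntegrable, fun φ hφ hφc => ?_⟩
  have hpc : ∀ k, Continuous (partialDeriv k φ) := fun k =>
    (hφ.continuous_fderiv (by simp)).clm_apply continuous_const
  have hps : ∀ k, HasCompactSupport (partialDeriv k φ) := fun k => hφc.fderiv_apply (𝕜 := ℝ) _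
  have h1 : ∀ k, Integrable fun x => partialDeriv k φ x • alphaOp k (f x) := fun k =>
    integrable_smul_of_locallyIntegrable (hpc k) (hps k) (hA k).continuous.locallyIntegrable
  have h2 : ∀ k, Integrable fun x => φ x • pderiv k (fun x => alphaOp k (f x)) x := fun k =>
    integrable_smul_of_locallyIntegrable hφ.continuous hφc (hpd k).locallyIntegrable
  have h3 : ∀ k, ∫ x, partialDeriv k φ x • alphaOp k (f x) =
      -∫ x, φ x • pderiv k (fun x => alphaOp k (f x)) x := fun k => by
    have := integral_smul_fderiv_eq_neg_fderiv_smul_of_integrable (μ := (volume : Measure Space3))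
      (f := φ) (g := fun x => alphaOp k (f x)) (v := EuclideanSpace.single k 1) (h1 k) (h2 k)
      (integrable_smul_of_locallyIntegrable hφ.continuous hφc (hA k).continuous.locallyIntegrable)
      (fun x _ => hφ.differentiable (by simp) x) fun x _ => (hA k).differentiable (by simp) x
    exact (neg_eq_iff_eq_neg.2 this).symm
  simp only [← alphaOp_apply]
  rw [integral_finsetSum _ fun k _ => h1 k]
  simp only [h3, Finset.sum_neg_distrib]
  rw [← integral_finsetSum _ fun k _ => h2 k, he]
  simp only [Finset.smul_sum]

/-- A monogenic polynomial is a weak solution of the massless Dirac equation. -/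
lemma hasWeakDirac_of_mem_monogenic {l : ℕ} {P : Space3 → Spinor} (hP : P ∈ monogenic l) :
    HasWeakDirac P 0 :=
  hP.2 ▸ hasWeakDirac_diracOp (contDiff_of_mem_homPoly hP.1)

lemma sphCoef_homPoly {l : ℕ} {Q : Space3 → Spinor} (hQ : Q ∈ homPoly l) (P : Space3 → Spinor)
    (r : ℝ) : sphCoef P Q r = ((r ^ l : ℝ) : ℂ) * sphCoef P Q 1 := by
  simp only [sphCoef, homPoly_smul hQ, one_smul, inner_smul_right, integral_const_mul]

lemma eq_zero_of_ae_mul_eq_const {a K : ℝ} {u : ℝ → ℝ} (hu : StrictMonoOn u (Ioi 0))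
    (h : ∀ᵐ r : ℝ, 0 < r → u r * a = K) : a = 0 := by
  have key : ∀ x y : ℝ, x < y → ∃ r ∈ Ioo x y, 0 < r → u r * a = K := fun x y hxy => by
    by_contra! hn
    have h0 : volume (Ioo x y) = 0 :=
      measure_mono_null (fun r hr (hp : 0 < r → u r * a = K) => (hn r hr).2 (hp (hn r hr).1))
        (ae_iff.1 h)
    rw [Real.volume_Ioo, ENNReal.ofReal_eq_zero] at h0
    linarith
  obtain ⟨r, hr, h1⟩ := key 1 2 (by norm_num)
  obtain ⟨s, hs, h2⟩ := key 2 3 (by norm_num)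
  have hr0 : 0 < r := by linarith [hr.1]
  have hs0 : 0 < s := by linarith [hs.1]
  have hlt := hu hr0 hs0 (hr.2.trans hs.1)
  have e : (u s - u r) * a = 0 := by rw [sub_mul, h1 hr0, h2 hs0, sub_self]
  exact (mul_eq_zero.1 e).resolve_left (by linarith)

lemma complex_eq_zero_of_re {z : ℂ} (h : ∀ c : ℂ, (c * z).re = 0) : z = 0 := by
  have h1 := h 1
  have h2 := h (-Complex.I)
  apply Complex.ext
  · simpa using h1
  · simpa using h2

lemma IsACPrimitive.eq_const_of_zero {w u' : ℝ → ℝ} (h : IsACPrimitive w u') (h0 : ∀ r, u' r = 0) {r : ℝ}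
    (hr : 0 < r) : w r = w 1 := by
  have := (h 1 r one_pos hr).2
  simp only [h0, intervalIntegral.integral_zero] at this
  linarith

/-- A monogenic `Q` solves the Dirac equation with zero right-hand side, so `r^(l+2)` times its
coefficient along `(α·x)P` is constant in `r`. By homogeneity this quantity is also a multiple of
`r^(l+2+l')`, and the multiple must vanish. -/
lemma sphCoef_slashMul_monogenic {l l' : ℕ} {P Q : Space3 → Spinor} (hP : P ∈ monogenic l)
    (hQ : Q ∈ monogenic l') : sphCoef (slashMul P) Q 1 = 0 := by
  refine complex_eq_zero_of_re fun c => ?_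
  obtain ⟨w, hw, he⟩ := (hasWeakDirac_of_mem_monogenic hQ).exists_primitive_slashMul hP c
  refine eq_zero_of_ae_mul_eq_const (K := w 1) (u := fun r => r ^ (l + 2) * r ^ l')
    (fun x hx y hy hxy => ?_) ?_
  · simp only [← pow_add]
    exact pow_lt_pow_left₀ hxy (le_of_lt hx) (by omega)
  · filter_upwards [he] with r hr h0
    have h2 := hr h0
    rw [hw.eq_const_of_zero (fun r => by simp [sphCoef]) h0, sphCoef_homPoly hQ.1] at h2
    rw [← h2, mul_left_comm, Complex.re_ofReal_mul, mul_assoc]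

/-- Same argument with the other radial equation: `r^(l'-l)` times the coefficient at radius `1` is
constant. For `l = l'` it says nothing, so inside one degree an orthonormal basis has to be chosen.
-/
lemma sphCoef_monogenic_of_lt {l l' : ℕ} {P Q : Space3 → Spinor} (hP : P ∈ monogenic l)
    (hQ : Q ∈ monogenic l') (hl : l < l') : sphCoef P Q 1 = 0 := by
  refine complex_eq_zero_of_re fun c => ?_
  obtain ⟨w, hw, he⟩ := (hasWeakDirac_of_mem_monogenic hQ).exists_primitive hP c
  obtain ⟨n, rfl⟩ := Nat.exists_eq_add_of_lt hl
  refine eq_zero_of_ae_mul_eq_const (K := w 1) (u := fun r => r ^ (n + 1))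
    (fun x hx y hy hxy => pow_lt_pow_left₀ hxy (le_of_lt hx) (by omega)) ?_
  filter_upwards [he] with r hr h0
  have h2 := hr h0
  rw [hw.eq_const_of_zero (fun r => by simp [sphCoef]) h0, sphCoef_homPoly hQ.1] at h2
  rw [← h2, mul_left_comm, Complex.re_ofReal_mul, ← mul_assoc]
  congr 1
  field_simp
  ring

/-! ### The Hilbert basis of spherical spinors -/

/-- The square integrable restrictions of monogenic polynomials to the sphere. -/
def sphericalMonogenic (i : ℕ × Bool) : monogenicBeta i.1 i.2 →ₗ[ℂ] Lp Spinor 2 surfaceMeasure :=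
  sphereL2.toLinearMap ∘ₗ restrHom i.1 ∘ₗ Submodule.inclusion (monogenicBeta_le_homPoly i.1 i.2)

/-- The indices of the basis of spherical spinors. -/
abbrev SphIndex : Type :=
  Σ i : ℕ × Bool, Fin (Module.finrank ℂ (LinearMap.range (sphericalMonogenic i)))

lemma exists_sphPoly (a : SphIndex) : ∃ P : monogenicBeta a.1.1 a.1.2, sphericalMonogenic a.1 P =
    (stdOrthonormalBasis ℂ (LinearMap.range (sphericalMonogenic a.1)) a.2 :
      Lp Spinor 2 surfaceMeasure) :=
  (stdOrthonormalBasis ℂ (LinearMap.range (sphericalMonogenic a.1)) a.2).2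

/-- The basic monogenic polynomials. -/
def sphPoly (a : SphIndex) : Space3 → Spinor := (exists_sphPoly a).choose.1

lemma sphPoly_mem (a : SphIndex) : sphPoly a ∈ monogenicBeta a.1.1 a.1.2 :=
  (exists_sphPoly a).choose.2

/-- The restriction of the basic monogenic polynomials to the sphere. -/
def sphField (a : SphIndex) : C(Sphere2, Spinor) := restrHom a.1.1 ⟨sphPoly a, (sphPoly_mem a).1.1⟩

lemma sphereL2_sphField (a : SphIndex) : sphereL2 (sphField a) =
    (stdOrthonormalBasis ℂ (LinearMap.range (sphericalMonogenic a.1)) a.2 :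
      Lp Spinor 2 surfaceMeasure) := (exists_sphPoly a).choose_spec

lemma inner_sphField (a b : SphIndex) : inner ℂ (sphereL2 (sphField a)) (sphereL2 (sphField b)) =
    sphCoef (sphPoly a) (sphPoly b) 1 := by
  rw [inner_sphereL2_sphereL2, sphCoef]
  simp only [one_smul]
  rfl

lemma sphCoef_conj {P Q : Space3 → Spinor} :
    starRingEnd ℂ (sphCoef P Q 1) = sphCoef Q P 1 := by
  rw [sphCoef, sphCoef, ← integral_conj]
  simp only [one_smul, inner_conj_symm]

/-- `β` is self-adjoint and the eigenvalues differ, so the fields are orthogonal at every point,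
before any integration. -/
lemma sphCoef_eq_zero_of_betaSign_ne {l l' : ℕ} {b b' : Bool} {P Q : Space3 → Spinor}
    (hP : P ∈ monogenicBeta l b) (hQ : Q ∈ monogenicBeta l' b') (hb : b ≠ b') :
    sphCoef P Q 1 = 0 := by
  have h : ∀ x, inner ℂ (P x) (Q x) = 0 := fun x => by
    have h1 := inner_betaOp (P x) (Q x)
    rw [hP.2, hQ.2, inner_smul_left, inner_smul_right, Complex.conj_ofReal] at h1
    have h2 : betaSign b ≠ betaSign b' := by
      revert hb
      cases b <;> cases b' <;> norm_num [betaSign]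
    by_contra hne
    exact h2 (by exact_mod_cast mul_right_cancel₀ hne h1)
  simp [sphCoef, h]

lemma sphCoef_monogenicBeta_of_ne {i j : ℕ × Bool} {P Q : Space3 → Spinor}
    (hP : P ∈ monogenicBeta i.1 i.2) (hQ : Q ∈ monogenicBeta j.1 j.2) (hij : i ≠ j) :
    sphCoef P Q 1 = 0 := by
  by_cases hb : i.2 = j.2
  · rcases lt_trichotomy i.1 j.1 with h | h | h
    · exact sphCoef_monogenic_of_lt hP.1 hQ.1 h
    · exact absurd (Prod.ext h hb) hij
    · rw [← sphCoef_conj, sphCoef_monogenic_of_lt hQ.1 hP.1 h, map_zero]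
  · exact sphCoef_eq_zero_of_betaSign_ne hP hQ hb

lemma orthonormal_sphField : Orthonormal ℂ fun a => sphereL2 (sphField a) := by
  classical
  rw [orthonormal_iff_ite]
  rintro ⟨i, a⟩ ⟨j, b⟩
  by_cases hij : i = j
  · subst hij
    have h := orthonormal_iff_ite.1
      (stdOrthonormalBasis ℂ (LinearMap.range (sphericalMonogenic i))).orthonormal a b
    rw [Submodule.coe_inner] at h
    simp only [sphereL2_sphField, h, Sigma.mk.injEq, heq_eq_eq, true_and]
  · rw [inner_sphField, sphCoef_monogenicBeta_of_ne (sphPoly_mem _) (sphPoly_mem _) hij,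
      if_neg fun h => hij (congrArg Sigma.fst h)]

/-- The basis of spherical spinors. -/
def sphBasisField : SphIndex ⊕ SphIndex → C(Sphere2, Spinor) :=
  Sum.elim sphField fun a => sphereSlash (sphField a)

lemma orthonormal_sphBasisField : Orthonormal ℂ fun a => sphereL2 (sphBasisField a) := by
  classical
  have h0 : ∀ a b, inner ℂ (sphereL2 (sphereSlash (sphField a))) (sphereL2 (sphField b)) = 0 :=
    fun a b => by
      rw [← sphCoef_slashMul_monogenic (sphPoly_mem a).1 (sphPoly_mem b).1,
        inner_sphereL2_sphereL2, sphCoef]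
      simp only [one_smul]
      rfl
  rw [orthonormal_iff_ite]
  rintro (a | a) (b | b)
  · simpa [sphBasisField] using orthonormal_iff_ite.1 orthonormal_sphField a b
  · rw [← inner_conj_symm]
    simp [sphBasisField, h0]
  · simp [sphBasisField, h0]
  · simp only [sphBasisField, Sum.elim_inr, inner_sphereSlash, Sum.inr.injEq]
    exact orthonormal_iff_ite.1 orthonormal_sphField a b

/-- The expansion is made in `L²`, and injectivity of the embedding of continuous functions brings
it back to an exact finite combination of continuous fields. -/
lemma restrHom_mem_span_of_monogenicBeta {i : ℕ × Bool} {P : Space3 → Spinor}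
    (hP : P ∈ monogenicBeta i.1 i.2) :
    restrHom i.1 ⟨P, hP.1.1⟩ ∈ Submodule.span ℂ (range sphField) := by
  let B := stdOrthonormalBasis ℂ (LinearMap.range (sphericalMonogenic i))
  let v : LinearMap.range (sphericalMonogenic i) := ⟨sphericalMonogenic i ⟨P, hP⟩, ⟨_, rfl⟩⟩
  have h1 : sphereL2 (restrHom i.1 ⟨P, hP.1.1⟩) = sphereL2 (∑ a, B.repr v a • sphField ⟨i, a⟩) := by
    simp only [map_sum, map_smul, sphereL2_sphField]
    have := congrArg (Subtype.val) (B.sum_repr v)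
    rw [Submodule.coe_sum] at this
    exact this.symm
  rw [ContinuousMap.toLp_injective surfaceMeasure h1]
  exact sum_mem fun a _ => Submodule.smul_mem _ _ (Submodule.subset_span ⟨_, rfl⟩)

lemma restrHom_mem_span_of_monogenic {l : ℕ} {P : Space3 → Spinor} (hP : P ∈ monogenic l) :
    restrHom l ⟨P, hP.1⟩ ∈ Submodule.span ℂ (range sphField) := by
  obtain ⟨Q, hQ, R, hR, rfl⟩ := Submodule.mem_sup.1 (monogenic_le_sup_monogenicBeta l hP)
  exact add_mem (restrHom_mem_span_of_monogenicBeta (i := (l, true)) hQ)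
    (restrHom_mem_span_of_monogenicBeta (i := (l, false)) hR)

/-- On the unit sphere `(α·x)² = 1`, so each Fischer component `(α·x)^j m` restricts to `m` or to
`(α·x)m` according to the parity of `j`. -/
lemma polyFields_le_span : polyFields ≤ Submodule.span ℂ (range sphBasisField) := by
  have h1 : Submodule.span ℂ (range sphField) ≤ Submodule.span ℂ (range sphBasisField) :=
    Submodule.span_mono (by rintro _ ⟨a, rfl⟩; exact ⟨Sum.inl a, rfl⟩)
  have h2 : ∀ F ∈ Submodule.span ℂ (range sphField),
      sphereSlash F ∈ Submodule.span ℂ (range sphBasisField) := fun F hF => by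
    have := Submodule.mem_map_of_mem (f := sphereSlash) hF
    rw [Submodule.map_span] at this
    refine Submodule.span_mono ?_ this
    rintro _ ⟨_, ⟨a, rfl⟩, rfl⟩
    exact ⟨Sum.inr a, rfl⟩
  have h3 : ∀ {d : ℕ} {m : Space3 → Spinor} (hm : m ∈ monogenic d) (j : ℕ),
      restrHom (d + j) ⟨slashMul^[j] m, iterate_slashMul_mem_homPoly hm.1 j⟩ =
        sphereSlash^[j] (restrHom d ⟨m, hm.1⟩) := fun {d m} hm j => by
    induction j with
    | zero => rfl
    | succ j ih =>
      rw [Function.iterate_succ_apply' sphereSlash, ← ih, sphereSlash_restrHom]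
      ext1 w
      simp only [restrHom, Function.iterate_succ_apply' slashMul]
      rfl
  have h4 : ∀ {d : ℕ} {m : Space3 → Spinor} (hm : m ∈ monogenic d) (j : ℕ),
      sphereSlash^[j] (restrHom d ⟨m, hm.1⟩) ∈ Submodule.span ℂ (range sphBasisField) :=
    fun {d m} hm j => by
      have hinv : sphereSlash^[2] = id := by
        ext1 F; exact sphereSlash_sphereSlash F
      rcases Nat.even_or_odd' j with ⟨n, rfl | rfl⟩
      · rw [Function.iterate_mul, hinv, Function.iterate_id]
        exact h1 (restrHom_mem_span_of_monogenic hm)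
      · rw [Function.iterate_succ_apply', Function.iterate_mul, hinv, Function.iterate_id]
        exact h2 _ (restrHom_mem_span_of_monogenic hm)
  refine iSup_le fun l => ?_
  rintro _ ⟨⟨f, hf⟩, rfl⟩
  have hf' := hf
  rw [homPoly_eq_fischerSpan] at hf'
  have key : ∀ f ∈ fischerSpan l, ∀ hf : f ∈ homPoly l,
      restrHom l ⟨f, hf⟩ ∈ Submodule.span ℂ (range sphBasisField) := by
    intro f hf
    refine Submodule.span_induction ?_ (fun h => ?_) ?_ ?_ hf
    · rintro _ ⟨d, j, m, rfl, hm, rfl⟩ h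
      rw [h3 hm j]
      exact h4 hm j
    · have : restrHom l ⟨0, h⟩ = 0 := map_zero (restrHom l)
      rw [this]; exact zero_mem _
    · intro f g hf hg h h' h0
      rw [← fischerSpan, ← homPoly_eq_fischerSpan] at hf hg
      exact add_mem (h hf) (h' hg)
    · intro c f hf h h0
      rw [← fischerSpan, ← homPoly_eq_fischerSpan] at hf
      exact Submodule.smul_mem _ c (h hf)
  exact key f hf' hf

/-- The Hilbert basis of spherical spinors. -/
def sphBasis : HilbertBasis (SphIndex ⊕ SphIndex) ℂ (Lp Spinor 2 surfaceMeasure) :=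
  HilbertBasis.mk orthonormal_sphBasisField <| by
    rw [← dense_polyFields]
    refine Submodule.topologicalClosure_mono ?_
    refine (Submodule.map_mono polyFields_le_span).trans ?_
    rw [Submodule.map_span]
    refine Submodule.span_mono ?_
    rintro _ ⟨_, ⟨a, rfl⟩, rfl⟩
    exact ⟨a, rfl⟩

lemma sphBasis_apply (a : SphIndex ⊕ SphIndex) : sphBasis a = sphereL2 (sphBasisField a) :=
  congrFun (HilbertBasis.coe_mk _ _) a

/-- Parseval's identity for the spherical spinors. -/
theorem lintegral_sphere_eq_tsum {f : Sphere2 → Spinor} (hf : MemLp f 2 surfaceMeasure) :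
    ∫⁻ w, ‖f w‖ₑ ^ 2 ∂surfaceMeasure =
      ∑' a, (‖∫ w : Sphere2, inner ℂ (sphPoly a w) (f w) ∂surfaceMeasure‖ₑ ^ 2 +
        ‖∫ w : Sphere2, inner ℂ (slashMul (sphPoly a) w) (f w) ∂surfaceMeasure‖ₑ ^ 2) := by
  have h1 : ∫⁻ w, ‖f w‖ₑ ^ 2 ∂surfaceMeasure = ENNReal.ofReal (‖hf.toLp f‖ ^ 2) := by
    rw [Lp.norm_toLp, ← ENNReal.toReal_pow, ENNReal.ofReal_toReal (by simp [hf.2.ne]),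
      eLpNorm_eq_lintegral_rpow_enorm_toReal (by simp) (by simp)]
    simp only [ENNReal.toReal_ofNat, ENNReal.rpow_ofNat]
    rw [← ENNReal.rpow_natCast, ← ENNReal.rpow_mul]
    simp
  have h2 : HasSum (fun a => ‖inner ℂ (sphBasis a) (hf.toLp f)‖ ^ 2) (‖hf.toLp f‖ ^ 2) := by
    have h := sphBasis.hasSum_inner_mul_inner (hf.toLp f) (hf.toLp f)
    have e : ∀ a, inner ℂ (hf.toLp f) (sphBasis a) * inner ℂ (sphBasis a) (hf.toLp f) =
        ((‖inner ℂ (sphBasis a) (hf.toLp f)‖ ^ 2 : ℝ) : ℂ) := fun a => by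
      rw [← inner_conj_symm (hf.toLp f), Complex.conj_mul']
      push_cast
      rfl
    simp only [e, inner_self_eq_norm_sq_to_K] at h
    refine (RCLike.hasSum_ofReal ℂ).1 ?_
    convert h using 1
    · rfl
    · exact RCLike.ofReal_pow (K := ℂ) _ 2
  have h3 : ∀ F : C(Sphere2, Spinor), inner ℂ (sphereL2 F) (hf.toLp f) =
      ∫ w, inner ℂ (F w) (f w) ∂surfaceMeasure := fun F => by
    rw [inner_sphereL2]
    refine integral_congr_ae ?_
    filter_upwards [hf.coeFn_toLp] with w hw
    rw [hw]
  rw [h1, ← h2.tsum_eq, ENNReal.ofReal_tsum_of_nonneg (fun a => by positivity) h2.summable,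
    ENNReal.summable.tsum_sum (f := fun a => ENNReal.ofReal _) ENNReal.summable, ← ENNReal.tsum_add]
  refine tsum_congr fun a => ?_
  simp only [sphBasis_apply, h3, ENNReal.ofReal_pow (norm_nonneg _), ofReal_norm]
  rfl

/-! ### Weighted norms in terms of spherical coefficients -/

lemma restrict_Ioi_absolutelyContinuous_radialMeasure :
    (volume.restrict (Ioi (0 : ℝ))) ≪ radialMeasure := by
  rw [← Measure.ae_le_iff_absolutelyContinuous]
  exact fun s hs => ae_radialMeasure_iff.1 hs

lemma aestronglyMeasurable_polar {E : Type*} [TopologicalSpace E] {f : Space3 → E}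
    (hf : AEStronglyMeasurable f) : AEStronglyMeasurable (fun p => f (polar p))
      (radialMeasure.prod surfaceMeasure) :=
  hf.comp_measurePreserving measurePreserving_polar

/-- Almost every restriction of a measurable function to a sphere is measurable. -/
lemma ae_aestronglyMeasurable_sphere {E : Type*} [TopologicalSpace E]
    [TopologicalSpace.PseudoMetrizableSpace E] {f : Space3 → E}
    (hf : AEStronglyMeasurable f) : ∀ᵐ r ∂volume.restrict (Ioi (0 : ℝ)),
      AEStronglyMeasurable (fun w : Sphere2 => f (r • (w : Space3))) surfaceMeasure :=
  ae_radialMeasure_iff.1 (aestronglyMeasurable_polar hf).prodMk_left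

lemma ae_integrable_sphere {ψ : Space3 → Spinor} (hψ : LocallyIntegrable ψ) :
    ∀ᵐ r ∂volume.restrict (Ioi (0 : ℝ)),
      Integrable (fun w : Sphere2 => ψ (r • (w : Space3))) surfaceMeasure := by
  have h : ∀ n : ℕ, ∀ᵐ r ∂radialMeasure, Integrable (fun w : Sphere2 =>
      (Metric.closedBall (0 : Space3) n).indicator ψ (r • (w : Space3))) surfaceMeasure := fun n =>
    (Integrable.comp_polar ((hψ.integrableOn_isCompact
      (isCompact_closedBall (0 : Space3) n)).integrable_indicator
        Metric.isClosed_closedBall.measurableSet)).prod_right_ae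
  filter_upwards [ae_radialMeasure_iff.1 (ae_all_iff.2 h), ae_restrict_mem measurableSet_Ioi]
    with r hr h0
  obtain ⟨n, hn⟩ := exists_nat_ge r
  refine (hr n).congr (.of_forall fun w => indicator_of_mem ?_ _)
  simpa [norm_polar h0] using hn

lemma aestronglyMeasurable_sphCoef {Q ψ : Space3 → Spinor} (hQ : Continuous Q)
    (hψ : AEStronglyMeasurable ψ) :
    AEStronglyMeasurable (sphCoef Q ψ) (volume.restrict (Ioi 0)) := by
  refine AEStronglyMeasurable.mono_ac restrict_Ioi_absolutelyContinuous_radialMeasure ?_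
  have h1 : AEStronglyMeasurable (fun p : ℝ × Sphere2 => Q p.2)
      (radialMeasure.prod surfaceMeasure) :=
    (hQ.comp (continuous_subtype_val.comp continuous_snd)).aestronglyMeasurable
  have h2 : AEStronglyMeasurable (fun p : ℝ × Sphere2 => inner ℂ (Q p.2) (ψ (polar p)))
      (radialMeasure.prod surfaceMeasure) := h1.inner (aestronglyMeasurable_polar hψ)
  exact h2.integral_prod_right'

lemma integrable_inner_sphere {Q : Space3 → Spinor} (hQ : Continuous Q) {f : Sphere2 → Spinor}
    (hf : Integrable f surfaceMeasure) :
    Integrable (fun w : Sphere2 => inner ℂ (Q w) (f w)) surfaceMeasure := by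
  have hc : Continuous fun w : Sphere2 => Q w := hQ.comp continuous_subtype_val
  obtain ⟨C, hC⟩ := (isCompact_univ (X := Sphere2)).exists_bound_of_continuousOn hc.continuousOn
  refine (hf.norm.const_mul C).mono' (hc.aestronglyMeasurable.inner hf.1) (.of_forall fun w => ?_)
  exact (norm_inner_le_norm _ _).trans
    (mul_le_mul_of_nonneg_right (hC w trivial) (norm_nonneg _))

/-- The action of the mass and energy terms on a spherical coefficient. -/
lemma ae_sphCoef_massiveDirac {m e s : ℝ} {Q ψ G : Space3 → Spinor} (hQ : Continuous Q)
    (hβ : ∀ x, betaOp (Q x) = (s : ℂ) • Q x) (hψ : LocallyIntegrable ψ)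
    (hG : LocallyIntegrable G) : ∀ᵐ r ∂volume.restrict (Ioi (0 : ℝ)),
      sphCoef Q (massiveDirac m e ψ G) r =
        sphCoef Q G r + (e + s * m * Complex.I) * sphCoef Q ψ r := by
  filter_upwards [ae_integrable_sphere hψ, ae_integrable_sphere hG] with r h1 h2
  rw [sphCoef, sphCoef, sphCoef, ← integral_const_mul,
    ← integral_add (integrable_inner_sphere hQ h2) ((integrable_inner_sphere hQ h1).const_mul _)]
  refine integral_congr_ae (.of_forall fun w => ?_)
  have h3 : inner ℂ (Q w) (betaOp (ψ (r • (w : Space3)))) = s * inner ℂ (Q w) (ψ (r • (w : Space3))) := by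
    rw [← inner_betaOp, hβ, inner_smul_left, Complex.conj_ofReal]
  simp only [massiveDirac, ← betaOp_apply, inner_add_right, inner_smul_right, h3]
  ring

/-- Bessel's inequality for the spherical spinors. -/
lemma tsum_le_lintegral_sphere {f : Sphere2 → Spinor} (hf : AEStronglyMeasurable f surfaceMeasure) :
    ∑' a, (‖∫ w : Sphere2, inner ℂ (sphPoly a w) (f w) ∂surfaceMeasure‖ₑ ^ 2 +
        ‖∫ w : Sphere2, inner ℂ (slashMul (sphPoly a) w) (f w) ∂surfaceMeasure‖ₑ ^ 2) ≤
      ∫⁻ w, ‖f w‖ₑ ^ 2 ∂surfaceMeasure := by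
  by_cases h : MemLp f 2 surfaceMeasure
  · exact (lintegral_sphere_eq_tsum h).ge
  · have : ∫⁻ w, ‖f w‖ₑ ^ 2 ∂surfaceMeasure = ⊤ := by
      by_contra hne
      refine h ⟨hf, ?_⟩
      rw [eLpNorm_lt_top_iff_lintegral_rpow_enorm_lt_top (by simp) (by simp)]
      simpa using lt_top_iff_ne_top.2 hne
    rw [this]
    exact le_top

/-- The squared coefficients of `ψ` along a pair of spherical spinors. -/
def sphCoefSq (a : SphIndex) (ψ : Space3 → Spinor) (r : ℝ) : ℝ≥0∞ :=
  ‖sphCoef (sphPoly a) ψ r‖ₑ ^ 2 + ‖sphCoef (slashMul (sphPoly a)) ψ r‖ₑ ^ 2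

lemma continuous_sphPoly (a : SphIndex) : Continuous (sphPoly a) :=
  (contDiff_of_mem_homPoly (sphPoly_mem a).1.1).continuous

lemma continuous_slashMul_sphPoly (a : SphIndex) : Continuous (slashMul (sphPoly a)) :=
  (contDiff_of_mem_homPoly (slashMul_mem_homPoly (sphPoly_mem a).1.1)).continuous

lemma aemeasurable_sphCoefSq (a : SphIndex) {ψ : Space3 → Spinor} (hψ : AEStronglyMeasurable ψ) :
    AEMeasurable (sphCoefSq a ψ) (volume.restrict (Ioi 0)) :=
  ((aestronglyMeasurable_sphCoef (continuous_sphPoly a) hψ).enorm.pow_const 2).add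
    ((aestronglyMeasurable_sphCoef (continuous_slashMul_sphPoly a) hψ).enorm.pow_const 2)

lemma aemeasurable_weighted_sphCoefSq {W : ℝ → ℝ≥0∞} (hW : Measurable W) (a : SphIndex)
    {ψ : Space3 → Spinor} (hψ : AEStronglyMeasurable ψ) :
    AEMeasurable (fun r => ENNReal.ofReal (r ^ 2) * (W r * sphCoefSq a ψ r))
      (volume.restrict (Ioi 0)) :=
  (by fun_prop : Measurable fun r : ℝ => ENNReal.ofReal (r ^ 2)).aemeasurable.mul
    (hW.aemeasurable.mul (aemeasurable_sphCoefSq a hψ))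

lemma lintegral_radial_weight {W : ℝ → ℝ≥0∞} (hW : Measurable W) {ψ : Space3 → Spinor}
    (hψ : AEStronglyMeasurable ψ) :
    ∫⁻ x, W ‖x‖ * ‖ψ x‖ₑ ^ 2 = ∫⁻ r in Ioi 0, ENNReal.ofReal (r ^ 2) * (W r *
      ∫⁻ w : Sphere2, ‖ψ (r • (w : Space3))‖ₑ ^ 2 ∂surfaceMeasure) := by
  have hm : AEMeasurable (fun p : ℝ × Sphere2 => ‖ψ (polar p)‖ₑ ^ 2)
      (radialMeasure.prod surfaceMeasure) := (aestronglyMeasurable_polar hψ).enorm.pow_const 2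
  have hm' : AEMeasurable fun x : Space3 => W ‖x‖ * ‖ψ x‖ₑ ^ 2 :=
    (hW.comp measurable_norm).aemeasurable.mul (hψ.enorm.pow_const 2)
  rw [lintegral_polar hm', ← lintegral_radialMeasure]
  · refine lintegral_congr_ae ?_
    filter_upwards [ae_radialMeasure_pos,
      ae_radialMeasure_iff.2 (ae_aestronglyMeasurable_sphere hψ)] with r h0 h1
    rw [← lintegral_const_mul'' _ (h1.enorm.pow_const 2)]
    simp only [norm_polar h0]
  · exact (hW.aemeasurable.mul hm.lintegral_prod_right').mono_ac
      restrict_Ioi_absolutelyContinuous_radialMeasure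

/-- Parseval on almost every sphere; square integrability of `ψ` on the whole space gives it on
almost every sphere. -/
lemma lintegral_radial_weight_eq_tsum {W : ℝ → ℝ≥0∞} (hW : Measurable W) {ψ : Space3 → Spinor}
    (hψ : MemLp ψ 2) :
    ∫⁻ x, W ‖x‖ * ‖ψ x‖ₑ ^ 2 =
      ∑' a, ∫⁻ r in Ioi 0, ENNReal.ofReal (r ^ 2) * (W r * sphCoefSq a ψ r) := by
  rw [lintegral_radial_weight hW hψ.1, ← lintegral_tsum fun a => aemeasurable_weighted_sphCoefSq hW a hψ.1]
  have hfin : ∀ᵐ r ∂volume.restrict (Ioi (0 : ℝ)),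
      ∫⁻ w : Sphere2, ‖ψ (r • (w : Space3))‖ₑ ^ 2 ∂surfaceMeasure < ⊤ := by
    have h1 : ∫⁻ x, ‖ψ x‖ₑ ^ 2 < ⊤ := by
      have := (eLpNorm_lt_top_iff_lintegral_rpow_enorm_lt_top (by simp) (by simp)).1 hψ.2
      simpa using this
    rw [lintegral_polar (hψ.1.enorm.pow_const 2)] at h1
    refine ae_radialMeasure_iff.1 (ae_lt_top' ?_ h1.ne)
    exact ((aestronglyMeasurable_polar hψ.1).enorm.pow_const 2).lintegral_prod_right'
  refine lintegral_congr_ae ?_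
  filter_upwards [hfin, ae_aestronglyMeasurable_sphere hψ.1] with r h1 h2
  have h3 : MemLp (fun w : Sphere2 => ψ (r • (w : Space3))) 2 surfaceMeasure := by
    refine ⟨h2, ?_⟩
    rw [eLpNorm_lt_top_iff_lintegral_rpow_enorm_lt_top (by simp) (by simp)]
    simpa using h1
  rw [lintegral_sphere_eq_tsum h3, ENNReal.tsum_mul_left, ENNReal.tsum_mul_left]
  rfl

/-- The inequality needs measurability only, which matters because it is applied to the image under
the Dirac operator, not known to be square integrable. -/
lemma tsum_le_lintegral_radial_weight {W : ℝ → ℝ≥0∞} (hW : Measurable W) {ψ : Space3 → Spinor}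
    (hψ : AEStronglyMeasurable ψ) :
    ∑' a, ∫⁻ r in Ioi 0, ENNReal.ofReal (r ^ 2) * (W r * sphCoefSq a ψ r) ≤
      ∫⁻ x, W ‖x‖ * ‖ψ x‖ₑ ^ 2 := by
  rw [lintegral_radial_weight hW hψ, ← lintegral_tsum fun a => aemeasurable_weighted_sphCoefSq hW a hψ]
  refine lintegral_mono_ae ?_
  filter_upwards [ae_aestronglyMeasurable_sphere hψ] with r h2
  rw [ENNReal.tsum_mul_left, ENNReal.tsum_mul_left]
  gcongr
  exact tsum_le_lintegral_sphere h2

lemma IsACPrimitive.congr {u u' v v' : ℝ → ℝ} (h : IsACPrimitive u u') (hu : ∀ t, 0 < t → v t = u t)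
    (hu' : ∀ t, 0 < t → v' t = u' t) : IsACPrimitive v v' := fun x y hx hy => by
  have e : EqOn v' u' (uIcc x y) := fun t ht => hu' t (uIcc_subset_Ioi hx hy ht)
  refine ⟨(h x y hx hy).1.congr fun t ht => (e (uIoc_subset_uIcc ht)).symm, ?_⟩
  rw [hu x hx, hu y hy, (h x y hx hy).2, intervalIntegral.integral_congr e]

lemma ofReal_sq_mul_re_le {c : ℂ} (hc : ‖c‖ ≤ 1) (x : ℂ) (r : ℝ) :
    ENNReal.ofReal ((r * (c * x).re) ^ 2) ≤ ENNReal.ofReal (r ^ 2) * ‖x‖ₑ ^ 2 := by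
  rw [← ofReal_norm, ← ENNReal.ofReal_pow (norm_nonneg _), ← ENNReal.ofReal_mul (sq_nonneg _),
    mul_pow]
  refine ENNReal.ofReal_le_ofReal (mul_le_mul_of_nonneg_left ?_ (sq_nonneg _))
  rw [sq_le_sq, abs_norm]
  refine (Complex.abs_re_le_norm _).trans ?_
  rw [norm_mul]
  exact mul_le_of_le_one_left (norm_nonneg _) hc

lemma ofReal_sq_mul_re_add (x : ℂ) (r : ℝ) :
    ENNReal.ofReal ((r * (1 * x).re) ^ 2 + (r * (-Complex.I * x).re) ^ 2) =
      ENNReal.ofReal (r ^ 2) * ‖x‖ₑ ^ 2 := by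
  rw [← ofReal_norm, ← ENNReal.ofReal_pow (norm_nonneg _), ← ENNReal.ofReal_mul (sq_nonneg _),
    Complex.sq_norm, Complex.normSq_apply]
  congr 1
  simp
  ring

/-! ### From the radial inequality to the Dirac inequality -/

section modes

variable {V : ℝ → ℝ} {ψ G : Space3 → Spinor} {m e : ℝ}

lemma aestronglyMeasurable_massiveDirac (h : HasWeakDirac ψ G) :
    AEStronglyMeasurable (massiveDirac m e ψ G) := by
  have h1 : AEStronglyMeasurable fun x => betaOp (ψ x) :=
    betaOp.continuous.comp_aestronglyMeasurable h.1.aestronglyMeasurable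
  have e1 : massiveDirac m e ψ G = fun x =>
      G x + (Complex.I * (m : ℂ)) • betaOp (ψ x) + (e : ℂ) • ψ x := by
    ext1 x
    rw [massiveDirac, betaOp_apply]
  rw [e1]
  exact (h.2.1.aestronglyMeasurable.add (h1.const_smul (Complex.I * (m : ℂ)))).add
    (h.1.aestronglyMeasurable.const_smul (e : ℂ))

/-- The phase that makes the coefficients of the radial system real. -/
def massPhase (m e s : ℝ) : ℂ := (e + s * m * Complex.I) / (√(m ^ 2 + e ^ 2) : ℝ)

lemma sqrt_mul_massPhase (he : e ≠ 0) (s : ℝ) :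
    ((√(m ^ 2 + e ^ 2) : ℝ) : ℂ) * massPhase m e s = e + s * m * Complex.I := by
  have : √(m ^ 2 + e ^ 2) ≠ 0 := (Real.sqrt_pos.2 (by positivity)).ne'
  rw [massPhase, mul_div_cancel₀]
  exact_mod_cast this

/-- `β` anticommutes with `α·x`, so the partner `(α·x)P` sees the conjugate of `e + s m i`;
multiplying it by the phase of `e + s m i` gives the modulus. Hence both couplings are the same
non-negative `μ`, for either sign of `e`. -/
lemma massPhase_mul {s : ℝ} (hs : s ^ 2 = 1) (he : e ≠ 0) :
    massPhase m e s * (e + (-s : ℝ) * m * Complex.I) = (√(m ^ 2 + e ^ 2) : ℝ) := by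
  have h0 : √(m ^ 2 + e ^ 2) ≠ 0 := (Real.sqrt_pos.2 (by positivity)).ne'
  have h1 : ((√(m ^ 2 + e ^ 2) : ℝ) : ℂ) ^ 2 = m ^ 2 + e ^ 2 := by
    exact_mod_cast Real.sq_sqrt (show 0 ≤ m ^ 2 + e ^ 2 by positivity)
  have h2 : (s : ℂ) ^ 2 = 1 := by exact_mod_cast hs
  have h3 : ((√(m ^ 2 + e ^ 2) : ℝ) : ℂ) ≠ 0 := by exact_mod_cast h0
  rw [massPhase, div_mul_eq_mul_div, div_eq_iff h3, ← sq, h1]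
  push_cast
  linear_combination (m : ℂ) ^ 2 * h2 - (s : ℂ) ^ 2 * m ^ 2 * Complex.I_sq

lemma norm_massPhase {s : ℝ} (hs : s ^ 2 = 1) (he : e ≠ 0) : ‖massPhase m e s‖ = 1 := by
  have h0 : 0 < √(m ^ 2 + e ^ 2) := Real.sqrt_pos.2 (by positivity)
  have h1 : ‖(e : ℂ) + s * m * Complex.I‖ = √(m ^ 2 + e ^ 2) := by
    have : (e : ℂ) + s * m * Complex.I = e + ((s * m : ℝ) : ℂ) * Complex.I := by push_cast; rfl
    rw [this, Complex.norm_add_mul_I]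
    congr 1
    linear_combination m ^ 2 * hs
  rw [massPhase, norm_div, h1, Complex.norm_real, Real.norm_of_nonneg h0.le, div_self h0.ne']

lemma betaSign_sq (b : Bool) : betaSign b ^ 2 = 1 := by cases b <;> simp [betaSign]

lemma integrableOn_of_lintegral_ofReal_lt_top {u : ℝ → ℝ}
    (hm : AEStronglyMeasurable u (volume.restrict (Ioi 0)))
    (h0 : ∀ᵐ r ∂volume.restrict (Ioi (0 : ℝ)), 0 ≤ u r)
    (h : ∫⁻ r in Ioi 0, ENNReal.ofReal (u r) < ⊤) : IntegrableOn u (Ioi 0) :=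
  (lintegral_ofReal_ne_top_iff_integrable hm h0).1 h.ne

lemma lintegral_sphCoefSq_le (a : SphIndex) {W : ℝ → ℝ≥0∞} (hW : Measurable W)
    {φ : Space3 → Spinor} (hφ : AEStronglyMeasurable φ) :
    ∫⁻ r in Ioi 0, ENNReal.ofReal (r ^ 2) * (W r * sphCoefSq a φ r) ≤
      ∫⁻ x, W ‖x‖ * ‖φ x‖ₑ ^ 2 :=
  (ENNReal.le_tsum a).trans (tsum_le_lintegral_radial_weight hW hφ)

/-- The weighted inequality for one real component of one pair of spherical modes. -/
lemma lintegral_mode_component_le (hV : AveragesLeHalf V) (hψ : MemLp ψ 2) (h : HasWeakDirac ψ G)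
    (he : e ≠ 0) (a : SphIndex) {c : ℂ} (hc : ‖c‖ ≤ 1)
    (hY : ∫⁻ x, ENNReal.ofReal (V ‖x‖)⁻¹ * ‖massiveDirac m e ψ G x‖ₑ ^ 2 < ⊤) :
    ∫⁻ r in Ioi 0, ENNReal.ofReal (V r * ((r * (c * sphCoef (slashMul (sphPoly a)) ψ r).re) ^ 2 +
        (r * (c * (massPhase m e (betaSign a.1.2) * sphCoef (sphPoly a) ψ r)).re) ^ 2)) ≤
      ∫⁻ r in Ioi 0, ENNReal.ofReal ((V r)⁻¹ *
        ((r * (c * sphCoef (sphPoly a) (massiveDirac m e ψ G) r).re) ^ 2 +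
        (r * (c * (massPhase m e (betaSign a.1.2) *
          sphCoef (slashMul (sphPoly a)) (massiveDirac m e ψ G) r)).re) ^ 2)) := by
  set P := sphPoly a
  set l := a.1.1
  set s := betaSign a.1.2
  set ζ := massPhase m e s
  set μ := √(m ^ 2 + e ^ 2)
  set D := massiveDirac m e ψ G
  have hs : s ^ 2 = 1 := betaSign_sq _
  have hP := sphPoly_mem a
  have hPc : Continuous P := continuous_sphPoly a
  have hTc : Continuous (slashMul P) := continuous_slashMul_sphPoly a
  have hζ : ‖ζ‖ = 1 := norm_massPhase hs he
  have hD : AEStronglyMeasurable D := aestronglyMeasurable_massiveDirac h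
  obtain ⟨w₁, hw₁, he₁⟩ := h.exists_primitive_slashMul hP.1 c
  obtain ⟨w₂, hw₂, he₂⟩ := h.exists_primitive hP.1 (c * ζ)
  -- `g₁` and `f₁` are the absolutely continuous representatives of the two coefficients. `d₁` and
  -- `d₂` are defined from them so that the system holds everywhere; their relation to the Dirac
  -- image holds almost everywhere.
  set g₁ : ℝ → ℝ := fun r => (r ^ (l + 1))⁻¹ * w₁ r
  set f₁ : ℝ → ℝ := fun r => r ^ (l + 1) * w₂ r
  set d₁ : ℝ → ℝ := fun r => r * (c * sphCoef P G r).re + μ * f₁ r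
  set d₂ : ℝ → ℝ := fun r => r * (c * ζ * sphCoef (slashMul P) G r).re + μ * g₁ r
  have hg : ∀ᵐ r ∂volume.restrict (Ioi (0 : ℝ)),
      g₁ r = r * (c * sphCoef (slashMul P) ψ r).re := by
    filter_upwards [ae_restrict_of_ae he₁, ae_restrict_mem measurableSet_Ioi] with r hr h0
    have h0' : r ≠ 0 := ne_of_gt h0
    simp only [g₁]
    rw [← hr h0]
    field_simp
    ring
  have hf : ∀ᵐ r ∂volume.restrict (Ioi (0 : ℝ)), f₁ r = r * (c * (ζ * sphCoef P ψ r)).re := by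
    filter_upwards [ae_restrict_of_ae he₂, ae_restrict_mem measurableSet_Ioi] with r hr h0
    have h0' : r ≠ 0 := ne_of_gt h0
    simp only [f₁]
    rw [← hr h0, mul_assoc c]
    field_simp
    ring
  have hd₁ : ∀ᵐ r ∂volume.restrict (Ioi (0 : ℝ)), d₁ r = r * (c * sphCoef P D r).re := by
    filter_upwards [hf, ae_sphCoef_massiveDirac (m := m) (e := e) hPc hP.2 h.1 h.2.1] with r h1 h2
    simp only [d₁]
    rw [h1, h2, ← sqrt_mul_massPhase he]
    have : c * (sphCoef P G r + (μ : ℂ) * ζ * sphCoef P ψ r) =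
      c * sphCoef P G r + (μ : ℂ) * (c * (ζ * sphCoef P ψ r)) := by ring
    rw [this, Complex.add_re, Complex.re_ofReal_mul]
    ring
  have hβT : ∀ x, betaOp (slashMul P x) = ((-s : ℝ) : ℂ) • slashMul P x := fun x => by
    rw [slashMul, betaOp_slash, show betaOp (P x) = (s : ℂ) • P x from hP.2 x, map_smul,
      Complex.ofReal_neg, neg_smul]
  have hd₂ : ∀ᵐ r ∂volume.restrict (Ioi (0 : ℝ)),
      d₂ r = r * (c * (ζ * sphCoef (slashMul P) D r)).re := by
    filter_upwards [hg, ae_sphCoef_massiveDirac (m := m) (e := e) hTc hβT h.1 h.2.1] with r h1 h2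
    simp only [d₂]
    rw [h1, h2, mul_add ζ, ← mul_assoc ζ (_ + _), massPhase_mul hs he]
    have : c * (ζ * sphCoef (slashMul P) G r + (μ : ℂ) * sphCoef (slashMul P) ψ r) =
      c * ζ * sphCoef (slashMul P) G r + (μ : ℂ) * (c * sphCoef (slashMul P) ψ r) := by ring
    rw [this, Complex.add_re, Complex.re_ofReal_mul]
    ring
  have hVm := hV.measurable
  have hre : ∀ {Q φ : Space3 → Spinor} (c : ℂ), Continuous Q → AEStronglyMeasurable φ →
      AEStronglyMeasurable (fun r => r * (c * sphCoef Q φ r).re) (volume.restrict (Ioi 0)) :=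
    fun c hQ hφ => aestronglyMeasurable_id.mul
      (Complex.continuous_re.comp_aestronglyMeasurable
        ((aestronglyMeasurable_sphCoef hQ hφ).const_mul c))
  have hψfin : ∫⁻ x, 1 * ‖ψ x‖ₑ ^ 2 < ⊤ := by
    simp only [one_mul]
    have := (eLpNorm_lt_top_iff_lintegral_rpow_enorm_lt_top (by simp) (by simp)).1 hψ.2
    simpa using this
  have hcζ : ∀ x : ℂ, c * (ζ * x) = c * ζ * x := fun x => (mul_assoc _ _ _).symm
  have hcζ1 : ‖c * ζ‖ ≤ 1 := by rw [norm_mul, hζ, mul_one]; exact hc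
  have hfinψ : ∫⁻ r in Ioi 0, ENNReal.ofReal (r ^ 2) * (1 * sphCoefSq a ψ r) < ⊤ :=
    (lintegral_sphCoefSq_le a measurable_const hψ.1).trans_lt hψfin
  have hW : Measurable fun r => ENNReal.ofReal (V r)⁻¹ := hVm.inv.ennreal_ofReal
  have hfinD : ∫⁻ r in Ioi 0, ENNReal.ofReal (r ^ 2) * (ENNReal.ofReal (V r)⁻¹ * sphCoefSq a D r) < ⊤ :=
    (lintegral_sphCoefSq_le a hW hD).trans_lt hY
  have hpair : RadialPair V (l + 1) μ g₁ f₁ d₁ d₂ := by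
    refine ⟨by omega, Real.sqrt_nonneg _, ?_, ?_, ?_, ?_, ?_⟩
    · refine hw₁.congr (fun t ht => ?_) fun t ht => ?_
      · simp only [g₁]
        rw [mul_inv_cancel_left₀ (pow_pos ht _).ne']
      · simp only [d₁]
        ring
    · refine hw₂.congr (fun t ht => ?_) fun t ht => ?_
      · simp only [f₁]
        rw [inv_mul_cancel_left₀ (pow_pos ht _).ne']
      · simp only [d₂]
        field_simp
        ring
    · have e1 : (fun r => (r * (c * sphCoef (slashMul P) ψ r).re) ^ 2)
          =ᵐ[volume.restrict (Ioi 0)] fun r => g₁ r ^ 2 := hg.mono fun r hr => by simp only [hr]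
      refine IntegrableOn.congr_fun_ae ?_ e1
      refine integrableOn_of_lintegral_ofReal_lt_top ((hre c hTc hψ.1).pow 2)
        (.of_forall fun r => sq_nonneg _) ((lintegral_mono fun r => ?_).trans_lt hfinψ)
      refine (ofReal_sq_mul_re_le hc _ r).trans ?_
      rw [one_mul, sphCoefSq]
      gcongr
      exact le_add_self
    · have e1 : (fun r => (r * (c * ζ * sphCoef P ψ r).re) ^ 2)
          =ᵐ[volume.restrict (Ioi 0)] fun r => f₁ r ^ 2 :=
        hf.mono fun r hr => by simp only [hr, hcζ]
      refine IntegrableOn.congr_fun_ae ?_ e1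
      refine integrableOn_of_lintegral_ofReal_lt_top ((hre (c * ζ) hPc hψ.1).pow 2)
        (.of_forall fun r => sq_nonneg _) ((lintegral_mono fun r => ?_).trans_lt hfinψ)
      refine (ofReal_sq_mul_re_le hcζ1 _ r).trans ?_
      rw [one_mul, sphCoefSq]
      gcongr
      exact le_self_add
    · have e1 : (fun r => (V r)⁻¹ * ((r * (c * sphCoef P D r).re) ^ 2 +
          (r * (c * ζ * sphCoef (slashMul P) D r).re) ^ 2)) =ᵐ[volume.restrict (Ioi 0)]
          fun r => (V r)⁻¹ * (d₁ r ^ 2 + d₂ r ^ 2) := by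
        filter_upwards [hd₁, hd₂] with r h1 h2
        rw [h1, h2, hcζ]
      refine IntegrableOn.congr_fun_ae ?_ e1
      refine integrableOn_of_lintegral_ofReal_lt_top (hVm.inv.aestronglyMeasurable.mul
        (((hre c hPc hD).pow 2).add ((hre (c * ζ) hTc hD).pow 2))) ?_ (lt_of_le_of_lt ?_ hfinD)
      · filter_upwards [ae_restrict_mem measurableSet_Ioi] with r hr
        have := hV.pos r hr
        positivity
      · refine setLIntegral_mono_ae' measurableSet_Ioi (.of_forall fun r hr => ?_)
        rw [ENNReal.ofReal_mul (inv_nonneg.2 (hV.pos r hr).le),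
          ENNReal.ofReal_add (sq_nonneg _) (sq_nonneg _), mul_left_comm, sphCoefSq,
          mul_add (ENNReal.ofReal (r ^ 2))]
        gcongr
        · exact ofReal_sq_mul_re_le hc _ r
        · exact ofReal_sq_mul_re_le hcζ1 _ r
  have hmain := hpair.lintegral_weighted_sq_le hV
  calc _ = ∫⁻ t in Ioi 0, ENNReal.ofReal (V t * (g₁ t ^ 2 + f₁ t ^ 2)) := by
        refine lintegral_congr_ae ?_
        filter_upwards [hg, hf] with r h1 h2
        rw [h1, h2]
    _ ≤ _ := hmain
    _ = _ := by
        refine lintegral_congr_ae ?_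
        filter_upwards [hd₁, hd₂] with r h1 h2
        rw [h1, h2]

/-- The weighted inequality for one pair of spherical modes. -/
lemma lintegral_mode_le (hV : AveragesLeHalf V) (hψ : MemLp ψ 2) (h : HasWeakDirac ψ G)
    (he : e ≠ 0) (a : SphIndex)
    (hY : ∫⁻ x, ENNReal.ofReal (V ‖x‖)⁻¹ * ‖massiveDirac m e ψ G x‖ₑ ^ 2 < ⊤) :
    ∫⁻ r in Ioi 0, ENNReal.ofReal (r ^ 2) * (ENNReal.ofReal (V r) * sphCoefSq a ψ r) ≤
      ∫⁻ r in Ioi 0, ENNReal.ofReal (r ^ 2) *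
        (ENNReal.ofReal (V r)⁻¹ * sphCoefSq a (massiveDirac m e ψ G) r) := by
  set ζ := massPhase m e (betaSign a.1.2)
  have hζ : ‖ζ‖ₑ = 1 := by
    rw [← ofReal_norm, norm_massPhase (betaSign_sq _) he, ENNReal.ofReal_one]
  have hD : AEStronglyMeasurable (massiveDirac m e ψ G) := aestronglyMeasurable_massiveDirac h
  have key : ∀ {W : ℝ → ℝ} (x y : ℝ → ℂ), Measurable W → (∀ r, 0 < r → 0 ≤ W r) →
      AEStronglyMeasurable x (volume.restrict (Ioi 0)) →
      AEStronglyMeasurable y (volume.restrict (Ioi 0)) →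
      (∫⁻ r in Ioi 0, ENNReal.ofReal (W r * ((r * (1 * x r).re) ^ 2 + (r * (1 * (ζ * y r)).re) ^ 2))) +
      ∫⁻ r in Ioi 0, ENNReal.ofReal (W r * ((r * (-Complex.I * x r).re) ^ 2 +
        (r * (-Complex.I * (ζ * y r)).re) ^ 2)) =
      ∫⁻ r in Ioi 0, ENNReal.ofReal (r ^ 2) * (ENNReal.ofReal (W r) * (‖x r‖ₑ ^ 2 + ‖y r‖ₑ ^ 2)) := by
    intro W x y hWm hW hx hy
    have hre : ∀ {x : ℝ → ℂ} (c : ℂ), AEStronglyMeasurable x (volume.restrict (Ioi 0)) →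
        AEStronglyMeasurable (fun r => (r * (c * x r).re) ^ 2) (volume.restrict (Ioi 0)) :=
      fun c hx => (aestronglyMeasurable_id.mul
        (Complex.continuous_re.comp_aestronglyMeasurable (hx.const_mul c))).pow 2
    have hm : AEMeasurable (fun r => ENNReal.ofReal (W r * ((r * (1 * x r).re) ^ 2 +
        (r * (1 * (ζ * y r)).re) ^ 2))) (volume.restrict (Ioi 0)) :=
      (hWm.aestronglyMeasurable.mul
        ((hre 1 hx).add (hre 1 (hy.const_mul ζ)))).aemeasurable.ennreal_ofReal
    rw [← lintegral_add_left' hm]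
    refine setLIntegral_congr_fun measurableSet_Ioi fun r hr => ?_
    have hr0 := hW r hr
    have h1 := ofReal_sq_mul_re_add (x r) r
    have h2 := ofReal_sq_mul_re_add (ζ * y r) r
    rw [enorm_mul ζ, hζ, one_mul ‖y r‖ₑ] at h2
    rw [← ENNReal.ofReal_add (by positivity) (by positivity), ← mul_add, ENNReal.ofReal_mul hr0,
      mul_left_comm (ENNReal.ofReal (r ^ 2)), mul_add (ENNReal.ofReal (r ^ 2)), ← h1, ← h2,
      ← ENNReal.ofReal_add (by positivity) (by positivity)]
    congr 2
    ring
  have hPc := continuous_sphPoly a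
  have hTc := continuous_slashMul_sphPoly a
  -- `c = 1` and `c = -i` select real and imaginary parts, whose squares add up to the modulus
  -- squared.
  have h1 := lintegral_mode_component_le (c := 1) hV hψ h he a (by simp) hY
  have h2 := lintegral_mode_component_le (c := -Complex.I) hV hψ h he a (by simp) hY
  have h3 := add_le_add h1 h2
  rw [key _ _ hV.measurable (fun r hr => (hV.pos r hr).le)
      (aestronglyMeasurable_sphCoef hTc hψ.1) (aestronglyMeasurable_sphCoef hPc hψ.1),
    key (W := fun r => (V r)⁻¹) _ _ hV.measurable.inv (fun r hr => inv_nonneg.2 (hV.pos r hr).le)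
      (aestronglyMeasurable_sphCoef hPc hD) (aestronglyMeasurable_sphCoef hTc hD)] at h3
  simpa only [sphCoefSq, add_comm] using h3

/-- The weighted inequality for the Dirac operator. -/
theorem lintegral_weight_le_lintegral_dirac (hV : AveragesLeHalf V) (hψ : MemLp ψ 2)
    (h : HasWeakDirac ψ G) (he : e ≠ 0) :
    ∫⁻ x, ENNReal.ofReal (V ‖x‖) * ‖ψ x‖ₑ ^ 2 ≤
      ∫⁻ x, ENNReal.ofReal (V ‖x‖)⁻¹ * ‖massiveDirac m e ψ G x‖ₑ ^ 2 := by
  rcases eq_or_ne (∫⁻ x, ENNReal.ofReal (V ‖x‖)⁻¹ * ‖massiveDirac m e ψ G x‖ₑ ^ 2) ⊤ with hY | hY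
  · rw [hY]; exact le_top
  rw [lintegral_radial_weight_eq_tsum hV.measurable.ennreal_ofReal hψ]
  refine (ENNReal.tsum_le_tsum fun a => lintegral_mode_le hV hψ h he a (lt_top_iff_ne_top.2 hY)).trans ?_
  exact tsum_le_lintegral_radial_weight (W := fun r => ENNReal.ofReal (V r)⁻¹)
    hV.measurable.inv.ennreal_ofReal (aestronglyMeasurable_massiveDirac h)

end modes

/-! ### The Coulomb case -/

lemma averagesLeHalf_inv : AveragesLeHalf fun t => 1 / t := by
  refine AveragesLeHalf.of_radialSupNorm (by fun_prop) (fun r hr => by positivity) ?_ ?_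
  · refine essSup_le_of_ae_le _ ?_
    filter_upwards [ae_restrict_mem measurableSet_Ioi] with r hr using (hPlus_hMinus_inv hr).1.le
  · refine essSup_le_of_ae_le _ ?_
    filter_upwards [ae_restrict_mem measurableSet_Ioi] with r hr using (hPlus_hMinus_inv hr).2.le

lemma massiveDirac'_eq (m e : ℝ) (ψ G : Space3 → Spinor) (x : Space3) :
    massiveDirac' m e ψ G x = Complex.I • massiveDirac m e ψ G x := by
  rw [massiveDirac', massiveDirac, smul_add, smul_add, smul_smul, smul_smul, ← mul_assoc,
    Complex.I_mul_I, neg_one_mul, neg_smul, ← sub_eq_add_neg, mul_comm (e : ℂ)]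

lemma enorm_massiveDirac' (m e : ℝ) (ψ G : Space3 → Spinor) (x : Space3) :
    ‖massiveDirac' m e ψ G x‖ₑ = ‖massiveDirac m e ψ G x‖ₑ := by
  rw [massiveDirac'_eq, enorm_smul, ← ofReal_norm Complex.I, Complex.norm_I, ENNReal.ofReal_one,
    one_mul]

lemma norm_betaOp (v : Spinor) : ‖betaOp v‖ = ‖v‖ := by
  have h1 : (inner ℂ (betaOp v) (betaOp v) : ℂ) = inner ℂ v v := by
    rw [inner_betaOp, betaOp_betaOp]
  rw [inner_self_eq_norm_sq_to_K, inner_self_eq_norm_sq_to_K] at h1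
  have h2 : ‖betaOp v‖ ^ 2 = ‖v‖ ^ 2 := by exact_mod_cast h1
  exact (sq_eq_sq₀ (norm_nonneg _) (norm_nonneg _)).1 h2

lemma norm_massiveDirac_le {m : ℝ} (hm : 0 ≤ m) (e : ℝ) (ψ G : Space3 → Spinor) (x : Space3) :
    ‖massiveDirac m e ψ G x‖ ≤ ‖G x‖ + (m + |e|) * ‖ψ x‖ := by
  rw [massiveDirac, ← betaOp_apply]
  refine (norm_add₃_le).trans (le_of_eq ?_)
  rw [norm_smul, norm_smul, norm_betaOp, norm_mul, Complex.norm_I, Complex.norm_real,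
    Complex.norm_real, Real.norm_of_nonneg hm, Real.norm_eq_abs]
  ring

/-! ### Sharpness of the constant -/

lemma lintegral_norm_eq {F : ℝ → ℝ≥0∞} (hF : Measurable F) :
    ∫⁻ x : Space3, F ‖x‖ =
      (∫⁻ r in Ioi 0, ENNReal.ofReal (r ^ 2) * F r) * surfaceMeasure univ := by
  have hm : AEMeasurable fun x : Space3 => F ‖x‖ := (hF.comp measurable_norm).aemeasurable
  rw [lintegral_polar hm,
    ← lintegral_radialMeasure hF.aemeasurable, ← lintegral_mul_const _ hF]
  refine lintegral_congr_ae ?_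
  filter_upwards [ae_radialMeasure_pos] with r hr
  simp only [norm_polar hr, lintegral_const]

/-- The logarithmic substitution on the half-line. -/
lemma lintegral_Ioi_eq_exp {L : ℝ} (hL : 0 < L) (f : ℝ → ℝ≥0∞) :
    ∫⁻ r in Ioi 0, f r = ∫⁻ s, ENNReal.ofReal (L * Real.exp (L * s)) * f (Real.exp (L * s)) := by
  have h1 : (fun s => Real.exp (L * s)) '' univ = Ioi 0 := by
    rw [image_univ]
    ext r
    refine ⟨fun ⟨s, hs⟩ => hs ▸ Real.exp_pos _, fun hr => ⟨Real.log r / L, ?_⟩⟩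
    simp only
    rw [mul_div_cancel₀ _ hL.ne', Real.exp_log hr]
  have hd : ∀ s ∈ univ, HasDerivWithinAt (fun s => Real.exp (L * s)) (L * Real.exp (L * s)) univ s :=
    fun s _ => by
      have := ((hasDerivAt_id s).const_mul L).exp
      rw [hasDerivWithinAt_univ]
      simpa [mul_comm] using this
  have hinj : InjOn (fun s => Real.exp (L * s)) univ := fun s _ t _ h =>
    mul_left_cancel₀ hL.ne' (Real.exp_injective h)
  rw [← h1, lintegral_image_eq_lintegral_abs_deriv_mul MeasurableSet.univ hd hinj,
    Measure.restrict_univ]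
  refine lintegral_congr fun s => ?_
  rw [abs_of_pos (by positivity)]

/-- The logarithmically dilated trial function `g (log r / L) / r`. -/
def logTrial (g : ℝ → ℝ) (L : ℝ) : ℝ → ℝ := (Ioi 0).indicator fun r => g (Real.log r / L) / r

lemma logTrial_exp (g : ℝ → ℝ) {L : ℝ} (hL : 0 < L) (s : ℝ) :
    logTrial g L (Real.exp (L * s)) = g s / Real.exp (L * s) := by
  rw [logTrial, indicator_of_mem (mem_Ioi.2 (Real.exp_pos _)), Real.log_exp, mul_div_cancel_left₀ _ hL.ne']

lemma deriv_logTrial_exp {g : ℝ → ℝ} (hg : Differentiable ℝ g) {L : ℝ} (hL : 0 < L) (s : ℝ) :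
    deriv (logTrial g L) (Real.exp (L * s)) = (deriv g s / L - g s) / Real.exp (L * s) ^ 2 := by
  have h0 := Real.exp_pos (L * s)
  have h1 : logTrial g L =ᶠ[nhds (Real.exp (L * s))] fun r => g (Real.log r / L) / r := by
    filter_upwards [Ioi_mem_nhds h0] with r hr
    rw [logTrial, indicator_of_mem hr]
  have hlog : Real.log (Real.exp (L * s)) / L = s := by
    rw [Real.log_exp, mul_div_cancel_left₀ _ hL.ne']
  have h2 : HasDerivAt (fun r => g (Real.log r / L))
      (deriv g s * ((Real.exp (L * s))⁻¹ / L)) (Real.exp (L * s)) := by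
    have h3 := (Real.hasDerivAt_log h0.ne').div_const L
    refine HasDerivAt.comp (Real.exp (L * s)) ?_ h3
    rw [hlog]
    exact (hg s).hasDerivAt
  rw [h1.deriv_eq, (h2.fun_div (hasDerivAt_id' _) h0.ne').deriv, hlog]
  field_simp

lemma isHalfLineTest_logTrial {g : ℝ → ℝ} (hg : ContDiff ℝ ∞ g)
    (hz : ∀ s, s ∉ Icc (-2 : ℝ) (-1) → g s = 0) {L : ℝ} (hL : 0 < L) :
    IsHalfLineTest (logTrial g L) := by
  have hzero : ∀ r, r ∉ Icc (Real.exp (L * -2)) (Real.exp (L * -1)) → logTrial g L r = 0 := by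
    intro r hr
    by_cases h0 : 0 < r
    · obtain ⟨s, rfl⟩ : ∃ s, r = Real.exp (L * s) :=
        ⟨Real.log r / L, by rw [mul_div_cancel₀ _ hL.ne', Real.exp_log h0]⟩
      rw [logTrial_exp g hL, hz s fun hs => hr ?_, zero_div]
      exact ⟨Real.exp_le_exp.2 (mul_le_mul_of_nonneg_left hs.1 hL.le),
        Real.exp_le_exp.2 (mul_le_mul_of_nonneg_left hs.2 hL.le)⟩
    · exact indicator_of_notMem h0 _
  refine ⟨contDiff_iff_contDiffAt.2 fun r => ?_, _, _, Real.exp_pos _,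
    Real.exp_lt_exp.2 (by linarith), hzero⟩
  by_cases h0 : 0 < r
  · have h1 : logTrial g L =ᶠ[nhds r] fun r => g (Real.log r / L) / r := by
      filter_upwards [Ioi_mem_nhds h0] with r hr
      rw [logTrial, indicator_of_mem hr]
    refine ContDiffAt.congr_of_eventuallyEq ?_ h1
    exact (hg.contDiffAt.comp r ((Real.contDiffAt_log.2 h0.ne').div_const L)).div contDiffAt_id h0.ne'
  · refine contDiffAt_const (c := (0 : ℝ)) |>.congr_of_eventuallyEq ?_
    filter_upwards [Iio_mem_nhds ((not_lt.1 h0).trans_lt (Real.exp_pos (L * -2)))] with t ht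
    exact hzero t fun h => (not_lt.2 h.1) ht

/-- The Hardy-Dirac inequality with constant `C`, tested on a radial field. -/
lemma halfLine_of_hardyDirac {m e : ℝ} (hm : 0 ≤ m) {C : ℝ≥0}
    (hC : ∀ ψ G : Space3 → Spinor, MemLp ψ 2 volume → HasWeakDirac ψ G →
        ∫⁻ x, ENNReal.ofReal (1 / ‖x‖) * ‖ψ x‖ₑ ^ 2 ≤
          (C : ℝ≥0∞) * ∫⁻ x, ENNReal.ofReal ‖x‖ * ‖massiveDirac' m e ψ G x‖ₑ ^ 2)
    {χ : ℝ → ℝ} (hχ : IsHalfLineTest χ) :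
    ∫⁻ r in Ioi 0, ENNReal.ofReal (r * χ r ^ 2) ≤
      C * ∫⁻ r in Ioi 0, ENNReal.ofReal (r ^ 3 * (|deriv χ r| + (m + |e|) * |χ r|) ^ 2) := by
  set v : Spinor := EuclideanSpace.single (Sum.inl 0) 1
  have hv : ‖v‖ = 1 := by simp [v]
  set ψ : Space3 → Spinor := fun x => χ ‖x‖ • v
  have hψc : ContDiff ℝ ∞ ψ := hχ.contDiff_comp_norm.smul contDiff_const
  have hψs : HasCompactSupport ψ := hχ.hasCompactSupport_comp_norm.smul_right
  have h1 := hC ψ (diracOp ψ) (hψc.continuous.memLp_of_hasCompactSupport hψs)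
    (hasWeakDirac_diracOp hψc)
  have hχm : Measurable χ := hχ.contDiff.continuous.measurable
  have hχm' : Measurable (deriv χ) := hχ.deriv.contDiff.continuous.measurable
  -- A constant spinor is monogenic of degree `0`, so only the derivative of `χ` remains.
  have hG : ∀ x, ‖diracOp ψ x‖ ≤ |deriv χ ‖x‖| := fun x => by
    have hd : diracOp (fun _ : Space3 => v) x = 0 := by
      exact congrFun (diracOp_const ⟨v, rfl⟩) x
    rw [hχ.diracOp_smul (F := fun _ => v) (differentiable_const v), hd, smul_zero, add_zero,
      norm_smul, slashMul, norm_slash, hv, mul_one, norm_div, Real.norm_eq_abs, norm_norm]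
    rcases eq_or_ne ‖x‖ 0 with h0 | h0
    · simp [h0]
    · rw [div_mul_cancel₀ _ h0]
  have hψn : ∀ x, ‖ψ x‖ = |χ ‖x‖| := fun x => by rw [norm_smul, hv, mul_one, Real.norm_eq_abs]
  have e1 : ∫⁻ x, ENNReal.ofReal (1 / ‖x‖) * ‖ψ x‖ₑ ^ 2 =
      (∫⁻ r in Ioi 0, ENNReal.ofReal (r * χ r ^ 2)) * surfaceMeasure univ := by
    have : ∀ x, ENNReal.ofReal (1 / ‖x‖) * ‖ψ x‖ₑ ^ 2 =
        (fun r => ENNReal.ofReal (1 / r * χ r ^ 2)) ‖x‖ := fun x => by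
      simp only
      rw [← ofReal_norm, hψn, ← ENNReal.ofReal_pow (abs_nonneg _), sq_abs,
        ← ENNReal.ofReal_mul (by positivity)]
    simp only [this]
    rw [lintegral_norm_eq (F := fun r => ENNReal.ofReal (1 / r * χ r ^ 2)) (by fun_prop)]
    congr 1
    refine setLIntegral_congr_fun measurableSet_Ioi fun r hr => ?_
    have hr' : r ≠ 0 := ne_of_gt hr
    rw [← ENNReal.ofReal_mul (sq_nonneg _)]
    congr 1
    field_simp
  have e2 : ∫⁻ x, ENNReal.ofReal ‖x‖ * ‖massiveDirac' m e ψ (diracOp ψ) x‖ₑ ^ 2 ≤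
      (∫⁻ r in Ioi 0, ENNReal.ofReal (r ^ 3 * (|deriv χ r| + (m + |e|) * |χ r|) ^ 2)) *
        surfaceMeasure univ := by
    have : ∀ x, ENNReal.ofReal ‖x‖ * ‖massiveDirac' m e ψ (diracOp ψ) x‖ₑ ^ 2 ≤
        (fun r => ENNReal.ofReal (r * (|deriv χ r| + (m + |e|) * |χ r|) ^ 2)) ‖x‖ := fun x => by
      simp only
      rw [enorm_massiveDirac', ← ofReal_norm, ← ENNReal.ofReal_pow (norm_nonneg _),
        ← ENNReal.ofReal_mul (norm_nonneg _)]
      refine ENNReal.ofReal_le_ofReal (mul_le_mul_of_nonneg_left ?_ (norm_nonneg _))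
      refine pow_le_pow_left₀ (norm_nonneg _) ((norm_massiveDirac_le hm e _ _ _).trans ?_) 2
      rw [hψn]
      exact add_le_add_left (hG x) _
    refine (lintegral_mono this).trans (le_of_eq ?_)
    rw [lintegral_norm_eq
      (F := fun r => ENNReal.ofReal (r * (|deriv χ r| + (m + |e|) * |χ r|) ^ 2)) (by fun_prop)]
    congr 1
    refine setLIntegral_congr_fun measurableSet_Ioi fun r hr => ?_
    rw [← ENNReal.ofReal_mul (sq_nonneg _)]
    congr 1
    ring
  have hS0 : surfaceMeasure univ ≠ 0 := by
    rw [Measure.measure_univ_ne_zero]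
    exact Measure.toSphere_ne_zero _
  have h2 := h1.trans (mul_le_mul_right e2 (C : ℝ≥0∞))
  rw [e1, ← mul_assoc] at h2
  exact (ENNReal.mul_le_mul_iff_left hS0 (measure_ne_top _ _)).1 h2

/-- Young's inequality weighted so that, as `L → ∞`, the coefficient of `y²` tends to `1` and that
of `x²` to `0`. -/
lemma sq_div_add_le {L : ℝ} (hL : 0 < L) (x y : ℝ) :
    (x / L + y) ^ 2 ≤ (1 + 1 / L) * y ^ 2 + (1 + L) / L ^ 2 * x ^ 2 := by
  have : (1 + 1 / L) * y ^ 2 + (1 + L) / L ^ 2 * x ^ 2 - (x / L + y) ^ 2 = (x - y) ^ 2 / L := by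
    field_simp
    ring
  have h6 : 0 ≤ (x - y) ^ 2 / L := by positivity
  linarith

/-- At `r = exp(Ls)` the left side is `L (|g'/L - g| + κ r|g|)²`. On the support of `g`, `s ≤ -1`,
so `r ≤ exp(-L)`: this is why the trial function is concentrated near the origin. -/
lemma logTrial_energy_le {g : ℝ → ℝ} (hg : Differentiable ℝ g)
    (hz : ∀ s, s ∉ Icc (-2 : ℝ) (-1) → g s = 0) {κ : ℝ} (hκ : 0 ≤ κ) {L : ℝ} (hL : 0 < L) (s : ℝ) :
    L * Real.exp (L * s) * (Real.exp (L * s) ^ 3 *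
        (|deriv (logTrial g L) (Real.exp (L * s))| + κ * |logTrial g L (Real.exp (L * s))|) ^ 2) ≤
      L * ((1 + 1 / L) * (1 + κ * Real.exp (-L)) ^ 2 * g s ^ 2 +
        (1 + L) / L ^ 2 * deriv g s ^ 2) := by
  have h0 := Real.exp_pos (L * s)
  have h2 : Real.exp (L * s) * |g s| ≤ Real.exp (-L) * |g s| := by
    by_cases hs : s ∈ Icc (-2 : ℝ) (-1)
    · refine mul_le_mul_of_nonneg_right (Real.exp_le_exp.2 ?_) (abs_nonneg _)
      nlinarith [hs.2]
    · rw [hz s hs]; simp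
  rw [logTrial_exp g hL, deriv_logTrial_exp hg hL, abs_div, abs_div, abs_of_pos h0,
    abs_of_pos (pow_pos h0 2)]
  generalize Real.exp (L * s) = t at h0 h2 ⊢
  have e3 : L * t * (t ^ 3 * (|deriv g s / L - g s| / t ^ 2 + κ * (|g s| / t)) ^ 2) =
      L * (|deriv g s / L - g s| + κ * t * |g s|) ^ 2 := by
    field_simp
  rw [e3]
  refine mul_le_mul_of_nonneg_left ?_ hL.le
  have h3 : |deriv g s / L - g s| ≤ |deriv g s| / L + |g s| := by
    refine (abs_sub _ _).trans ?_
    rw [abs_div, abs_of_pos hL]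
  have h4 : |deriv g s / L - g s| + κ * t * |g s| ≤
      |deriv g s| / L + (1 + κ * Real.exp (-L)) * |g s| := by
    linarith [mul_le_mul_of_nonneg_left h2 hκ]
  refine (pow_le_pow_left₀ (by positivity) h4 2).trans ?_
  refine (sq_div_add_le hL _ _).trans (le_of_eq ?_)
  rw [mul_pow, sq_abs, sq_abs, mul_assoc]

/-- The Hardy-Dirac inequality with constant `C`, tested on a logarithmically dilated field. -/
lemma integral_sq_le_of_hardyDirac {m e : ℝ} (hm : 0 ≤ m) {C : ℝ≥0}
    (hC : ∀ ψ G : Space3 → Spinor, MemLp ψ 2 volume → HasWeakDirac ψ G →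
        ∫⁻ x, ENNReal.ofReal (1 / ‖x‖) * ‖ψ x‖ₑ ^ 2 ≤
          (C : ℝ≥0∞) * ∫⁻ x, ENNReal.ofReal ‖x‖ * ‖massiveDirac' m e ψ G x‖ₑ ^ 2)
    {g : ℝ → ℝ} (hg : ContDiff ℝ ∞ g) (hz : ∀ s, s ∉ Icc (-2 : ℝ) (-1) → g s = 0)
    (hi : Integrable fun s => g s ^ 2) (hi' : Integrable fun s => deriv g s ^ 2)
    {L : ℝ} (hL : 0 < L) :
    ∫ s, g s ^ 2 ≤ C * ((1 + 1 / L) * (1 + (m + |e|) * Real.exp (-L)) ^ 2 * (∫ s, g s ^ 2) +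
      (1 + L) / L ^ 2 * ∫ s, deriv g s ^ 2) := by
  have hκ : 0 ≤ m + |e| := by positivity
  have h1 := halfLine_of_hardyDirac hm hC (isHalfLineTest_logTrial hg hz hL)
  rw [lintegral_Ioi_eq_exp hL, lintegral_Ioi_eq_exp hL] at h1
  have e1 : ∀ s, ENNReal.ofReal (L * Real.exp (L * s)) * ENNReal.ofReal (Real.exp (L * s) *
      logTrial g L (Real.exp (L * s)) ^ 2) = ENNReal.ofReal (L * g s ^ 2) := fun s => by
    have := (Real.exp_pos (L * s)).ne'
    rw [← ENNReal.ofReal_mul (by positivity), logTrial_exp g hL]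
    congr 1
    field_simp
  have e2 : ∀ s, ENNReal.ofReal (L * Real.exp (L * s)) * ENNReal.ofReal (Real.exp (L * s) ^ 3 *
      (|deriv (logTrial g L) (Real.exp (L * s))| +
        (m + |e|) * |logTrial g L (Real.exp (L * s))|) ^ 2) ≤
      ENNReal.ofReal (L * ((1 + 1 / L) * (1 + (m + |e|) * Real.exp (-L)) ^ 2 * g s ^ 2 +
        (1 + L) / L ^ 2 * deriv g s ^ 2)) := fun s => by
    rw [← ENNReal.ofReal_mul (by positivity)]
    exact ENNReal.ofReal_le_ofReal (logTrial_energy_le (hg.differentiable (by simp)) hz hκ hL s)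
  simp only [e1] at h1
  have h2 := h1.trans (mul_le_mul_right (lintegral_mono e2) (C : ℝ≥0∞))
  have ha₁ : 0 ≤ (1 + 1 / L) * (1 + (m + |e|) * Real.exp (-L)) ^ 2 := by positivity
  have ha₂ : 0 ≤ (1 + L) / L ^ 2 := by positivity
  generalize (1 + 1 / L) * (1 + (m + |e|) * Real.exp (-L)) ^ 2 = a₁ at h2 ha₁ ⊢
  generalize (1 + L) / L ^ 2 = a₂ at h2 ha₂ ⊢
  have hint : Integrable fun s => L * (a₁ * g s ^ 2 + a₂ * deriv g s ^ 2) :=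
    ((hi.const_mul a₁).add (hi'.const_mul a₂)).const_mul L
  have hsum : ∫ s, L * (a₁ * g s ^ 2 + a₂ * deriv g s ^ 2) =
      L * (a₁ * (∫ s, g s ^ 2) + a₂ * ∫ s, deriv g s ^ 2) := by
    rw [integral_const_mul, integral_add (hi.const_mul a₁) (hi'.const_mul a₂), integral_const_mul,
      integral_const_mul]
  have hA : 0 ≤ ∫ s, g s ^ 2 := integral_nonneg fun s => sq_nonneg _
  have hB : 0 ≤ ∫ s, deriv g s ^ 2 := integral_nonneg fun s => sq_nonneg _
  rw [← ofReal_integral_eq_lintegral_ofReal (hi.const_mul L) (.of_forall fun s => by positivity),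
    ← ofReal_integral_eq_lintegral_ofReal hint (.of_forall fun s => by positivity),
    ← ENNReal.ofReal_coe_nnreal, ← ENNReal.ofReal_mul C.coe_nonneg, integral_const_mul] at h2
  rw [hsum, ENNReal.ofReal_le_ofReal_iff (by positivity), mul_left_comm] at h2
  exact le_of_mul_le_mul_left h2 hL

/-- Let `L → ∞`: the inequality becomes `A ≤ C A`, and `A > 0`. -/
lemma one_le_of_forall_le {A B κ C : ℝ} (hA : 0 < A) (key : ∀ L : ℝ, 0 < L →
    A ≤ C * ((1 + 1 / L) * (1 + κ * Real.exp (-L)) ^ 2 * A + (1 + L) / L ^ 2 * B)) : 1 ≤ C := by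
  have t1 : Filter.Tendsto (fun L : ℝ => 1 / L) Filter.atTop (nhds 0) := by
    simpa using tendsto_inv_atTop_zero (𝕜 := ℝ)
  have t2 : Filter.Tendsto (fun L : ℝ => Real.exp (-L)) Filter.atTop (nhds 0) :=
    Real.tendsto_exp_neg_atTop_nhds_zero
  have t3 : Filter.Tendsto (fun L : ℝ => (1 + L) / L ^ 2) Filter.atTop (nhds 0) := by
    have : Filter.Tendsto (fun L : ℝ => 1 / L * (1 / L) + 1 / L) Filter.atTop (nhds (0 * 0 + 0)) :=
      (t1.mul t1).add t1
    rw [mul_zero, add_zero] at this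
    refine this.congr' ?_
    filter_upwards [Filter.eventually_gt_atTop 0] with L hL
    field_simp
  have t4 := ((((t1.const_add 1).mul (((t2.const_mul κ).const_add 1).pow 2)).mul_const A).add
    (t3.mul_const B)).const_mul C
  have h := ge_of_tendsto t4 (by
    filter_upwards [Filter.eventually_gt_atTop 0] with L hL using key L hL)
  simp only [add_zero, mul_zero, one_pow, mul_one, one_mul, zero_mul] at h
  by_contra hlt
  nlinarith

/-- The constant in the Hardy-Dirac inequality cannot be less than one. -/
theorem one_le_of_hardyDirac {m e : ℝ} (hm : 0 ≤ m) {C : ℝ≥0}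
    (hC : ∀ ψ G : Space3 → Spinor, MemLp ψ 2 volume → HasWeakDirac ψ G →
        ∫⁻ x, ENNReal.ofReal (1 / ‖x‖) * ‖ψ x‖ₑ ^ 2 ≤
          (C : ℝ≥0∞) * ∫⁻ x, ENNReal.ofReal ‖x‖ * ‖massiveDirac' m e ψ G x‖ₑ ^ 2) : 1 ≤ C := by
  -- Centre `-3/2` and outer radius `1/2` put the support in `[-2, -1]`, to the left of `-1` as the
  -- energy bound requires.
  let b : ContDiffBump (-3 / 2 : ℝ) := ⟨1 / 4, 1 / 2, by norm_num, by norm_num⟩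
  obtain ⟨g, hgb⟩ : ∃ g : ℝ → ℝ, g = fun s => b s := ⟨_, rfl⟩
  have hg : ContDiff ℝ ∞ g := hgb ▸ b.contDiff
  have hgs : HasCompactSupport g := hgb ▸ b.hasCompactSupport
  have hg1 : g (-3 / 2) ≠ 0 := by
    rw [hgb]
    exact b.eventuallyEq_one.eq_of_nhds.trans_ne one_ne_zero
  have hz : ∀ s, s ∉ Icc (-2 : ℝ) (-1) → g s = 0 := fun s hs => by
    rw [hgb]
    by_contra h
    have h1 : s ∈ Function.support b := h
    rw [b.support_eq, Metric.mem_ball, Real.dist_eq] at h1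
    have h2 : |s - -3 / 2| < 1 / 2 := h1
    have h3 := abs_lt.1 h2
    exact hs ⟨by linarith [h3.1], by linarith [h3.2]⟩
  have hsq : ∀ {f : ℝ → ℝ}, HasCompactSupport f → HasCompactSupport fun s => f s ^ 2 := fun hf =>
    hf.comp_left (g := fun t : ℝ => t ^ 2) (by simp)
  have hi : Integrable fun s => g s ^ 2 :=
    (hg.continuous.pow 2).integrable_of_hasCompactSupport (hsq hgs)
  have hi' : Integrable fun s => deriv g s ^ 2 :=
    ((hg.continuous_deriv (by simp)).pow 2).integrable_of_hasCompactSupport (hsq hgs.deriv)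
  have hA : 0 < ∫ s, g s ^ 2 :=
    (hg.continuous.pow 2).integral_pos_of_hasCompactSupport_nonneg_nonzero (hsq hgs)
      (fun s => sq_nonneg _) (pow_ne_zero 2 hg1)
  have : (1 : ℝ) ≤ C := one_le_of_forall_le hA fun L hL =>
    integral_sq_le_of_hardyDirac hm hC hg hz hi hi' hL
  exact_mod_cast this

end

/-! ### The theorem -/

theorem theorem5p1 (m ε e : ℝ) (hm : 0 ≤ m) (hε : 0 < ε) (he : e = ε ∨ e = -ε) :
    -- the weighted inequality for a general positive radial weight
    (∀ V : ℝ → ℝ, Measurable V → (∀ r : ℝ, 0 < r → 0 < V r) →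
      radialSupNorm (hPlus V) ≤ 1 / 2 → radialSupNorm (hMinus V) ≤ 1 / 2 →
      ∀ ψ G : Space3 → Spinor, MemLp ψ 2 volume → HasWeakDirac ψ G →
        ∫⁻ x, ENNReal.ofReal (V ‖x‖) * ‖ψ x‖ₑ ^ 2 ≤
          (∫⁻ x, ENNReal.ofReal (V ‖x‖)⁻¹ * ‖massiveDirac m e ψ G x‖ₑ ^ 2) +
            ENNReal.ofReal (Real.sqrt (m ^ 2 + ε ^ 2)) *
              (∫⁻ x, ‖((hMinus V ‖x‖).toReal - (hPlus V ‖x‖).toReal) • ψ x‖ₑ ^ 2) ^ (1 / 2 : ℝ) *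
              (∫⁻ x, ‖ψ x‖ₑ ^ 2) ^ (1 / 2 : ℝ)) ∧
    -- for `V = 1 / |x|` both averages are identically `1 / 2`
    (∀ r : ℝ, 0 < r →
      hPlus (fun t => 1 / t) r = 1 / 2 ∧ hMinus (fun t => 1 / t) r = 1 / 2) ∧
    -- the resulting Hardy-Dirac inequality
    (∀ ψ G : Space3 → Spinor, MemLp ψ 2 volume → HasWeakDirac ψ G →
      ∫⁻ x, ENNReal.ofReal (1 / ‖x‖) * ‖ψ x‖ₑ ^ 2 ≤
        ∫⁻ x, ENNReal.ofReal ‖x‖ * ‖massiveDirac' m e ψ G x‖ₑ ^ 2) ∧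
    -- its constant cannot be improved
    (∀ C : ℝ≥0,
      (∀ ψ G : Space3 → Spinor, MemLp ψ 2 volume → HasWeakDirac ψ G →
        ∫⁻ x, ENNReal.ofReal (1 / ‖x‖) * ‖ψ x‖ₑ ^ 2 ≤
          (C : ℝ≥0∞) * ∫⁻ x, ENNReal.ofReal ‖x‖ * ‖massiveDirac' m e ψ G x‖ₑ ^ 2) →
      1 ≤ C) := by
  have he0 : e ≠ 0 := by
    rcases he with rfl | rfl
    · exact hε.ne'
    · exact neg_ne_zero.2 hε.ne'
  refine ⟨fun V hV hpos hP hM ψ G hψ h => ?_, fun r hr => hPlus_hMinus_inv hr,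
    fun ψ G hψ h => ?_, fun C hC => one_le_of_hardyDirac hm hC⟩
  -- The stronger inequality without the term in `h⁻ - h⁺` is available; that term is non-negative
  -- and is only added on the right.
  · exact (lintegral_weight_le_lintegral_dirac (AveragesLeHalf.of_radialSupNorm hV hpos hP hM)
      hψ h he0).trans le_self_add
  · refine (lintegral_weight_le_lintegral_dirac (m := m) averagesLeHalf_inv hψ h he0).trans
      (le_of_eq (lintegral_congr fun x => ?_))
    rw [enorm_massiveDirac', one_div, inv_inv]
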